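/- Let $n\ge 0$, $z\in\mathbb C^n$ and $g\in U(n)$. On $L^2(\mathbb R^n)$ consider the following operators. * The harmonic oscillator $H=\frac12\sum_{j=1}^n(-\partial_{x_j}^2+x_j^2)$ and its heat semigroup $e^{-tH}$, $t>0$. * The Heisenberg–Weyl operator $T_zu(x)=e^{ik\cdot x-ia\cdot k/2}u(x-a)$, where $z=a-ik$ with $a,k\in\mathbb R^n$. * The metaplectic operator $R_g=e^{i\operatorname{tr}A/2}\exp(-i\widehat H_{A,B})$. Here $g=\exp(B+iA)$ with $A$ real symmetric and $B$ real skew-symmetric, and $\widehat H_{A,B}$ is the Weyl quantization of the quadratic Hamiltonian $\frac12(x,p)\begin{pmatrix}A&-B\\B&A\end{pmatrix}\begin{pmatrix}x\\p\end{pmatrix}$. Such $A,B$ exist for every $g$, and $R_g$ does not depend on their choice. Write $(v,w)=\sum_j v_j\overline{w_j}$ on $\mathbb C^n$. Let $\mathbb C^n_g=\{w: gw=w\}$ and $m=n-\dim_{\mathbb C}\mathbb C^n_g$. Whenever $g=h\,\mathrm{diag}(e^{i\varphi_1},\dots,e^{i\varphi_m},1,\dots,1)\,h^{-1}$ with $h\in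 U(n)$ and $\varphi_1,\dots,\varphi_m\in(0,2\pi)$, let $e_1,\dots,e_n$ be the columns of $h$; thus $e_1,\dots,e_m$ is an orthonormal system of eigenvectors for the eigenvalues $e^{i\varphi_j}\neq1$. 1. For every $t>0$ the operator $T_zR_ge^{-tH}$ is of trace class. If the affine map $w\mapsto gw+z$ has no fixed point in $\mathbb C^n$, then, as $t\to0^+$, $\operatorname{Tr}(T_zR_ge^{-tH})=O(t^N)$ for every $N\in\mathbb N$. If it has a fixed point, then for every diagonalization of $g$ as above $$\operatorname{Tr}(T_zR_ge^{-tH})\sim t^{-(n-m)}\prod_{j=1}^m\frac{e^{\frac i4|(z,e_j)|^2\cot(\varphi_j/2)}}{1-e^{-i\varphi_j}}\qquad(t\to0^+),$$ in the sense that the quotient of the two sides tends to $1$. 2. For every such diagonalization $(z,e_j)=(h^{-1}z)_j$ for all $j$, and $w\mapsto gw+z$ has a fixed point if and only if $(z,e_j)=0$ for all $j>m$. Equivalently, it has a fixed point if and only if $z$ is orthogonal to $\mathbb C^n_g$. 3. Let $B=\sum_{|\alpha|+|\beta|\le d}c_{\alpha\beta}x^\alpha\partial_x^\beta$, $c_{\alpha\beta}\in\mathbb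 C$, be a differential operator with polynomial coefficients of order at most $d\in\mathbb N$, where the powers of $x$ and of $\partial_x$ both count for the order. Then for every $t>0$ the operator $T_zR_ge^{-tH}$ maps $L^2(\mathbb R^n)$ to Schwartz functions, and $BT_zR_ge^{-tH}$ is a bounded operator of trace class on $L^2(\mathbb R^n)$. As $t\to0^+$, $\operatorname{Tr}(BT_zR_ge^{-tH})=O(t^N)$ for every $N\in\mathbb N$ if $w\mapsto gw+z$ has no fixed point, and $\operatorname{Tr}(BT_zR_ge^{-tH})=O(t^{-(n-m+d/2)})$ otherwise. -/

import Mathlib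

open MeasureTheory Filter Topology Asymptotics
open scoped SchwartzMap ENNReal InnerProductSpace

namespace HeatTrace

noncomputable section

/-- The Hilbert space `L²(ℝⁿ)` with respect to Lebesgue measure. -/
abbrev L2 (n : ℕ) : Type := Lp ℂ 2 (volume : Measure (EuclideanSpace ℝ (Fin n)))

/-- The Schwartz space `𝓢(ℝⁿ)` of complex valued functions. -/
abbrev Sch (n : ℕ) : Type := 𝓢(EuclideanSpace ℝ (Fin n), ℂ)

/-- The class in `L²(ℝⁿ)` of a Schwartz function. -/
def toL2 {n : ℕ} (f : Sch n) : L2 n := f.toLp 2 volume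

/-! ### Trace class operators and the trace -/

/-- A bounded operator `X` on a Hilbert space is of trace class if `Tr |X| < ∞`, where
`|X| = (X* X)^{1/2}`. -/
def IsTraceClass {E : Type*} [NormedAddCommGroup E] [InnerProductSpace ℂ E] [CompleteSpace E]
    (X : E →L[ℂ] E) : Prop :=
  ∀ (w : Set E) (b : HilbertBasis w ℂ E), Summable fun i => (⟪b i, (CFC.abs X) (b i)⟫_ℂ).re

/-- `X` is of trace class and its trace is `τ`: in every orthonormal basis `(b i)` one has
`∑ i, ⟨b i, X (b i)⟩ = τ`. -/
def HasTrace {E : Type*} [NormedAddCommGroup E] [InnerProductSpace ℂ E] [CompleteSpace E]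
    (X : E →L[ℂ] E) (τ : ℂ) : Prop :=
  IsTraceClass X ∧
    ∀ (w : Set E) (b : HilbertBasis w ℂ E), HasSum (fun i => ⟪b i, X (b i)⟫_ℂ) τ

/-! ### Differential operators with polynomial coefficients -/

/-- Multiplication by the coordinate `x_j` on the Schwartz space. -/
def mulX {n : ℕ} (j : Fin n) : Sch n →L[ℂ] Sch n :=
  SchwartzMap.smulLeftCLM ℂ (fun x : EuclideanSpace ℝ (Fin n) => (x j : ℂ))

/-- The partial derivative `∂/∂x_j` on the Schwartz space. -/
def partialD {n : ℕ} (j : Fin n) : Sch n →L[ℂ] Sch n :=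
  LineDeriv.lineDerivOpCLM ℂ (Sch n) (EuclideanSpace.single j (1 : ℝ))

theorem mulX_apply {n : ℕ} (j : Fin n) (f : Sch n) (x : EuclideanSpace ℝ (Fin n)) :
    mulX j f x = (x j : ℂ) * f x := by
  have h : (fun x : EuclideanSpace ℝ (Fin n) => (x j : ℂ)).HasTemperateGrowth :=
    (Complex.ofRealCLM.comp (EuclideanSpace.proj j : _ →L[ℝ] ℝ)).hasTemperateGrowth
  simp [mulX, SchwartzMap.smulLeftCLM_apply_apply h]

theorem partialD_apply {n : ℕ} (j : Fin n) (f : Sch n) (x : EuclideanSpace ℝ (Fin n)) :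
    partialD j f x = fderiv ℝ f x (EuclideanSpace.single j (1 : ℝ)) := by
  simp [partialD, LineDeriv.lineDerivOpCLM_apply, SchwartzMap.lineDerivOp_apply_eq_fderiv]

/-- The operator `x^α ∂^β` on the Schwartz space, `α, β` multi-indices. -/
def diffMonomial {n : ℕ} (α β : Fin n → ℕ) : Sch n →L[ℂ] Sch n :=
  ((List.finRange n).map fun j => mulX j ^ α j).prod *
    ((List.finRange n).map fun j => partialD j ^ β j).prod

/-- The (Shubin type) differential operators of order at most `d`: the linear combinations
`∑_{|α| + |β| ≤ d} c_{αβ} x^α ∂^β` with complex coefficients, where both the powers of `x` and of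
`∂` count for the order. (A differential operator is of Shubin type precisely if its coefficients
are polynomials.) -/
def diffOps (n d : ℕ) : Submodule ℂ (Sch n →L[ℂ] Sch n) :=
  Submodule.span ℂ {P | ∃ α β : Fin n → ℕ, ∑ j, α j + ∑ j, β j ≤ d ∧ P = diffMonomial α β}

/-! ### Exponentials of differential operators -/

/-- `U` is a strongly continuous contraction semigroup on `L²(ℝⁿ)` whose generator extends the
operator `P`, given on Schwartz functions. -/
structure IsContractionSemigroup {n : ℕ} (P : Sch n →L[ℂ] Sch n) (U : ℝ → L2 n →L[ℂ] L2 n) :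
    Prop where
  map_zero : U 0 = 1
  map_add : ∀ s t : ℝ, 0 ≤ s → 0 ≤ t → U (s + t) = U s * U t
  norm_le_one : ∀ t : ℝ, 0 ≤ t → ‖U t‖ ≤ 1
  continuousOn : ∀ f : L2 n, ContinuousOn (fun t => U t f) (Set.Ici 0)
  hasDerivWithinAt : ∀ f : Sch n,
    HasDerivWithinAt (fun t => U t (toL2 f)) (toL2 (P f)) (Set.Ici 0) 0

open Classical in
/-- The operator `e^{tP}` on `L²(ℝⁿ)`, `t ≥ 0`: the contraction semigroup generated by `P`.
For the operators `P = -H` and `P = -iĤ` below, `H` and `Ĥ` are essentially self-adjoint on the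
Schwartz space, so that there is exactly one such semigroup, namely the one given by the functional
calculus of the closure. -/
def expOp {n : ℕ} (P : Sch n →L[ℂ] Sch n) (t : ℝ) : L2 n →L[ℂ] L2 n :=
  if h : ∃ U, IsContractionSemigroup P U then h.choose t else 0

/-- The harmonic oscillator `H = ½ ∑_j (-∂_j² + x_j²)`. -/
def harmonicOsc (n : ℕ) : Sch n →L[ℂ] Sch n :=
  (1 / 2 : ℂ) • ∑ j : Fin n, (mulX j ^ 2 - partialD j ^ 2)

/-- The heat operator `e^{-tH}` on `L²(ℝⁿ)`. -/
def heatOp (n : ℕ) (t : ℝ) : L2 n →L[ℂ] L2 n := expOp (-harmonicOsc n) t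

/-! ### Heisenberg-Weyl operators -/

theorem memLp_phase {n : ℕ} (θ : EuclideanSpace ℝ (Fin n) → ℝ) (hθ : Continuous θ) (f : L2 n) :
    MemLp (fun x => Complex.exp (Complex.I * θ x) * f x) 2 volume := by
  have hc : Continuous fun x => Complex.exp (Complex.I * θ x) := by fun_prop
  refine (Lp.memLp f).of_le (hc.aestronglyMeasurable.mul (Lp.aestronglyMeasurable f))
    (Eventually.of_forall fun x => ?_)
  rw [norm_mul, mul_comm Complex.I, Complex.norm_exp_ofReal_mul_I, one_mul]

/-- Multiplication by `e^{iθ(x)}` on `L²(ℝⁿ)`, for a continuous real function `θ`. -/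
def phaseMul {n : ℕ} (θ : EuclideanSpace ℝ (Fin n) → ℝ) (hθ : Continuous θ) :
    L2 n →L[ℂ] L2 n :=
  LinearMap.mkContinuous
    { toFun := fun f => (memLp_phase θ hθ f).toLp
      map_add' := fun f g => by
        rw [← MemLp.toLp_add]
        refine MemLp.toLp_congr _ _ ?_
        filter_upwards [Lp.coeFn_add f g] with x hx
        simp only [hx, Pi.add_apply, mul_add]
      map_smul' := fun c f => by
        rw [RingHom.id_apply, ← MemLp.toLp_const_smul]
        refine MemLp.toLp_congr _ _ ?_
        filter_upwards [Lp.coeFn_smul c f] with x hx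
        simp only [hx, Pi.smul_apply, smul_eq_mul]
        ring }
    1 (fun f => by
      rw [one_mul]
      refine Lp.norm_le_norm_of_ae_le ?_
      filter_upwards [(memLp_phase θ hθ f).coeFn_toLp] with x hx
      simp only [LinearMap.coe_mk, AddHom.coe_mk]
      rw [hx, norm_mul, mul_comm Complex.I, Complex.norm_exp_ofReal_mul_I, one_mul])

theorem phaseMul_coeFn {n : ℕ} (θ : EuclideanSpace ℝ (Fin n) → ℝ) (hθ : Continuous θ)
    (f : L2 n) : phaseMul θ hθ f =ᵐ[volume] fun x => Complex.exp (Complex.I * θ x) * f x :=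
  (memLp_phase θ hθ f).coeFn_toLp

/-- Translation `u(x) ↦ u(x - a)` on `L²(ℝⁿ)`. -/
def translation {n : ℕ} (a : EuclideanSpace ℝ (Fin n)) : L2 n →L[ℂ] L2 n :=
  (Lp.compMeasurePreservingₗᵢ ℂ (fun x => x - a)
    (measurePreserving_sub_right volume a)).toContinuousLinearMap

/-- The real vector `a` in `z = a - ik`. -/
def reVec {n : ℕ} (z : Fin n → ℂ) : EuclideanSpace ℝ (Fin n) :=
  WithLp.toLp 2 fun j => (z j).re

/-- The real vector `k` in `z = a - ik`. -/
def kVec {n : ℕ} (z : Fin n → ℂ) : EuclideanSpace ℝ (Fin n) :=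
  WithLp.toLp 2 fun j => -(z j).im

/-- The Heisenberg-Weyl operator `T_z u(x) = e^{ikx - iak/2} u(x - a)`, `z = a - ik`. -/
def weylT {n : ℕ} (z : Fin n → ℂ) : L2 n →L[ℂ] L2 n :=
  phaseMul (fun x => ∑ j, kVec z j * x j - (∑ j, reVec z j * kVec z j) / 2) (by fun_prop) ∘L
    translation (reVec z)

theorem weylT_coeFn {n : ℕ} (z : Fin n → ℂ) (f : L2 n) :
    weylT z f =ᵐ[volume] fun x =>
      Complex.exp (Complex.I * ((∑ j, kVec z j * x j - (∑ j, reVec z j * kVec z j) / 2 : ℝ) : ℂ)) *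
        f (x - reVec z) := by
  have h1 := phaseMul_coeFn
    (fun x => ∑ j, kVec z j * x j - (∑ j, reVec z j * kVec z j) / 2) (by fun_prop)
    (translation (reVec z) f)
  have h2 := Lp.coeFn_compMeasurePreserving f
    (measurePreserving_sub_right (volume : Measure (EuclideanSpace ℝ (Fin n))) (reVec z))
  filter_upwards [h1, h2] with x hx1 hx2
  refine hx1.trans ?_
  congr 1

/-! ### Metaplectic operators -/

/-- The quantized phase space coordinates `(x, p)`: multiplication by `x_j`, and `p_j = -i∂_j`. -/
def phaseCoord {n : ℕ} : Fin n ⊕ Fin n → (Sch n →L[ℂ] Sch n)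
  | Sum.inl j => mulX j
  | Sum.inr j => -Complex.I • partialD j

/-- The Weyl quantization of the quadratic Hamiltonian `½ (x,p) M (x,p)ᵀ`: every product of two
phase space coordinates is replaced by the symmetrized product of the operators. -/
def weylQuadratic {n : ℕ} (M : Matrix (Fin n ⊕ Fin n) (Fin n ⊕ Fin n) ℝ) :
    Sch n →L[ℂ] Sch n :=
  (1 / 2 : ℂ) • ∑ a, ∑ b, (M a b : ℂ) •
    ((1 / 2 : ℂ) • (phaseCoord a * phaseCoord b + phaseCoord b * phaseCoord a))

/-- The data `(A, B)`, `A` real symmetric and `B` real skew-symmetric, with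
`g = exp (B + iA)`. -/
def IsLogarithm {n : ℕ} (g : Matrix (Fin n) (Fin n) ℂ)
    (AB : Matrix (Fin n) (Fin n) ℝ × Matrix (Fin n) (Fin n) ℝ) : Prop :=
  AB.1.transpose = AB.1 ∧ AB.2.transpose = -AB.2 ∧
    g = NormedSpace.exp (AB.2.map ((↑) : ℝ → ℂ) + Complex.I • AB.1.map ((↑) : ℝ → ℂ))

open Classical in
/-- The metaplectic operator `R_g = exp(-iĤ) exp(i tr A / 2)` of the unitary matrix
`g = exp (B + iA)`, where `Ĥ` is the Weyl quantization of the Hamiltonian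
`½ (x,p) (A, -B; B, A) (x,p)ᵀ`. Every unitary matrix has such a logarithm `B + iA`, and `R_g` does
not depend on its choice. -/
def metaplecticR {n : ℕ} (g : Matrix.unitaryGroup (Fin n) ℂ) : L2 n →L[ℂ] L2 n :=
  if h : ∃ AB, IsLogarithm (g : Matrix (Fin n) (Fin n) ℂ) AB then
    Complex.exp (Complex.I * (h.choose.1.trace : ℂ) / 2) •
      expOp (-Complex.I • weylQuadratic
        (Matrix.fromBlocks h.choose.1 (-h.choose.2) h.choose.2 h.choose.1)) 1
  else 0

/-! ### The operators and the data of the heat trace asymptotics -/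

/-- The Hermitian product `(z, w) = ∑ z_j \bar w_j` on `ℂⁿ`. -/
def herm {n : ℕ} (z w : Fin n → ℂ) : ℂ := ∑ j, z j * star (w j)

/-- The affine map `w ↦ g w + z` has a fixed point. -/
def HasFixedPoint {n : ℕ} (g : Matrix.unitaryGroup (Fin n) ℂ) (z : Fin n → ℂ) : Prop :=
  ∃ w : Fin n → ℂ, (g : Matrix (Fin n) (Fin n) ℂ).mulVec w + z = w

/-- The fixed point set `ℂⁿ_g` of `g`. -/
def fixedSpace {n : ℕ} (g : Matrix.unitaryGroup (Fin n) ℂ) : Submodule ℂ (Fin n → ℂ) :=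
  LinearMap.eqLocus (Matrix.mulVecLin (g : Matrix (Fin n) (Fin n) ℂ)) LinearMap.id

/-- The number `m = n - dim ℂⁿ_g`. -/
def movedDim {n : ℕ} (g : Matrix.unitaryGroup (Fin n) ℂ) : ℕ :=
  n - Module.finrank ℂ (fixedSpace g)

/-- `g = h diag(e^{iφ_1}, …, e^{iφ_m}, 1, …, 1) h⁻¹` with `m = n - dim ℂⁿ_g`, `h` unitary,
`φ_1, …, φ_m ∈ (0, 2π)` and `φ_{m+1} = … = φ_n = 0` (the indices start at `0` here). -/
structure IsDiagonalization {n : ℕ} (g h : Matrix.unitaryGroup (Fin n) ℂ) (φ : Fin n → ℝ) :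
    Prop where
  eq : (g : Matrix (Fin n) (Fin n) ℂ) = (h : Matrix (Fin n) (Fin n) ℂ) *
    Matrix.diagonal (fun j => Complex.exp (Complex.I * φ j)) *
      ((h⁻¹ : Matrix.unitaryGroup (Fin n) ℂ) : Matrix (Fin n) (Fin n) ℂ)
  angle_mem : ∀ j : Fin n, (j : ℕ) < movedDim g → φ j ∈ Set.Ioo 0 (2 * Real.pi)
  angle_eq_zero : ∀ j : Fin n, movedDim g ≤ (j : ℕ) → φ j = 0

/-- The `j`-th column `e_j` of `h`. -/
def eigvec {n : ℕ} (h : Matrix.unitaryGroup (Fin n) ℂ) (j : Fin n) : Fin n → ℂ :=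
  fun i => (h : Matrix (Fin n) (Fin n) ℂ) i j

/-- The operator `T_z R_g e^{-tH}` on `L²(ℝⁿ)`. -/
def twistedHeat {n : ℕ} (z : Fin n → ℂ) (g : Matrix.unitaryGroup (Fin n) ℂ) (t : ℝ) :
    L2 n →L[ℂ] L2 n :=
  weylT z ∘L metaplecticR g ∘L heatOp n t

/-- The bounded operator `Y` is the composition `B X` of the bounded operator `X` on `L²(ℝⁿ)` with
the differential operator `B`, defined on the Schwartz space: `X` maps `L²(ℝⁿ)` to Schwartz
functions, and `Y f = B (X f)` for all `f`. -/
def IsDiffOpComp {n : ℕ} (B : Sch n →L[ℂ] Sch n) (X Y : L2 n →L[ℂ] L2 n) : Prop :=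
  ∀ f : L2 n, ∃ u : Sch n, X f = toL2 u ∧ Y f = toL2 (B u)

/-- `τ(t) = O(t^∞)` as `t → 0⁺`. -/
def IsBigOInfty (τ : ℝ → ℂ) : Prop :=
  ∀ N : ℕ, τ =O[𝓝[>] (0 : ℝ)] fun t => t ^ N

end

end HeatTrace

open HeatTrace

namespace HeatTrace

noncomputable section

/-! ### Exponential vectors -/

/-! Everything is computed on the exponential vectors ε_w (`coh w`), the Gaussians that generate the
Hermite functions. They satisfy ⟨ε_w, ε_v⟩ = exp(w̄·v) (`inner_coh`), they are total in L²
(`eq_zero_of_inner_coh`), and a_j ε_w = w_j ε_w. All three operators of the theorem send an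
exponential vector to a multiple of another one.

In terms of creation and annihilation operators, -H = dΓ(-1) - n/2 and -iĤ = dΓ(B - iA) - i tr A/2
(`harmonicOsc_eq`, `weylQuadratic_eq`). The semigroup of dΓ(K) is Γ(e^{tK}), where Γ(C) ε_w =
ε_{Cw}. It is the only contraction semigroup with this generator on Schwartz functions, because the
orbits of exponential vectors stay Schwartz (`IsContractionSemigroup.eq_of_schwartz_orbit`,
`expOp_dGamma`). Hence e^{-tH} = e^{-tn/2} Γ(e^{-t}) and R_g = Γ(ḡ), the phase e^{i tr A/2}
cancelling the constant of Weyl ordering. Finally T_z shifts w by η = z̄/√2, up to a scalar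
(`weylS_coh`).

The coherent states resolve the identity (`integral_inner_cohState`), so a trace is the integral of
the diagonal coherent state matrix elements (`hasSum_inner_of_integrable`). Trace class follows from
splitting off e^{-tH/2}, a positive operator of finite trace. In coordinates diagonalizing ḡ the
integral for T_z R_g e^{-tH} is a Gaussian that factors over the eigenvalues. With q = e^{-t-iφ} and
a = |(z, e_j)|², one factor is e^{-t/2} (1-q)^{-1} exp(-(a/4)(1+q)/(1-q))
(`gaussFactor_mul_integral`). If φ ≠ 0, it converges, and (1+q)/(1-q) tends to -i cot(φ/2). If φ =
0, it behaves like 1/t when a = 0 and is flat when a > 0. Since gw + z = w is diagonal in the same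
coordinates, a fixed point exists exactly when a = 0 for every j with φ_j = 0.

For a differential operator, normal ordering turns the integrand into the same Gaussian times at
most d affine forms. The complex Gaussian moments obey a recursion bounding them by ρ^k times the
zeroth moment itself, not its absolute version (`exists_norm_gmom_le`), so the factor asymptotics
carry over. With a fixed point ρ = 2t^{-1/2} is admissible, which costs t^{-d/2}; without one, ρ of
size 1/t is harmless against a flat factor. -/

/-- The exponent of the exponential vector. -/
def expo {n : ℕ} (w : Fin n → ℂ) (x : EuclideanSpace ℝ (Fin n)) : ℂ :=
  ∑ j, (-(x j : ℂ) ^ 2 / 2 + √2 * w j * x j - w j ^ 2 / 2)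

/-- The normalization constant `π^{-n/4}` of the exponential vectors. -/
def cohConst (n : ℕ) : ℝ := Real.pi ^ (-(n : ℝ) / 4)

theorem cohConst_pos (n : ℕ) : 0 < cohConst n := Real.rpow_pos_of_pos Real.pi_pos _

theorem contDiff_expo_comp {F : Type*} [NormedAddCommGroup F] [NormedSpace ℝ F] {n : ℕ}
    {f : F → Fin n → ℂ} {g : F → EuclideanSpace ℝ (Fin n)} (hf : ContDiff ℝ ⊤ f)
    (hg : ContDiff ℝ ⊤ g) : ContDiff ℝ ⊤ (fun p => expo (f p) (g p)) := by
  unfold expo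
  have h1 : ∀ j, ContDiff ℝ ⊤ (fun p => ((g p j : ℝ) : ℂ)) := fun j =>
    Complex.ofRealCLM.contDiff.comp
      ((EuclideanSpace.proj (𝕜 := ℝ) j : _ →L[ℝ] ℝ).contDiff.comp hg)
  refine ContDiff.sum fun j _ => ?_
  have := h1 j
  fun_prop

theorem contDiff_expo_right {n : ℕ} (w : Fin n → ℂ) : ContDiff ℝ ⊤ (expo w) :=
  contDiff_expo_comp contDiff_const contDiff_id

/-- The derivative of the exponent. -/
def dexpo {n : ℕ} (w : Fin n → ℂ) (x : EuclideanSpace ℝ (Fin n)) :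
    EuclideanSpace ℝ (Fin n) →L[ℝ] ℂ :=
  ∑ j, (EuclideanSpace.proj (𝕜 := ℝ) j : EuclideanSpace ℝ (Fin n) →L[ℝ] ℝ).smulRight
    (-(x j : ℂ) + √2 * w j)

theorem dexpo_apply {n : ℕ} (w : Fin n → ℂ) (x v : EuclideanSpace ℝ (Fin n)) :
    dexpo w x v = ∑ j, (v j : ℂ) * (-(x j : ℂ) + √2 * w j) := by
  simp only [dexpo, sum_apply, ContinuousLinearMap.smulRight_apply, Complex.real_smul]
  rfl

theorem hasFDerivAt_expo {n : ℕ} (w : Fin n → ℂ) (x : EuclideanSpace ℝ (Fin n)) :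
    HasFDerivAt (expo w) (dexpo w x) x := by
  unfold expo dexpo
  refine HasFDerivAt.fun_sum fun j _ => ?_
  have h : HasFDerivAt (fun y : EuclideanSpace ℝ (Fin n) => y j)
    (EuclideanSpace.proj (𝕜 := ℝ) j : EuclideanSpace ℝ (Fin n) →L[ℝ] ℝ) x :=
    (EuclideanSpace.proj (𝕜 := ℝ) j : EuclideanSpace ℝ (Fin n) →L[ℝ] ℝ).hasFDerivAt
  have h2 : HasDerivAt (fun s : ℝ => -(s : ℂ) ^ 2 / 2 + √2 * w j * s - w j ^ 2 / 2)
      (-(x j : ℂ) + √2 * w j) (x j) := by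
    have e := Complex.ofRealCLM.hasDerivAt (x := x j)
    have := (((e.pow 2).neg.div_const 2).add (e.const_mul (√2 * w j))).sub_const (w j ^ 2 / 2)
    convert! this using 1
    simp
    ring
  have h3 := h2.hasFDerivAt.comp x h
  convert! h3 using 1

/-- The sum of the absolute values of the coordinates. -/
def absSum {n : ℕ} (w : Fin n → ℂ) : ℝ := ∑ j, ‖w j‖

/-- The square of the Euclidean norm. -/
def sqSum {n : ℕ} (w : Fin n → ℂ) : ℝ := ∑ j, ‖w j‖ ^ 2

theorem absSum_nonneg {n : ℕ} (w : Fin n → ℂ) : 0 ≤ absSum w :=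
  Finset.sum_nonneg fun _ _ => norm_nonneg _

theorem norm_dexpo_le {n : ℕ} (w : Fin n → ℂ) (x : EuclideanSpace ℝ (Fin n)) :
    ‖dexpo w x‖ ≤ n * ‖x‖ + 2 * absSum w := by
  have h2 : √2 ≤ (2 : ℝ) := by
    rw [Real.sqrt_le_left (by norm_num)]; norm_num
  refine ContinuousLinearMap.opNorm_le_bound _
    (by have := absSum_nonneg w; positivity) fun v => ?_
  rw [dexpo_apply]
  calc ‖∑ j, (v j : ℂ) * (-(x j : ℂ) + √2 * w j)‖
      ≤ ∑ j, ‖(v j : ℂ) * (-(x j : ℂ) + √2 * w j)‖ := norm_sum_le _ _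
    _ ≤ ∑ j, ‖v‖ * (‖x‖ + 2 * ‖w j‖) := by
        refine Finset.sum_le_sum fun j _ => ?_
        rw [norm_mul, Complex.norm_real]
        have a1 : ‖v j‖ ≤ ‖v‖ := PiLp.norm_apply_le v j
        have a2 : ‖x j‖ ≤ ‖x‖ := PiLp.norm_apply_le x j
        have a3 : ‖-(x j : ℂ) + √2 * w j‖ ≤ ‖x‖ + 2 * ‖w j‖ := by
          refine (norm_add_le _ _).trans ?_
          rw [norm_neg, norm_mul, Complex.norm_real, Complex.norm_real,
            Real.norm_of_nonneg (Real.sqrt_nonneg 2)]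
          gcongr
        gcongr
    _ = (n * ‖x‖ + 2 * absSum w) * ‖v‖ := by
        rw [← Finset.mul_sum, Finset.sum_add_distrib, ← Finset.mul_sum]
        simp [absSum, mul_comm]

theorem fderiv_expo {n : ℕ} (w : Fin n → ℂ) : fderiv ℝ (expo w) = dexpo w :=
  funext fun x => (hasFDerivAt_expo w x).fderiv

/-- The linear part of `dexpo`. -/
def ddexpo (n : ℕ) : EuclideanSpace ℝ (Fin n) →L[ℝ] EuclideanSpace ℝ (Fin n) →L[ℝ] ℂ :=
  LinearMap.mkContinuous
    { toFun := fun x => dexpo 0 x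
      map_add' := fun x y => by
        ext v; simp [dexpo_apply, mul_add, Finset.sum_add_distrib]; ring
      map_smul' := fun c x => by
        ext v; simp [dexpo_apply, Finset.mul_sum, mul_left_comm] }
    n (fun x => by simpa [absSum] using norm_dexpo_le 0 x)

theorem dexpo_eq {n : ℕ} (w : Fin n → ℂ) : dexpo w = fun x => ddexpo n x + dexpo w 0 := by
  funext x
  ext v
  simp only [ddexpo, dexpo_apply, add_apply, LinearMap.mkContinuous_apply,
    LinearMap.coe_mk, AddHom.coe_mk, ← Finset.sum_add_distrib]
  exact Finset.sum_congr rfl fun j _ => by simp; ring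

theorem fderiv_dexpo {n : ℕ} (w : Fin n → ℂ) : fderiv ℝ (dexpo w) = fun _ => ddexpo n := by
  rw [dexpo_eq]
  funext x
  rw [fderiv_add_const, ContinuousLinearMap.fderiv]

theorem norm_ddexpo_le (n : ℕ) : ‖ddexpo n‖ ≤ n := LinearMap.mkContinuous_norm_le _ (by simp) _

/-- The exponent is quadratic, so derivatives of order three and higher vanish. The geometric form
of the bound is what `norm_iteratedFDeriv_comp_le` requires of the inner function. -/
theorem norm_iteratedFDeriv_expo_le {n : ℕ} (w : Fin n → ℂ) (x : EuclideanSpace ℝ (Fin n))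
    {i : ℕ} (hi : 1 ≤ i) :
    ‖iteratedFDeriv ℝ i (expo w) x‖ ≤ ((n + 1) * (1 + ‖x‖ + 2 * absSum w)) ^ i := by
  have hw := absSum_nonneg w
  have h1 : 1 ≤ 1 + ‖x‖ + 2 * absSum w := by linarith [norm_nonneg x]
  have h0 : (n : ℝ) + 1 ≤ (n + 1) * (1 + ‖x‖ + 2 * absSum w) :=
    le_mul_of_one_le_right (by positivity) h1
  have hD : 1 ≤ ((n : ℝ) + 1) * (1 + ‖x‖ + 2 * absSum w) :=
    le_trans (by linarith [(Nat.cast_nonneg n : (0 : ℝ) ≤ n)]) h0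
  obtain ⟨i, rfl⟩ : ∃ k, i = k + 1 := ⟨i - 1, by omega⟩
  rw [← norm_iteratedFDeriv_fderiv, fderiv_expo]
  match i with
  | 0 =>
    rw [norm_iteratedFDeriv_zero, zero_add, pow_one]
    refine (norm_dexpo_le w x).trans ?_
    nlinarith [norm_nonneg x, (Nat.cast_nonneg n : (0 : ℝ) ≤ n),
      mul_nonneg (Nat.cast_nonneg n : (0 : ℝ) ≤ n) hw]
  | 1 =>
    rw [← norm_iteratedFDeriv_fderiv, fderiv_dexpo, norm_iteratedFDeriv_zero]
    refine (norm_ddexpo_le n).trans ((by linarith : (n : ℝ) ≤ n + 1).trans (h0.trans ?_))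
    exact le_self_pow₀ hD (by norm_num)
  | i + 2 =>
    rw [← norm_iteratedFDeriv_fderiv, fderiv_dexpo, iteratedFDeriv_succ_const]
    simp only [Pi.zero_apply, norm_zero]
    positivity

theorem norm_iteratedFDeriv_cexp_le (i : ℕ) (y : ℂ) :
    ‖iteratedFDeriv ℝ i Complex.exp y‖ ≤ ‖Complex.exp y‖ := by
  induction i with
  | zero => rw [norm_iteratedFDeriv_zero]
  | succ i ih =>
    rw [← norm_iteratedFDeriv_fderiv]
    have h : fderiv ℝ Complex.exp = fun y => ContinuousLinearMap.mul ℝ ℂ (Complex.exp y) := by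
      funext y
      have := (Complex.hasDerivAt_exp y).hasFDerivAt.restrictScalars ℝ
      rw [this.fderiv]
      ext v
      all_goals simp [mul_comm]
    rw [h]
    refine ((ContinuousLinearMap.mul ℝ ℂ).norm_iteratedFDeriv_comp_left
      (f := Complex.exp) (n := i) (N := ⊤) ?_ ?_).trans ?_
    · exact (Complex.contDiff_exp (𝕜 := ℝ)).contDiffAt
    · exact le_top
    · exact (mul_le_mul ((ContinuousLinearMap.opNorm_mul ℝ ℂ).le) ih (norm_nonneg _)
        zero_le_one).trans (one_mul _).le

/-- The exponential vectors as functions. -/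
def cohFun {n : ℕ} (w : Fin n → ℂ) (x : EuclideanSpace ℝ (Fin n)) : ℂ :=
  cohConst n * Complex.exp (expo w x)

theorem contDiff_cohFun_comp {F : Type*} [NormedAddCommGroup F] [NormedSpace ℝ F] {n : ℕ}
    {f : F → Fin n → ℂ} {g : F → EuclideanSpace ℝ (Fin n)} (hf : ContDiff ℝ ⊤ f)
    (hg : ContDiff ℝ ⊤ g) : ContDiff ℝ ⊤ (fun p => cohFun (f p) (g p)) :=
  contDiff_const.mul (contDiff_expo_comp hf hg).cexp

theorem contDiff_cohFun_right {n : ℕ} (w : Fin n → ℂ) : ContDiff ℝ ⊤ (cohFun w) :=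
  contDiff_cohFun_comp contDiff_const contDiff_id

/-- Completing the square: the modulus is a real Gaussian centred at √2 Re w, with total weight
exp(|w|²/2). -/
theorem norm_exp_expo {n : ℕ} (w : Fin n → ℂ) (x : EuclideanSpace ℝ (Fin n)) :
    ‖Complex.exp (expo w x)‖ = Real.exp (-‖x - √2 • reVec w‖ ^ 2 / 2 + sqSum w / 2) := by
  rw [Complex.norm_exp]
  congr 1
  rw [EuclideanSpace.norm_sq_eq, sqSum, expo, Complex.re_sum, neg_div, Finset.sum_div,
    Finset.sum_div, ← Finset.sum_neg_distrib, ← Finset.sum_add_distrib]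
  refine Finset.sum_congr rfl fun j _ => ?_
  rw [← Complex.normSq_eq_norm_sq, Complex.normSq_apply]
  have h2 : √2 * √2 = (2 : ℝ) := Real.mul_self_sqrt (by norm_num)
  simp [reVec, pow_two, Complex.mul_re]
  linear_combination ((w j).re ^ 2 / 2) * h2

theorem norm_reVec_le {n : ℕ} (w : Fin n → ℂ) : ‖reVec w‖ ≤ absSum w := by
  have h : reVec w = ∑ j, (w j).re • EuclideanSpace.single j (1 : ℝ) := by
    ext i
    simp [reVec, Pi.single_apply]
  rw [h]
  refine (norm_sum_le _ _).trans (Finset.sum_le_sum fun j _ => ?_)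
  rw [norm_smul]
  simpa using Complex.abs_re_le_norm (w j)

theorem pow_mul_exp_neg_sq_le (m : ℕ) {r : ℝ} (hr : 0 ≤ r) :
    (1 + r) ^ m * Real.exp (-r ^ 2 / 2) ≤ m.factorial * Real.exp 2 := by
  have h1 : (1 + r) ^ m ≤ m.factorial * Real.exp (1 + r) := by
    have := Real.pow_div_factorial_le_exp (1 + r) (by positivity) m
    rwa [div_le_iff₀' (by positivity)] at this
  calc (1 + r) ^ m * Real.exp (-r ^ 2 / 2)
      ≤ m.factorial * Real.exp (1 + r) * Real.exp (-r ^ 2 / 2) := by gcongr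
    _ = m.factorial * Real.exp (1 + r + -r ^ 2 / 2) := by rw [mul_assoc, ← Real.exp_add]
    _ ≤ m.factorial * Real.exp 2 := by
        gcongr
        nlinarith [sq_nonneg (r - 1)]

/-- Every Schwartz seminorm of ε_w grows at the quadratic rate |w|²/2 of the L² norm, up to a linear
exponent that absorbs the polynomial factors. No loss in the quadratic rate is permitted: this is
what lets a strict contraction of w produce Schwartz functions. -/
theorem exists_bound_cohFun (n k l : ℕ) : ∃ C : ℝ, 0 ≤ C ∧
    ∀ (w : Fin n → ℂ) (x : EuclideanSpace ℝ (Fin n)),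
      ‖x‖ ^ k * ‖iteratedFDeriv ℝ l (cohFun w) x‖ ≤
        C * Real.exp (4 * absSum w + sqSum w / 2) := by
  refine ⟨cohConst n * l.factorial * (n + 1) ^ l * ((k + l).factorial * Real.exp 2) *
    ((k + l).factorial * Real.exp 1), by have := cohConst_pos n; positivity, fun w x => ?_⟩
  have hc := cohConst_pos n
  have hs := absSum_nonneg w
  set y := x - √2 • reVec w with hy
  have h2 : √2 ≤ (2 : ℝ) := by
    rw [Real.sqrt_le_left (by norm_num)]; norm_num
  have hx : ‖x‖ ≤ ‖y‖ + 2 * absSum w := by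
    have : x = y + √2 • reVec w := by simp [hy]
    calc ‖x‖ = ‖y + √2 • reVec w‖ := by rw [← this]
      _ ≤ ‖y‖ + √2 * ‖reVec w‖ := by
        refine (norm_add_le _ _).trans ?_
        rw [norm_smul, Real.norm_of_nonneg (Real.sqrt_nonneg 2)]
      _ ≤ _ := by gcongr; exact norm_reVec_le w
  have hd : ‖iteratedFDeriv ℝ l (cohFun w) x‖ ≤ cohConst n * (l.factorial *
      ‖Complex.exp (expo w x)‖ * ((n + 1) * (1 + ‖x‖ + 2 * absSum w)) ^ l) := by
    have e : cohFun w = fun x => (cohConst n : ℝ) • (Complex.exp ∘ expo w) x := by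
      funext x
      simp [cohFun]
    rw [e, iteratedFDeriv_const_smul_apply', norm_smul, Real.norm_of_nonneg hc.le]
    · refine mul_le_mul_of_nonneg_left ?_ hc.le
      exact norm_iteratedFDeriv_comp_le (N := ⊤) (Complex.contDiff_exp (𝕜 := ℝ))
        (contDiff_expo_right w) le_top x (fun i _ => norm_iteratedFDeriv_cexp_le i _)
        (fun i hi _ => norm_iteratedFDeriv_expo_le w x hi)
    · exact ((Complex.contDiff_exp (𝕜 := ℝ) (n := ⊤)).comp
        (contDiff_expo_right w)).contDiffAt.of_le le_top
  have hB : 1 + ‖x‖ + 2 * absSum w ≤ (1 + ‖y‖) * (1 + 4 * absSum w) := by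
    nlinarith [norm_nonneg y, mul_nonneg (norm_nonneg y) hs]
  have hB' : ‖x‖ ≤ 1 + ‖x‖ + 2 * absSum w := by linarith
  have hexp : (1 + 4 * absSum w) ^ (k + l) ≤
      (k + l).factorial * Real.exp 1 * Real.exp (4 * absSum w) := by
    have := Real.pow_div_factorial_le_exp (1 + 4 * absSum w) (by positivity) (k + l)
    rwa [div_le_iff₀' (by positivity), Real.exp_add, ← mul_assoc] at this
  have hy2 := pow_mul_exp_neg_sq_le (k + l) (norm_nonneg y)
  rw [norm_exp_expo, Real.exp_add] at hd
  calc ‖x‖ ^ k * ‖iteratedFDeriv ℝ l (cohFun w) x‖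
      ≤ (1 + ‖x‖ + 2 * absSum w) ^ k * (cohConst n * (l.factorial *
        (Real.exp (-‖y‖ ^ 2 / 2) * Real.exp (sqSum w / 2)) *
          ((n + 1) * (1 + ‖x‖ + 2 * absSum w)) ^ l)) := by gcongr
    _ = cohConst n * l.factorial * (n + 1) ^ l * ((1 + ‖x‖ + 2 * absSum w) ^ (k + l) *
          Real.exp (-‖y‖ ^ 2 / 2)) * Real.exp (sqSum w / 2) := by
        rw [mul_pow, pow_add]; ring
    _ ≤ cohConst n * l.factorial * (n + 1) ^ l * (((1 + ‖y‖) * (1 + 4 * absSum w)) ^ (k + l) *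
          Real.exp (-‖y‖ ^ 2 / 2)) * Real.exp (sqSum w / 2) := by gcongr
    _ = cohConst n * l.factorial * (n + 1) ^ l * (((1 + ‖y‖) ^ (k + l) *
          Real.exp (-‖y‖ ^ 2 / 2)) * (1 + 4 * absSum w) ^ (k + l)) * Real.exp (sqSum w / 2) := by
        rw [mul_pow]; ring
    _ ≤ cohConst n * l.factorial * (n + 1) ^ l * (((k + l).factorial * Real.exp 2) *
          ((k + l).factorial * Real.exp 1 * Real.exp (4 * absSum w))) *
            Real.exp (sqSum w / 2) := by gcongr
    _ = _ := by rw [Real.exp_add]; ring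

/-- The exponential vector `ε_w`, a Schwartz function. -/
def coh {n : ℕ} (w : Fin n → ℂ) : Sch n where
  toFun := cohFun w
  smooth' := (contDiff_cohFun_right w).of_le le_top
  decay' := fun k l => by
    obtain ⟨C, -, hC⟩ := exists_bound_cohFun n k l
    exact ⟨_, fun x => hC w x⟩

theorem coh_apply {n : ℕ} (w : Fin n → ℂ) (x : EuclideanSpace ℝ (Fin n)) :
    coh w x = cohFun w x := rfl

end

end HeatTrace

namespace HeatTrace

noncomputable section

/-! ### Reproducing kernel and totality of the exponential vectors. -/

theorem inner_toL2 {n : ℕ} (f g : Sch n) :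
    ⟪toL2 f, toL2 g⟫_ℂ = ∫ x, (starRingEnd ℂ) (f x) * g x := by
  refine (SchwartzMap.inner_toL2_toL2_eq f g volume).trans ?_
  simp [mul_comm]

-- A product of Gaussian integrals: the linear coefficient √2(w̄ + v) produces (w̄ + v)²/2, from
-- which the constants (w̄² + v²)/2 leave w̄v. The factor `cohConst` is chosen to cancel π^{n/2}.
open Matrix Finset in
theorem inner_coh {n : ℕ} (w v : Fin n → ℂ) :
    ⟪toL2 (coh w), toL2 (coh v)⟫_ℂ = Complex.exp (star w ⬝ᵥ v) := by
  rw [inner_toL2]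
  rw [← (PiLp.volume_preserving_toLp (Fin n)).integral_comp
    (MeasurableEquiv.toLp 2 _).measurableEmbedding]
  have h2 : (√2 : ℂ) ^ 2 = 2 := by
    rw [← Complex.ofReal_pow, Real.sq_sqrt (by norm_num)]; norm_num
  have key : ∀ y : Fin n → ℝ, (starRingEnd ℂ) (coh w (WithLp.toLp 2 y)) * coh v (WithLp.toLp 2 y) =
      ((cohConst n : ℂ) ^ 2 * Complex.exp (-(∑ j, (star (w j) ^ 2 + v j ^ 2) / 2))) *
        Complex.exp (-∑ j, (1 : ℂ) * (y j : ℂ) ^ 2 + ∑ j, (√2 * (star (w j) + v j)) * y j) := by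
    intro y
    rw [coh_apply, coh_apply, cohFun, cohFun, map_mul]
    have e : (starRingEnd ℂ) (Complex.exp (expo w (WithLp.toLp 2 y))) =
        Complex.exp (expo (star w) (WithLp.toLp 2 y)) := by
      rw [← Complex.exp_conj]
      simp [expo, show (starRingEnd ℂ) 2 = 2 from map_ofNat _ 2]
    rw [e]
    simp only [Complex.conj_ofReal]
    rw [mul_mul_mul_comm, ← Complex.exp_add, mul_assoc _ (Complex.exp _) (Complex.exp _),
      ← Complex.exp_add, ← pow_two]
    congr 2
    simp only [expo, ← Finset.sum_neg_distrib, ← Finset.sum_add_distrib]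
    refine Finset.sum_congr rfl fun j _ => ?_
    simp only [Pi.star_apply]
    ring
  simp_rw [key]
  rw [integral_const_mul, GaussianFourier.integral_cexp_neg_sum_mul_add (fun _ => by simp)]
  rw [Finset.prod_mul_distrib, ← Complex.exp_sum, Finset.prod_const]
  have hc : (cohConst n : ℂ) ^ 2 * (((Real.pi : ℂ) / 1) ^ (1 / 2 : ℂ)) ^ (Finset.univ : Finset (Fin n)).card = 1 := by
    have e1 : ((Real.pi : ℂ) / 1) ^ (1 / 2 : ℂ) = ((Real.pi ^ (1 / 2 : ℝ) : ℝ) : ℂ) := by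
      rw [Complex.ofReal_cpow Real.pi_pos.le]; simp
    rw [e1, cohConst, ← Complex.ofReal_pow, ← Complex.ofReal_pow, ← Complex.ofReal_mul,
      ← Real.rpow_natCast, ← Real.rpow_natCast, ← Real.rpow_mul Real.pi_pos.le,
      ← Real.rpow_mul Real.pi_pos.le, ← Real.rpow_add Real.pi_pos]
    simp
    ring_nf
    simp
  calc _ = ((cohConst n : ℂ) ^ 2 * (((Real.pi : ℂ) / 1) ^ (1 / 2 : ℂ)) ^ (Finset.univ : Finset (Fin n)).card) *
        (Complex.exp (-(∑ j, (star (w j) ^ 2 + v j ^ 2) / 2)) *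
          Complex.exp (∑ j, (√2 * (star (w j) + v j)) ^ 2 / (4 * 1))) := by ring
    _ = _ := by
      rw [hc, one_mul, ← Complex.exp_add]
      congr 1
      simp only [dotProduct, ← Finset.sum_neg_distrib, ← Finset.sum_add_distrib]
      refine Finset.sum_congr rfl fun j _ => ?_
      rw [mul_pow, h2]
      simp only [Pi.star_apply]
      ring

/-- A function in `L²(ℝⁿ)` that is orthogonal to all exponential vectors vanishes. -/
theorem eq_zero_of_inner_coh {n : ℕ} (f : L2 n) (hf : ∀ w, ⟪toL2 (coh w), f⟫_ℂ = 0) : f = 0 := by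
  set G : EuclideanSpace ℝ (Fin n) → ℂ := fun x => coh (0 : Fin n → ℂ) x * f x with hG
  have hGi : Integrable G :=
    MemLp.integrable_mul ((coh (0 : Fin n → ℂ)).memLp 2 volume) (Lp.memLp f)
  have hexp : ∀ x : EuclideanSpace ℝ (Fin n), coh (0 : Fin n → ℂ) x =
      cohConst n * Complex.exp (∑ j, -(x j : ℂ) ^ 2 / 2) := fun x => by
    rw [coh_apply, cohFun, expo]; simp
  have hF : ∀ ξ, VectorFourier.fourierIntegral Real.fourierChar volume
      (innerₗ (EuclideanSpace ℝ (Fin n))) G ξ = 0 := by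
    intro ξ
    -- With this purely imaginary w the conjugated exponent contains exactly -2πi ξ·x, so ⟨ε_w, f⟩
    -- is, up to a nonzero scalar, the Fourier transform of G = ε_0 f at ξ.
    set w : Fin n → ℂ := fun j => √2 * Real.pi * Complex.I * ξ j with hw
    have h2 : (√2 : ℂ) ^ 2 = 2 := by
      rw [← Complex.ofReal_pow, Real.sq_sqrt (by norm_num)]; norm_num
    have h0 := hf w
    rw [L2.inner_def] at h0
    have : VectorFourier.fourierIntegral Real.fourierChar volume
        (innerₗ (EuclideanSpace ℝ (Fin n))) G ξ = ∫ x, Complex.exp (∑ j, star (w j) ^ 2 / 2) *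
          ⟪toL2 (coh w) x, f x⟫_ℂ := by
      rw [VectorFourier.fourierIntegral]
      refine integral_congr_ae ?_
      filter_upwards [(coh w).coeFn_toLp 2 volume] with x hx
      rw [toL2, hx, hG, RCLike.inner_apply', coh_apply w, cohFun, map_mul, ← Complex.exp_conj,
        Circle.smul_def, Real.fourierChar_apply, smul_eq_mul]
      simp only [Complex.conj_ofReal]
      rw [hexp]
      have : (starRingEnd ℂ) (expo w x) = ((∑ j, -(x j : ℂ) ^ 2 / 2) +
          ((2 * Real.pi * (-(innerₗ (EuclideanSpace ℝ (Fin n))) x ξ) : ℝ) : ℂ) * Complex.I) -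
            ∑ j, star (w j) ^ 2 / 2 := by
        simp only [innerₗ_apply_apply, PiLp.inner_apply, expo, map_sum, hw]
        push_cast
        rw [← Finset.sum_neg_distrib, Finset.mul_sum, Finset.sum_mul, ← Finset.sum_add_distrib,
          ← Finset.sum_sub_distrib]
        refine Finset.sum_congr rfl fun j _ => ?_
        simp
        rw [show (starRingEnd ℂ) 2 = 2 from map_ofNat _ 2]
        linear_combination (-(Real.pi : ℂ) * Complex.I * ξ j * x j) * h2
      rw [this, Complex.exp_sub, Complex.exp_add]
      field_simp [Complex.exp_ne_zero]
    rw [this, integral_const_mul, h0, mul_zero]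
  have hG0 : ∀ᵐ x, G x = 0 := by
    apply ae_eq_zero_of_integral_contDiff_smul_eq_zero hGi.locallyIntegrable
    intro g hg1 hg2
    have hg₁ : HasCompactSupport (Complex.ofRealCLM ∘ g) := hg2.comp_left rfl
    have hg₂ : ContDiff ℝ (⊤ : ℕ∞) (Complex.ofRealCLM ∘ g) := by fun_prop
    set ψ : Sch n := hg₁.toSchwartzMap hg₂
    -- A test function ψ is the Fourier transform of a Schwartz function, so the transform can be
    -- moved onto G, where it vanishes.
    have h3 := VectorFourier.integral_fourierIntegral_smul_eq_flip
      (L := innerₗ (EuclideanSpace ℝ (Fin n)))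
      (f := G) (g := (FourierTransform.fourierInv ψ : Sch n)) (μ := volume) (ν := volume)
      Real.continuous_fourierChar continuous_inner hGi
      ((FourierTransform.fourierInv ψ : Sch n).integrable)
    simp only [hF, zero_smul, integral_zero, flip_innerₗ] at h3
    rw [h3]
    refine integral_congr_ae (Eventually.of_forall fun x => ?_)
    have h4 : VectorFourier.fourierIntegral Real.fourierChar volume
      (innerₗ (EuclideanSpace ℝ (Fin n))) (FourierTransform.fourierInv ψ : Sch n) x = ψ x := by
      change FourierTransform.fourier ((FourierTransform.fourierInv ψ : Sch n) : EuclideanSpace ℝ (Fin n) → ℂ) x = _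
      rw [← SchwartzMap.fourier_coe]
      simp
    simp only [h4]
    simp [ψ, mul_comm]
  rw [Lp.eq_zero_iff_ae_eq_zero]
  filter_upwards [hG0] with x hx
  rw [hG] at hx
  refine (mul_eq_zero.1 hx).resolve_left ?_
  rw [hexp]
  exact mul_ne_zero (by exact_mod_cast (cohConst_pos n).ne') (Complex.exp_ne_zero _)

/-- Linear combinations of exponential vectors. -/
def cohSum (n : ℕ) : ((Fin n → ℂ) →₀ ℂ) →ₗ[ℂ] L2 n :=
  Finsupp.linearCombination ℂ fun w => toL2 (coh w)

theorem cohSum_single {n : ℕ} (w : Fin n → ℂ) (c : ℂ) :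
    cohSum n (Finsupp.single w c) = c • toL2 (coh w) := by
  simp [cohSum]

theorem denseRange_cohSum (n : ℕ) : DenseRange (cohSum n) := by
  have h : (LinearMap.range (cohSum n))ᗮ = ⊥ := by
    rw [Submodule.eq_bot_iff]
    intro f hf
    refine eq_zero_of_inner_coh f fun w => ?_
    exact (Submodule.mem_orthogonal _ _).1 hf _ ⟨Finsupp.single w 1, by simp [cohSum_single]⟩
  rw [← Submodule.topologicalClosure_eq_top_iff] at h
  have := Submodule.dense_iff_topologicalClosure_eq_top.2 h
  rwa [DenseRange, ← LinearMap.coe_range]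

/-- Bounded operators that agree on the exponential vectors are equal. -/
theorem clm_ext_coh {n : ℕ} {F : Type*} [AddCommMonoid F] [Module ℂ F] [TopologicalSpace F]
    [T2Space F] {X Y : L2 n →L[ℂ] F} (h : ∀ w, X (toL2 (coh w)) = Y (toL2 (coh w))) : X = Y := by
  have h1 : (X : L2 n →ₗ[ℂ] F) ∘ₗ cohSum n = (Y : L2 n →ₗ[ℂ] F) ∘ₗ cohSum n := by
    ext w
    simp [cohSum_single, h]
  ext f
  exact congrFun ((denseRange_cohSum n).equalizer X.continuous Y.continuous
    (funext fun c => LinearMap.congr_fun h1 c)) f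

theorem ext_inner_coh {n : ℕ} {f g : L2 n}
    (h : ∀ w, ⟪toL2 (coh w), f⟫_ℂ = ⟪toL2 (coh w), g⟫_ℂ) : f = g :=
  sub_eq_zero.1 (eq_zero_of_inner_coh _ fun w => by rw [inner_sub_right, h, sub_self])

end

end HeatTrace

namespace HeatTrace

noncomputable section

/-! ### Creation and annihilation operators -/

theorem inv_sqrt_two_mul_self : ((√2 : ℂ)⁻¹) * (√2 : ℂ)⁻¹ = 1 / 2 := by
  rw [← mul_inv, ← Complex.ofReal_mul, Real.mul_self_sqrt (by norm_num)]; norm_num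

theorem sqrt_two_mul_self : (√2 : ℂ) * (√2 : ℂ) = 2 := by
  rw [← Complex.ofReal_mul, Real.mul_self_sqrt (by norm_num)]; norm_num

/-- The annihilation operator. -/
def ann {n : ℕ} (j : Fin n) : Sch n →L[ℂ] Sch n := (√2 : ℂ)⁻¹ • (mulX j + partialD j)

/-- The creation operator. -/
def cre {n : ℕ} (j : Fin n) : Sch n →L[ℂ] Sch n := (√2 : ℂ)⁻¹ • (mulX j - partialD j)

theorem mulX_eq {n : ℕ} (j : Fin n) : mulX j = (√2 : ℂ)⁻¹ • (ann j + cre j) := by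
  rw [ann, cre, ← smul_add, smul_smul, inv_sqrt_two_mul_self]
  module

theorem partialD_eq {n : ℕ} (j : Fin n) : partialD j = (√2 : ℂ)⁻¹ • (ann j - cre j) := by
  rw [ann, cre, ← smul_sub, smul_smul, inv_sqrt_two_mul_self]
  module

theorem smul_inv_sqrt_two_mul {n : ℕ} (X Y : Sch n →L[ℂ] Sch n) :
    ((√2 : ℂ)⁻¹ • X) * ((√2 : ℂ)⁻¹ • Y) = (1 / 2 : ℂ) • (X * Y) := by
  rw [smul_mul_smul_comm, inv_sqrt_two_mul_self]

theorem partialD_coh {n : ℕ} (j : Fin n) (w : Fin n → ℂ) (x : EuclideanSpace ℝ (Fin n)) :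
    partialD j (coh w) x = (-(x j : ℂ) + √2 * w j) * coh w x := by
  rw [partialD_apply]
  have h : HasFDerivAt (coh w) ((cohConst n : ℂ) • (Complex.exp (expo w x) • dexpo w x)) x :=
    ((hasFDerivAt_expo w x).cexp).const_mul (cohConst n : ℂ)
  rw [h.fderiv]
  have e : dexpo w x (EuclideanSpace.single j 1) = -(x j : ℂ) + √2 * w j := by
    rw [dexpo_apply, Finset.sum_eq_single j] <;> simp +contextual
  simp only [smul_apply, e, coh_apply, cohFun, smul_eq_mul]
  ring

theorem ann_coh {n : ℕ} (j : Fin n) (w : Fin n → ℂ) : ann j (coh w) = w j • coh w := by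
  ext x
  simp only [ann, smul_apply, add_apply, mulX_apply, partialD_coh, smul_eq_mul]
  field_simp [show (√2 : ℂ) ≠ 0 by simp]
  ring

theorem cre_coh_apply {n : ℕ} (j : Fin n) (w : Fin n → ℂ) (x : EuclideanSpace ℝ (Fin n)) :
    cre j (coh w) x = (√2 * x j - w j) * coh w x := by
  simp only [cre, smul_apply, sub_apply, mulX_apply, partialD_coh, smul_eq_mul]
  field_simp [show (√2 : ℂ) ≠ 0 by simp]
  linear_combination (-(x j : ℂ) * coh w x) * sqrt_two_mul_self

theorem partialD_mulX {n : ℕ} (j k : Fin n) :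
    partialD j * mulX k = mulX k * partialD j + (if j = k then 1 else 0 : Sch n →L[ℂ] Sch n) := by
  ext f x
  have h : HasFDerivAt (fun y : EuclideanSpace ℝ (Fin n) => (y k : ℂ))
      (Complex.ofRealCLM ∘L (EuclideanSpace.proj (𝕜 := ℝ) k : _ →L[ℝ] ℝ)) x :=
    (Complex.ofRealCLM ∘L (EuclideanSpace.proj (𝕜 := ℝ) k : _ →L[ℝ] ℝ)).hasFDerivAt
  have hm : ⇑(mulX k f) = fun y => (y k : ℂ) * f y := funext fun y => mulX_apply k f y
  have h2 := h.fun_mul (f.hasFDerivAt x)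
  simp only [mul_apply_eq_comp, add_apply, mulX_apply]
  rw [partialD_apply, hm, h2.fderiv, partialD_apply]
  by_cases hjk : j = k
  · subst hjk; simp [mul_comm]
  · simp [hjk, Ne.symm hjk]

theorem partialD_comm {n : ℕ} (j k : Fin n) :
    (partialD j : Sch n →L[ℂ] Sch n) * partialD k = partialD k * partialD j := by
  ext f x
  have h1 : ∀ i : Fin n, ⇑(partialD i f) = fun y => fderiv ℝ f y (EuclideanSpace.single i 1) :=
    fun i => funext fun y => partialD_apply i f y
  simp only [mul_apply_eq_comp]
  rw [partialD_apply, partialD_apply, h1, h1]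
  have hd : DifferentiableAt ℝ (fderiv ℝ f) x :=
    ((f.smooth 2).fderiv_right (m := 1) (by norm_num)).differentiable (by norm_num) x
  rw [fderiv_clm_apply hd (differentiableAt_const _), fderiv_clm_apply hd (differentiableAt_const _)]
  simp only [fderiv_fun_const, Pi.zero_apply, ContinuousLinearMap.comp_zero, zero_add,
    ContinuousLinearMap.flip_apply]
  exact ((f.smooth 2).contDiffAt.isSymmSndFDerivAt (by simp)) _ _

theorem mulX_comm {n : ℕ} (j k : Fin n) :
    (mulX j : Sch n →L[ℂ] Sch n) * mulX k = mulX k * mulX j := by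
  ext f x
  simp only [mul_apply_eq_comp, mulX_apply]
  ring

/-- Multiplications commute with each other and so do derivatives; the two mixed commutators
contribute δ_jk/2 each. -/
theorem ann_mul_cre {n : ℕ} (j k : Fin n) :
    ann j * cre k = cre k * ann j + (if j = k then 1 else 0 : Sch n →L[ℂ] Sch n) := by
  have h1 := partialD_mulX j k
  have h2 := partialD_mulX k j
  have h3 := mulX_comm j k
  have h4 := partialD_comm j k
  simp only [ann, cre, smul_inv_sqrt_two_mul, add_mul, mul_sub, sub_mul, mul_add]
  rw [h1, h2, h3, h4]
  by_cases hjk : j = k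
  · subst hjk
    simp only [if_true]
    module
  · simp only [hjk, Ne.symm hjk, if_false]
    module

theorem inner_partialD {n : ℕ} (j : Fin n) (u v : Sch n) :
    ⟪toL2 u, toL2 (partialD j v)⟫_ℂ = -⟪toL2 (partialD j u), toL2 v⟫_ℂ := by
  rw [inner_toL2, inner_toL2]
  exact SchwartzMap.integral_bilinear_lineDerivOp_right_eq_neg_left u v
    ((ContinuousLinearMap.mul ℝ ℂ).comp (Complex.conjCLE : ℂ →L[ℝ] ℂ)) _

theorem inner_mulX {n : ℕ} (j : Fin n) (u v : Sch n) :
    ⟪toL2 u, toL2 (mulX j v)⟫_ℂ = ⟪toL2 (mulX j u), toL2 v⟫_ℂ := by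
  rw [inner_toL2, inner_toL2]
  congr 1
  ext x
  simp only [mulX_apply, map_mul, Complex.conj_ofReal]
  ring

theorem toL2_eq_toLpCLM {n : ℕ} (f : Sch n) :
    toL2 f = SchwartzMap.toLpCLM ℂ ℂ 2 (volume : Measure (EuclideanSpace ℝ (Fin n))) f := rfl

theorem toL2_add {n : ℕ} (f g : Sch n) : toL2 (f + g) = toL2 f + toL2 g := by
  simp only [toL2_eq_toLpCLM, map_add]

theorem toL2_sub {n : ℕ} (f g : Sch n) : toL2 (f - g) = toL2 f - toL2 g := by
  simp only [toL2_eq_toLpCLM, map_sub]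

theorem toL2_smul {n : ℕ} (c : ℂ) (f : Sch n) : toL2 (c • f) = c • toL2 f := by
  simp only [toL2_eq_toLpCLM, map_smul]

theorem toL2_sum {n : ℕ} {ι : Type*} (s : Finset ι) (f : ι → Sch n) :
    toL2 (∑ i ∈ s, f i) = ∑ i ∈ s, toL2 (f i) := by
  simp only [toL2_eq_toLpCLM, map_sum]

theorem toL2_injective {n : ℕ} : Function.Injective (toL2 : Sch n → L2 n) :=
  SchwartzMap.injective_toLp 2 volume

theorem inner_cre {n : ℕ} (j : Fin n) (u v : Sch n) :
    ⟪toL2 u, toL2 (cre j v)⟫_ℂ = ⟪toL2 (ann j u), toL2 v⟫_ℂ := by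
  simp only [cre, ann, smul_apply, sub_apply, add_apply, toL2_smul, toL2_sub, toL2_add,
    inner_smul_left, inner_smul_right, inner_sub_right, inner_add_left, inner_partialD, inner_mulX]
  simp

theorem inner_ann {n : ℕ} (j : Fin n) (u v : Sch n) :
    ⟪toL2 u, toL2 (ann j v)⟫_ℂ = ⟪toL2 (cre j u), toL2 v⟫_ℂ := by
  rw [← inner_conj_symm, ← inner_cre, inner_conj_symm]

/-- The second quantization `∑ K_{jk} a_j^* a_k` of a matrix. -/
def dGamma {n : ℕ} (K : Matrix (Fin n) (Fin n) ℂ) : Sch n →L[ℂ] Sch n :=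
  ∑ j, ∑ k, K j k • (cre j * ann k)

theorem dGamma_coh_apply {n : ℕ} (K : Matrix (Fin n) (Fin n) ℂ) (w : Fin n → ℂ)
    (x : EuclideanSpace ℝ (Fin n)) :
    dGamma K (coh w) x = (∑ j, K.mulVec w j * (√2 * x j - w j)) * coh w x := by
  simp only [dGamma, sum_apply, smul_apply, mul_apply_eq_comp, ann_coh, map_smul,
    cre_coh_apply, smul_eq_mul, Matrix.mulVec, dotProduct, Finset.sum_mul]
  refine Finset.sum_congr rfl fun j _ => Finset.sum_congr rfl fun k _ => by ring

theorem inner_dGamma {n : ℕ} (K : Matrix (Fin n) (Fin n) ℂ) (u v : Sch n) :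
    ⟪toL2 u, toL2 (dGamma K v)⟫_ℂ = ⟪toL2 (dGamma K.conjTranspose u), toL2 v⟫_ℂ := by
  simp only [dGamma, sum_apply, smul_apply, mul_apply_eq_comp, toL2_sum, toL2_smul,
    sum_inner, inner_sum, inner_smul_left, inner_smul_right, inner_cre, inner_ann]
  rw [Finset.sum_comm]
  simp

/-! ### Normally ordered form of the two Hamiltonians. -/

theorem harmonicOsc_eq (n : ℕ) :
    -harmonicOsc n = dGamma (-1) - ((n : ℂ) / 2) • (1 : Sch n →L[ℂ] Sch n) := by
  have h : ∀ j : Fin n, (mulX j ^ 2 - partialD j ^ 2 : Sch n →L[ℂ] Sch n) =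
      (2 : ℂ) • (cre j * ann j) + 1 := by
    intro j
    have h1 := ann_mul_cre j j
    simp only [mulX_eq j, partialD_eq j, pow_two, smul_inv_sqrt_two_mul, add_mul, mul_sub,
      sub_mul, mul_add]
    rw [h1, if_pos rfl]
    module
  simp only [harmonicOsc, h, dGamma, Matrix.neg_apply, Matrix.one_apply, Finset.sum_add_distrib,
    Finset.sum_const, Finset.card_univ, Fintype.card_fin, ← Finset.smul_sum, neg_smul, ite_smul,
    one_smul, zero_smul, Finset.sum_neg_distrib, Finset.sum_ite_eq, Finset.mem_univ, if_true]
  rw [← Nat.cast_smul_eq_nsmul ℂ]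
  module

/-- The block structure (A, -B; B, A) makes the terms a a and a* a* cancel between positions and
momenta, so only a* a survives. The symmetrized ordering leaves the scalar tr A/2 behind. -/
theorem weylQuadratic_eq {n : ℕ} (A B : Matrix (Fin n) (Fin n) ℝ) (hA : A.transpose = A)
    (hB : B.transpose = -B) :
    -Complex.I • weylQuadratic (Matrix.fromBlocks A (-B) B A) =
      dGamma (B.map ((↑) : ℝ → ℂ) - Complex.I • A.map ((↑) : ℝ → ℂ)) -
        (Complex.I * A.trace / 2) • (1 : Sch n →L[ℂ] Sch n) := by
  have hI := Complex.I_mul_I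
  have hA' : ∀ j k, A j k = A k j := fun j k => congrFun (congrFun hA k) j
  have hB' : ∀ j k, B j k = -B k j := fun j k => congrFun (congrFun hB k) j
  -- The two diagonal blocks together: xx + pp has no a a and no a* a* part.
  have key1 : ∀ j k : Fin n,
      ((1 / 2 : ℂ) • (mulX j * mulX k + mulX k * mulX j) +
        (1 / 2 : ℂ) • ((-Complex.I • partialD j) * (-Complex.I • partialD k) +
          (-Complex.I • partialD k) * (-Complex.I • partialD j)) : Sch n →L[ℂ] Sch n) =
      cre j * ann k + cre k * ann j + (if j = k then 1 else 0) := by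
    intro j k
    have h1 := ann_mul_cre j k
    have h2 := ann_mul_cre k j
    simp only [smul_mul_smul_comm, neg_mul_neg, hI]
    simp only [mulX_eq, partialD_eq, smul_inv_sqrt_two_mul, add_mul, mul_sub, sub_mul, mul_add]
    rw [h1, h2]
    by_cases hjk : j = k
    · subst hjk
      simp only [if_true]
      module
    · simp only [hjk, Ne.symm hjk, if_false]
      module
  -- The two off-diagonal blocks together; here the reordering scalars cancel too.
  have key2 : ∀ j k : Fin n,
      ((1 / 2 : ℂ) • ((-Complex.I • partialD j) * mulX k + mulX k * (-Complex.I • partialD j)) -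
        (1 / 2 : ℂ) • (mulX j * (-Complex.I • partialD k) + (-Complex.I • partialD k) * mulX j) :
          Sch n →L[ℂ] Sch n) =
      -Complex.I • (cre k * ann j - cre j * ann k) := by
    intro j k
    have h1 := ann_mul_cre j k
    have h2 := ann_mul_cre k j
    simp only [smul_mul_assoc, mul_smul_comm]
    simp only [mulX_eq, partialD_eq, smul_inv_sqrt_two_mul, add_mul, mul_sub, sub_mul, mul_add]
    rw [h1, h2]
    by_cases hjk : j = k
    · subst hjk
      simp only [if_true]
      module
    · simp only [hjk, Ne.symm hjk, if_false]
      module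
  have e : weylQuadratic (Matrix.fromBlocks A (-B) B A) = (1 / 2 : ℂ) • ∑ j, ∑ k,
      ((A j k : ℂ) • (cre j * ann k + cre k * ann j + (if j = k then 1 else 0)) +
        (B j k : ℂ) • (-Complex.I • (cre k * ann j - cre j * ann k))) := by
    rw [weylQuadratic]
    congr 1
    simp only [Fintype.sum_sum_type, Matrix.fromBlocks_apply₁₁, Matrix.fromBlocks_apply₁₂,
      Matrix.fromBlocks_apply₂₁, Matrix.fromBlocks_apply₂₂, phaseCoord, ← Finset.sum_add_distrib]
    refine Finset.sum_congr rfl fun j _ => Finset.sum_congr rfl fun k _ => ?_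
    rw [← key1, ← key2, Matrix.neg_apply]
    push_cast
    module
  -- Exchanging the indices identifies the two orderings of a* a for symmetric A, and makes them
  -- opposite for skew B.
  have s1 : ∑ j, ∑ k, (A j k : ℂ) • (cre k * ann j) = ∑ j, ∑ k, (A j k : ℂ) • (cre j * ann k) := by
    rw [Finset.sum_comm]
    exact Finset.sum_congr rfl fun j _ => Finset.sum_congr rfl fun k _ => by rw [hA']
  have s2 : ∑ j, ∑ k, (B j k : ℂ) • (cre k * ann j) = -∑ j, ∑ k, (B j k : ℂ) • (cre j * ann k) := by
    rw [Finset.sum_comm, ← Finset.sum_neg_distrib]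
    refine Finset.sum_congr rfl fun j _ => ?_
    rw [← Finset.sum_neg_distrib]
    exact Finset.sum_congr rfl fun k _ => by rw [hB']; push_cast; module
  have s3 : ∑ j, ∑ k, (A j k : ℂ) • (if j = k then 1 else 0 : Sch n →L[ℂ] Sch n) =
      (A.trace : ℂ) • 1 := by
    simp [Matrix.trace, Finset.sum_smul]
  have e2 : dGamma (B.map ((↑) : ℝ → ℂ) - Complex.I • A.map ((↑) : ℝ → ℂ)) =
      ∑ j, ∑ k, (B j k : ℂ) • (cre j * ann k) -
        Complex.I • ∑ j, ∑ k, (A j k : ℂ) • (cre j * ann k) := by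
    simp only [dGamma, Matrix.sub_apply, Matrix.smul_apply, Matrix.map_apply, sub_smul,
      Finset.sum_sub_distrib, smul_eq_mul, Finset.smul_sum, mul_smul]
  rw [e, e2]
  have s4 : ∑ j, ∑ k, (B j k : ℂ) • (-Complex.I • (cre k * ann j - cre j * ann k)) =
      -Complex.I • (∑ j, ∑ k, (B j k : ℂ) • (cre k * ann j : Sch n →L[ℂ] Sch n) -
        ∑ j, ∑ k, (B j k : ℂ) • (cre j * ann k)) := by
    simp only [smul_sub, Finset.smul_sum, Finset.sum_sub_distrib, smul_comm (-Complex.I)]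
  simp only [smul_add, Finset.sum_add_distrib, s1, s3]
  rw [s4, s2]
  match_scalars
  · ring
  · ring
  · linear_combination (-1 : ℂ) * hI

end

end HeatTrace

namespace HeatTrace

noncomputable section

/-! ### Second quantization of contractions -/

open Matrix

theorem inner_cohSum {n : ℕ} (C D : (Fin n → ℂ) → (Fin n → ℂ)) (c d : (Fin n → ℂ) →₀ ℂ) :
    ⟪Finsupp.linearCombination ℂ (fun w => toL2 (coh (C w))) c,
      Finsupp.linearCombination ℂ (fun w => toL2 (coh (D w))) d⟫_ℂ =
      ∑ w ∈ c.support, ∑ v ∈ d.support,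
        star (c w) * d v * Complex.exp (star (C w) ⬝ᵥ D v) := by
  simp only [Finsupp.linearCombination_apply, Finsupp.sum, sum_inner, inner_sum, inner_smul_left,
    inner_smul_right, inner_coh, Finset.mul_sum]
  rw [Finset.sum_comm]
  refine Finset.sum_congr rfl fun w _ => Finset.sum_congr rfl fun v _ => ?_
  rw [RCLike.star_def]
  ring

/-- Differentiating the kernel exp(r² w̄·v) yields 2r Σ_k w̄_k v_k times the kernel, so the
derivative of the squared norm is 2r Σ_k ‖Σ_w c_w w_k ε_{rw}‖² ≥ 0. This makes Γ(q) a contraction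
for 0 ≤ q ≤ 1 without a Hermite expansion. -/
theorem monotoneOn_norm_cohSum_smul {n : ℕ} (c : (Fin n → ℂ) →₀ ℂ) :
    MonotoneOn (fun r : ℝ =>
      ‖Finsupp.linearCombination ℂ (fun w => toL2 (coh ((r : ℂ) • w))) c‖ ^ 2) (Set.Ici 0) := by
  set F : ℝ → ℂ := fun r => ∑ w ∈ c.support, ∑ v ∈ c.support,
    star (c w) * c v * Complex.exp ((r : ℂ) ^ 2 * (star w ⬝ᵥ v)) with hF
  have h1 : ∀ r : ℝ, ‖Finsupp.linearCombination ℂ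
      (fun w => toL2 (coh ((r : ℂ) • w))) c‖ ^ 2 = (F r).re := by
    intro r
    rw [← inner_self_eq_norm_sq (𝕜 := ℂ), inner_cohSum]
    simp only [star_smul, smul_dotProduct, dotProduct_smul, hF, smul_eq_mul, RCLike.star_def,
      Complex.conj_ofReal, ← mul_assoc, pow_two]
    rfl
  set g : ℝ → Fin n → L2 n := fun r k =>
    ∑ w ∈ c.support, (c w * w k) • toL2 (coh ((r : ℂ) • w)) with hg
  have h2 : ∀ r : ℝ, HasDerivAt F (2 * r * ∑ k, ⟪g r k, g r k⟫_ℂ) r := by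
    intro r
    have e : (2 * r * ∑ k, ⟪g r k, g r k⟫_ℂ : ℂ) = ∑ w ∈ c.support, ∑ v ∈ c.support,
        star (c w) * c v * (Complex.exp ((r : ℂ) ^ 2 * (star w ⬝ᵥ v)) *
          (2 * r * (star w ⬝ᵥ v))) := by
      simp only [hg, sum_inner, inner_sum, inner_smul_left, inner_smul_right, inner_coh]
      rw [Finset.sum_comm, Finset.mul_sum]
      conv_rhs => rw [Finset.sum_comm]
      refine Finset.sum_congr rfl fun v _ => ?_
      simp only [Finset.mul_sum]
      rw [Finset.sum_comm]
      refine Finset.sum_congr rfl fun w _ => ?_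
      simp only [star_smul, smul_dotProduct, dotProduct_smul, smul_eq_mul, RCLike.star_def,
        Complex.conj_ofReal, map_mul]
      have : (starRingEnd ℂ (c w) * c v * (Complex.exp ((r : ℂ) ^ 2 * (star w ⬝ᵥ v)) *
          (2 * r * (star w ⬝ᵥ v)))) = ∑ k, starRingEnd ℂ (c w) * c v *
            (Complex.exp ((r : ℂ) ^ 2 * (star w ⬝ᵥ v)) * (2 * r)) *
              (starRingEnd ℂ (w k) * v k) := by
        rw [← Finset.mul_sum]
        simp only [dotProduct, Pi.star_apply, RCLike.star_def]
        ring
      rw [this]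
      refine Finset.sum_congr rfl fun k _ => ?_
      rw [← mul_assoc (r : ℂ) r, ← pow_two]
      ring
    rw [e, hF]
    refine HasDerivAt.fun_sum fun w _ => HasDerivAt.fun_sum fun v _ => ?_
    refine HasDerivAt.const_mul _ ?_
    have h3 : HasDerivAt (fun r : ℝ => (r : ℂ) ^ 2 * (star w ⬝ᵥ v)) (2 * r * (star w ⬝ᵥ v)) r := by
      have := ((Complex.ofRealCLM.hasDerivAt (x := r)).pow 2).mul_const (star w ⬝ᵥ v)
      convert! this using 1
      simp
    exact h3.cexp
  simp only [h1]
  have h3 : ∀ r : ℝ, HasDerivAt (fun r => (F r).re) (2 * r * ∑ k, ‖g r k‖ ^ 2) r := by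
    intro r
    have := Complex.reCLM.hasFDerivAt.comp_hasDerivAt r (h2 r)
    convert! this using 1
    have : ∀ k, ⟪g r k, g r k⟫_ℂ = ((‖g r k‖ ^ 2 : ℝ) : ℂ) := fun k => by
      rw [inner_self_eq_norm_sq_to_K]; simp
    simp only [this, Complex.reCLM_apply]
    rw [← Complex.ofReal_sum]
    norm_cast
  refine monotoneOn_of_deriv_nonneg (convex_Ici 0) ?_ ?_ ?_
  · exact fun r _ => (h3 r).continuousAt.continuousWithinAt
  · exact fun r _ => (h3 r).differentiableAt.differentiableWithinAt
  · intro r hr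
    rw [interior_Ici, Set.mem_Ioi] at hr
    rw [(h3 r).deriv]
    positivity

/-- A contraction which is a multiple of a unitary matrix. -/
def IsScaledUnitary {n : ℕ} (C : Matrix (Fin n) (Fin n) ℂ) : Prop :=
  ∃ q : ℝ, 0 ≤ q ∧ q ≤ 1 ∧ Cᴴ * C = ((q : ℂ) ^ 2) • (1 : Matrix (Fin n) (Fin n) ℂ)

theorem star_mulVec_dotProduct {n : ℕ} (C : Matrix (Fin n) (Fin n) ℂ) (w v : Fin n → ℂ) :
    star (C *ᵥ w) ⬝ᵥ v = star w ⬝ᵥ (Cᴴ *ᵥ v) := by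
  rw [star_mulVec, ← dotProduct_mulVec]

/-- The Gram matrix of the vectors ε_{Cw} depends on C only through CᴴC = q², so C may be replaced
by the scalar q, which is then compared with 1 by monotonicity. -/
theorem IsScaledUnitary.norm_le {n : ℕ} {C : Matrix (Fin n) (Fin n) ℂ} (hC : IsScaledUnitary C)
    (c : (Fin n → ℂ) →₀ ℂ) :
    ‖Finsupp.linearCombination ℂ (fun w => toL2 (coh (C *ᵥ w))) c‖ ≤ 1 * ‖cohSum n c‖ := by
  obtain ⟨q, hq0, hq1, hC⟩ := hC
  have h := monotoneOn_norm_cohSum_smul c hq0 (Set.mem_Ici.2 zero_le_one) hq1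
  simp only [Complex.ofReal_one, one_smul] at h
  rw [one_mul, cohSum]
  refine le_of_sq_le_sq ?_ (norm_nonneg _)
  refine le_trans (le_of_eq ?_) h
  rw [← inner_self_eq_norm_sq (𝕜 := ℂ), ← inner_self_eq_norm_sq (𝕜 := ℂ), inner_cohSum,
    inner_cohSum]
  congr 1
  refine Finset.sum_congr rfl fun w _ => Finset.sum_congr rfl fun v _ => ?_
  rw [star_mulVec_dotProduct, mulVec_mulVec, hC]
  simp [smul_mulVec, pow_two, mul_assoc]

/-- The second quantization `Γ(C)`, with `Γ(C) ε_w = ε_{Cw}`. -/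
def Gamma {n : ℕ} (C : Matrix (Fin n) (Fin n) ℂ) : L2 n →L[ℂ] L2 n :=
  (Finsupp.linearCombination ℂ (fun w => toL2 (coh (C *ᵥ w)))).extendOfNorm (cohSum n)

theorem Gamma_coh {n : ℕ} {C : Matrix (Fin n) (Fin n) ℂ} (hC : IsScaledUnitary C)
    (w : Fin n → ℂ) : Gamma C (toL2 (coh w)) = toL2 (coh (C *ᵥ w)) := by
  have := LinearMap.extendOfNorm_eq (denseRange_cohSum n) ⟨1, hC.norm_le⟩ (Finsupp.single w 1)
  simpa [Gamma, cohSum_single] using this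

theorem norm_Gamma_le {n : ℕ} {C : Matrix (Fin n) (Fin n) ℂ} (hC : IsScaledUnitary C) :
    ‖Gamma C‖ ≤ 1 :=
  LinearMap.opNorm_extendOfNorm_le (denseRange_cohSum n) zero_le_one hC.norm_le

open scoped ComplexOrder in
theorem IsScaledUnitary.conjTranspose {n : ℕ} {C : Matrix (Fin n) (Fin n) ℂ}
    (hC : IsScaledUnitary C) : IsScaledUnitary Cᴴ := by
  obtain ⟨q, hq0, hq1, hC⟩ := hC
  refine ⟨q, hq0, hq1, ?_⟩
  rw [conjTranspose_conjTranspose]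
  -- If q = 0 then C = 0; otherwise q⁻²Cᴴ is a left inverse of C, hence also a right inverse.
  rcases hq0.eq_or_lt with rfl | hq
  · have : C = 0 := by
      rw [← conjTranspose_mul_self_eq_zero, hC]; simp
    simp [this]
  · have hq' : ((q : ℂ) ^ 2) ≠ 0 := by simp [hq.ne']
    have h1 : ((((q : ℂ) ^ 2)⁻¹) • Cᴴ) * C = 1 := by
      rw [smul_mul_assoc, hC, smul_smul, inv_mul_cancel₀ hq', one_smul]
    have h2 := mul_eq_one_comm.1 h1
    rw [mul_smul_comm] at h2
    rw [← h2, smul_smul, mul_inv_cancel₀ hq', one_smul]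

theorem IsScaledUnitary.mul {n : ℕ} {C D : Matrix (Fin n) (Fin n) ℂ}
    (hC : IsScaledUnitary C) (hD : IsScaledUnitary D) : IsScaledUnitary (C * D) := by
  obtain ⟨q, hq0, hq1, hC⟩ := hC
  obtain ⟨r, hr0, hr1, hD⟩ := hD
  refine ⟨q * r, by positivity, mul_le_one₀ hq1 hr0 hr1, ?_⟩
  rw [conjTranspose_mul, Matrix.mul_assoc, ← Matrix.mul_assoc Cᴴ, hC, smul_mul_assoc,
    Matrix.one_mul, mul_smul_comm, hD, smul_smul]
  push_cast
  rw [mul_pow]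

theorem Gamma_mul {n : ℕ} {C D : Matrix (Fin n) (Fin n) ℂ} (hC : IsScaledUnitary C)
    (hD : IsScaledUnitary D) : Gamma (C * D) = Gamma C * Gamma D :=
  clm_ext_coh fun w => by
    rw [Gamma_coh (hC.mul hD), mul_apply_eq_comp, Gamma_coh hD, Gamma_coh hC, mulVec_mulVec]

/-- The kernel gives the identity on exponential vectors, and totality extends it to all f. Through
it Γ(C) can be handled on arbitrary vectors by moving it to the explicit side. -/
theorem inner_coh_Gamma {n : ℕ} {C : Matrix (Fin n) (Fin n) ℂ} (hC : IsScaledUnitary C)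
    (v : Fin n → ℂ) (f : L2 n) :
    ⟪toL2 (coh v), Gamma C f⟫_ℂ = ⟪toL2 (coh (Cᴴ *ᵥ v)), f⟫_ℂ := by
  have h : (innerSL ℂ (toL2 (coh v))) ∘L Gamma C = innerSL ℂ (toL2 (coh (Cᴴ *ᵥ v))) :=
    clm_ext_coh fun w => by
      simp only [ContinuousLinearMap.comp_apply, innerSL_apply_apply, Gamma_coh hC, inner_coh]
      rw [star_mulVec_dotProduct, conjTranspose_conjTranspose]
  exact DFunLike.congr_fun h f

theorem adjoint_Gamma {n : ℕ} {C : Matrix (Fin n) (Fin n) ℂ} (hC : IsScaledUnitary C) :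
    ContinuousLinearMap.adjoint (Gamma C) = Gamma Cᴴ :=
  clm_ext_coh fun w => ext_inner_coh fun v => by
    rw [ContinuousLinearMap.adjoint_inner_right, inner_coh_Gamma hC.conjTranspose,
      conjTranspose_conjTranspose, Gamma_coh hC]

/-- The squared distance of two exponential vectors is a combination of four values of the
continuous kernel. -/
theorem continuous_coh (n : ℕ) : Continuous fun w : Fin n → ℂ => toL2 (coh w) := by
  rw [continuous_iff_continuousAt]
  intro v
  rw [ContinuousAt, tendsto_iff_norm_sub_tendsto_zero]
  have h : ∀ w : Fin n → ℂ, ‖toL2 (coh w) - toL2 (coh v)‖ =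
      √(Complex.exp (star w ⬝ᵥ w) - Complex.exp (star w ⬝ᵥ v) - Complex.exp (star v ⬝ᵥ w) +
        Complex.exp (star v ⬝ᵥ v)).re := by
    intro w
    rw [norm_eq_sqrt_re_inner (𝕜 := ℂ), inner_sub_left, inner_sub_right, inner_sub_right]
    simp only [inner_coh, RCLike.re_eq_complex_re]
    congr 2
    ring
  simp_rw [h]
  have hc : Continuous fun w : Fin n → ℂ => √(Complex.exp (star w ⬝ᵥ w) -
      Complex.exp (star w ⬝ᵥ v) - Complex.exp (star v ⬝ᵥ w) +
        Complex.exp (star v ⬝ᵥ v)).re := by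
    simp only [dotProduct, Pi.star_apply]
    fun_prop
  have := hc.tendsto v
  simpa using this

end

end HeatTrace

namespace HeatTrace

noncomputable section

/-! ### Contraction semigroups -/

open Matrix

theorem IsContractionSemigroup.continuousOn_apply {n : ℕ} {P : Sch n →L[ℂ] Sch n}
    {U : ℝ → L2 n →L[ℂ] L2 n} (hU : IsContractionSemigroup P U) {t : ℝ} {y : ℝ → L2 n}
    (hy : ContinuousOn y (Set.Icc 0 t)) :
    ContinuousOn (fun s => U (t - s) (y s)) (Set.Icc 0 t) := by
  intro s hs
  have h1 : Tendsto (fun s' => U (t - s') (y s)) (𝓝[Set.Icc 0 t] s) (𝓝 (U (t - s) (y s))) := by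
    refine ((hU.continuousOn (y s)) (t - s) (by simpa using hs.2)).tendsto.comp ?_
    refine tendsto_nhdsWithin_iff.2 ⟨?_, ?_⟩
    · exact ((continuous_const.sub continuous_id).tendsto s).mono_left nhdsWithin_le_nhds
    · filter_upwards [self_mem_nhdsWithin] with s' hs'
      simpa using hs'.2
  have h2 : Tendsto (fun s' => U (t - s') (y s' - y s)) (𝓝[Set.Icc 0 t] s) (𝓝 0) := by
    have h3 : Tendsto (fun s' => ‖y s' - y s‖) (𝓝[Set.Icc 0 t] s) (𝓝 0) :=
      tendsto_iff_norm_sub_tendsto_zero.1 (hy s hs)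
    refine squeeze_zero_norm' ?_ h3
    filter_upwards [self_mem_nhdsWithin] with s' hs'
    have h4 := (U (t - s')).le_of_opNorm_le (hU.norm_le_one (t - s') (by simpa using hs'.2))
      (y s' - y s)
    rwa [one_mul] at h4
  have := h2.add h1
  simpa [ContinuousWithinAt] using this

/-- Two contraction semigroups with the same generator agree on the vectors whose orbit under one
of them consists of Schwartz functions. -/
theorem IsContractionSemigroup.eq_of_schwartz_orbit {n : ℕ} {P : Sch n →L[ℂ] Sch n}
    {U V : ℝ → L2 n →L[ℂ] L2 n} (hU : IsContractionSemigroup P U) (hV : IsContractionSemigroup P V)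
    {g : L2 n} (hg : ∀ s, 0 ≤ s → ∃ u : Sch n, U s g = toL2 u) {t : ℝ} (ht : 0 ≤ t) :
    V t g = U t g := by
  have hcont : ContinuousOn (fun s => V (t - s) (U s g)) (Set.Icc 0 t) :=
    hV.continuousOn_apply ((hU.continuousOn g).mono Set.Icc_subset_Ici_self)
  have hder : ∀ s ∈ Set.Ico 0 t,
      HasDerivWithinAt (fun s => V (t - s) (U s g)) 0 (Set.Ici s) s := by
    intro s hs
    obtain ⟨u, hu⟩ := hg s hs.1
    -- Both semigroups have the derivative P u at the Schwartz vector u, so their difference there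
    -- is o(h). This is where the Schwartz orbit is needed.
    have hD := (hU.hasDerivWithinAt u).sub (hV.hasDerivWithinAt u)
    rw [sub_self, hasDerivWithinAt_iff_isLittleO] at hD
    rw [hasDerivWithinAt_iff_isLittleO]
    have ht' : Tendsto (fun s' => s' - s) (𝓝[Set.Ici s] s) (𝓝[Set.Ici 0] 0) := by
      refine tendsto_nhdsWithin_iff.2 ⟨?_, ?_⟩
      · have : Tendsto (fun s' => s' - s) (𝓝 s) (𝓝 (s - s)) :=
          (continuous_id.sub continuous_const).tendsto s
        rw [sub_self] at this
        exact this.mono_left nhdsWithin_le_nhds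
      · filter_upwards [self_mem_nhdsWithin] with s' hs'
        simpa using hs'
    have hD' := hD.comp_tendsto ht'
    refine IsBigO.trans_isLittleO (IsBigO.of_bound 1 ?_) (hD'.congr_right fun s' => by simp)
    have hlt : ∀ᶠ s' in 𝓝[Set.Ici s] s, s' < t :=
      (eventually_lt_nhds hs.2).filter_mono nhdsWithin_le_nhds
    filter_upwards [self_mem_nhdsWithin, hlt] with s' hs' hs't
    have hs'' : 0 ≤ s' - s := sub_nonneg.2 hs'
    -- Both endpoints are rewritten so that the increment becomes V(t - s') applied to (U - V)(s' -
    -- s)u; contractivity of V then preserves the o(s' - s).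
    have e1 : U s' g = U (s' - s) (toL2 u) := by
      rw [← hu, ← mul_apply_eq_comp, ← hU.map_add _ _ hs'' hs.1, sub_add_cancel]
    have e2 : V (t - s) (U s g) = V (t - s') (V (s' - s) (toL2 u)) := by
      rw [← hu, ← mul_apply_eq_comp (V (t - s')), ← hV.map_add _ _ (by linarith) hs'']
      congr 2
      ring
    simp only [smul_zero, sub_zero, Function.comp_apply, Pi.sub_apply]
    rw [e1, e2, ← map_sub, hU.map_zero, hV.map_zero, sub_self, sub_zero]
    exact (V (t - s')).le_of_opNorm_le (hV.norm_le_one _ (by linarith)) _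
  have h := constant_of_has_deriv_right_zero hcont hder t (Set.right_mem_Icc.2 ht)
  simp only [sub_self, sub_zero, hV.map_zero, hU.map_zero] at h
  exact h.symm

/-- `expOp` chooses some semigroup; uniqueness on the total set of exponential vectors shows that
the choice is U. -/
theorem IsContractionSemigroup.expOp_eq {n : ℕ} {P : Sch n →L[ℂ] Sch n}
    {U : ℝ → L2 n →L[ℂ] L2 n} (hU : IsContractionSemigroup P U)
    (hg : ∀ s, 0 ≤ s → ∀ w, ∃ u : Sch n, U s (toL2 (coh w)) = toL2 u) {t : ℝ} (ht : 0 ≤ t) :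
    expOp P t = U t := by
  have h : ∃ U, IsContractionSemigroup P U := ⟨U, hU⟩
  rw [expOp, dif_pos h]
  exact clm_ext_coh fun w => hU.eq_of_schwartz_orbit h.choose_spec (fun s hs => hg s hs w) ht

theorem cre_coh_sum_apply {n : ℕ} (a w : Fin n → ℂ) (x : EuclideanSpace ℝ (Fin n)) :
    (∑ j, a j • cre j (coh w)) x = (∑ j, a j * (√2 * x j - w j)) * cohFun w x := by
  simp only [_root_.sum_apply, _root_.smul_apply, cre_coh_apply, smul_eq_mul, Finset.sum_mul, coh_apply]
  exact Finset.sum_congr rfl fun j _ => by ring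

/-- The derivative of ε_w in the direction w_j is a_j* ε_w. Differentiation under the integral is
justified by bounds for v, v' and ε_{v(s)} that are uniform on a compact interval around s₀. -/
theorem hasDerivAt_inner_coh {n : ℕ} (f : Sch n) {v v' : ℝ → Fin n → ℂ}
    (hv : ∀ s, HasDerivAt v (v' s) s) (hv' : Continuous v') (s₀ : ℝ) :
    HasDerivAt (fun s => ⟪toL2 (coh (v s)), toL2 f⟫_ℂ)
      ⟪toL2 (∑ j, v' s₀ j • cre j (coh (v s₀))), toL2 f⟫_ℂ s₀ := by
  have hvc : Continuous v := continuous_iff_continuousAt.2 fun s => (hv s).continuousAt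
  obtain ⟨C, hC0, hC⟩ := exists_bound_cohFun n 0 0
  have hK : IsCompact (Set.Icc (s₀ - 1) (s₀ + 1)) := isCompact_Icc
  obtain ⟨M1, hM1⟩ := hK.exists_bound_of_continuousOn
    (f := fun s => Real.exp (4 * absSum (v s) + sqSum (v s) / 2))
    (by unfold absSum sqSum; fun_prop)
  obtain ⟨M2, hM2⟩ := hK.exists_bound_of_continuousOn (f := v) hvc.continuousOn
  obtain ⟨M3, hM3⟩ := hK.exists_bound_of_continuousOn (f := v') hv'.continuousOn
  simp only [inner_toL2]
  have hmem : s₀ ∈ Set.Icc (s₀ - 1) (s₀ + 1) := by constructor <;> linarith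
  have hM1' := (norm_nonneg _).trans (hM1 s₀ hmem)
  have hM2' := (norm_nonneg _).trans (hM2 s₀ hmem)
  have hM3' := (norm_nonneg _).trans (hM3 s₀ hmem)
  have h2 : √2 ≤ (2 : ℝ) := by
    rw [Real.sqrt_le_left (by norm_num)]; norm_num
  refine (hasDerivAt_integral_of_dominated_loc_of_deriv_le
    (F := fun s x => (starRingEnd ℂ) (coh (v s) x) * f x)
    (F' := fun s x => (starRingEnd ℂ) ((∑ j, v' s j • cre j (coh (v s))) x) * f x)
    (bound := fun x => n * (M3 * (2 * ‖x‖ + M2)) * (C * M1) * ‖f x‖)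
    (Metric.ball_mem_nhds s₀ one_pos) ?_ ?_ ?_ ?_ ?_ ?_).2
  · refine Eventually.of_forall fun s => ?_
    exact ((Complex.continuous_conj.comp (coh (v s)).continuous).mul f.continuous).aestronglyMeasurable
  · refine Integrable.mono (f.integrable.norm.const_mul (C * M1)) ?_ ?_
    · exact ((Complex.continuous_conj.comp (coh (v s₀)).continuous).mul f.continuous).aestronglyMeasurable
    · refine Eventually.of_forall fun x => ?_
      rw [norm_mul, RCLike.norm_conj, norm_mul, norm_norm]
      refine mul_le_mul_of_nonneg_right ?_ (norm_nonneg _)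
      have := hC (v s₀) x
      simp only [pow_zero, one_mul, norm_iteratedFDeriv_zero] at this
      refine this.trans (le_trans ?_ (le_abs_self _))
      exact mul_le_mul_of_nonneg_left ((le_abs_self _).trans (hM1 s₀ hmem)) hC0
  · exact ((Complex.continuous_conj.comp (SchwartzMap.continuous _)).mul
      f.continuous).aestronglyMeasurable
  · refine Eventually.of_forall fun x s hs => ?_
    have hs' : s ∈ Set.Icc (s₀ - 1) (s₀ + 1) := by
      rw [Metric.mem_ball, Real.dist_eq, abs_lt] at hs
      constructor <;> linarith
    rw [norm_mul, RCLike.norm_conj, cre_coh_sum_apply, norm_mul]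
    have b1 : ‖∑ j, v' s j * (√2 * x j - v s j)‖ ≤ n * (M3 * (2 * ‖x‖ + M2)) := by
      refine (norm_sum_le _ _).trans ((Finset.sum_le_card_nsmul _ _
        (M3 * (2 * ‖x‖ + M2)) fun j _ => ?_).trans (by simp))
      rw [norm_mul]
      have c1 : ‖v' s j‖ ≤ M3 := (norm_le_pi_norm _ j).trans (hM3 s hs')
      have c2 : ‖v s j‖ ≤ M2 := (norm_le_pi_norm _ j).trans (hM2 s hs')
      have c3 : ‖(√2 : ℂ) * x j - v s j‖ ≤ 2 * ‖x‖ + M2 := by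
        refine (norm_sub_le _ _).trans (add_le_add ?_ c2)
        rw [norm_mul, Complex.norm_real, Complex.norm_real,
          Real.norm_of_nonneg (Real.sqrt_nonneg 2)]
        gcongr
        exact PiLp.norm_apply_le x j
      exact mul_le_mul c1 c3 (norm_nonneg _) hM3'
    have b2 : ‖cohFun (v s) x‖ ≤ C * M1 := by
      have := hC (v s) x
      simp only [pow_zero, one_mul, norm_iteratedFDeriv_zero] at this
      refine this.trans ?_
      exact mul_le_mul_of_nonneg_left ((le_abs_self _).trans (hM1 s hs')) hC0
    gcongr
  · have i1 := (f.integrable_pow_mul volume 1).const_mul (n * (M3 * 2) * (C * M1))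
    have i2 := (f.integrable (μ := volume)).norm.const_mul (n * (M3 * M2) * (C * M1))
    refine (i1.add i2).congr (Eventually.of_forall fun x => ?_)
    simp only [Pi.add_apply]
    ring
  · refine Eventually.of_forall fun x s _ => ?_
    refine HasDerivAt.mul_const ?_ _
    have h3 : HasDerivAt (fun s => expo (v s) x) (∑ j, v' s j * (√2 * x j - v s j)) s := by
      unfold expo
      refine HasDerivAt.fun_sum fun j _ => ?_
      have hj : HasDerivAt (fun s => v s j) (v' s j) s := hasDerivAt_pi.1 (hv s) j
      have := ((hj.const_mul (√2 : ℂ)).mul_const (x j : ℂ)).const_add (-(x j : ℂ) ^ 2 / 2)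
      have := this.sub ((hj.pow 2).div_const 2)
      convert! this using 1
      simp
      ring
    have h4 := (h3.cexp).const_mul (cohConst n : ℂ)
    have h5 := Complex.conjCLE.toContinuousLinearMap.hasFDerivAt.comp_hasDerivAt s h4
    rw [cre_coh_sum_apply]
    convert! h5 using 1
    simp [cohFun]
    ring

/-! ### The semigroup of dΓ(K) + c, and the heat and metaplectic operators. -/

/-- The semigroup `e^{ct} Γ(e^{tK})`. -/
def gammaSemigroup {n : ℕ} (K : Matrix (Fin n) (Fin n) ℂ) (c : ℂ) (t : ℝ) : L2 n →L[ℂ] L2 n :=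
  Complex.exp (t * c) • Gamma (NormedSpace.exp ((t : ℂ) • K))

theorem exp_smul_mul_exp_smul {n : ℕ} (K : Matrix (Fin n) (Fin n) ℂ) (s t : ℝ) :
    NormedSpace.exp (((s + t : ℝ) : ℂ) • K) =
      NormedSpace.exp ((s : ℂ) • K) * NormedSpace.exp ((t : ℂ) • K) := by
  rw [Complex.ofReal_add, add_smul]
  exact Matrix.exp_add_of_commute _ _ (((Commute.refl K).smul_left _).smul_right _)

theorem exp_smul_one {n : ℕ} (c : ℂ) :
    NormedSpace.exp (c • (1 : Matrix (Fin n) (Fin n) ℂ)) =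
      Complex.exp c • (1 : Matrix (Fin n) (Fin n) ℂ) := by
  rw [smul_one_eq_diagonal, Matrix.exp_diagonal, smul_one_eq_diagonal]
  congr 1
  funext i
  rw [Pi.coe_exp, Complex.exp_eq_exp_ℂ]

/-- The hypothesis says that K + κ is skew-Hermitian, so exp(tK) is e^{-κt} times a unitary matrix.
Both uses fit: κ = 1 for the heat semigroup, κ = 0 for the metaplectic group. -/
theorem isScaledUnitary_exp {n : ℕ} {K : Matrix (Fin n) (Fin n) ℂ} {κ : ℝ} (hκ : 0 ≤ κ)
    (hK : Kᴴ = -K - (2 * κ : ℂ) • (1 : Matrix (Fin n) (Fin n) ℂ)) {t : ℝ} (ht : 0 ≤ t) :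
    IsScaledUnitary (NormedSpace.exp ((t : ℂ) • K)) := by
  refine ⟨Real.exp (-κ * t), (Real.exp_pos _).le, ?_, ?_⟩
  · rw [Real.exp_le_one_iff]
    nlinarith
  · have hK' : ((t : ℂ) • K)ᴴ = -((t : ℂ) • K) + (-2 * κ * t : ℂ) • 1 := by
      rw [conjTranspose_smul, hK]
      simp only [RCLike.star_def, Complex.conj_ofReal]
      module
    rw [← Matrix.exp_conjTranspose, ← Matrix.exp_add_of_commute]
    · rw [hK', add_right_comm, neg_add_cancel, zero_add, exp_smul_one, Complex.ofReal_exp,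
        ← Complex.exp_nat_mul]
      congr 2
      push_cast
      ring
    · rw [hK']
      exact (Commute.refl _).neg_left.add_left ((Commute.one_left _).smul_left _)

theorem hasDerivAt_exp_smul_mulVec {n : ℕ} (K : Matrix (Fin n) (Fin n) ℂ) (v : Fin n → ℂ)
    (s : ℝ) : HasDerivAt (fun s : ℝ => NormedSpace.exp ((s : ℂ) • K) *ᵥ v)
      (K *ᵥ (NormedSpace.exp ((s : ℂ) • K) *ᵥ v)) s := by
  let _ : NormedRing (Matrix (Fin n) (Fin n) ℂ) := Matrix.linftyOpNormedRing
  let _ : NormedAlgebra ℝ (Matrix (Fin n) (Fin n) ℂ) := Matrix.linftyOpNormedAlgebra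
  have h := hasDerivAt_exp_smul_const' (𝕂 := ℝ) K s
  let L : Matrix (Fin n) (Fin n) ℂ →ₗ[ℝ] (Fin n → ℂ) :=
    { toFun := fun A => A *ᵥ v
      map_add' := fun A B => add_mulVec A B v
      map_smul' := fun c A => smul_mulVec c A v }
  have h2 := (LinearMap.toContinuousLinearMap L).hasFDerivAt.comp_hasDerivAt s h
  have e : ∀ s : ℝ, (s : ℂ) • K = s • K := fun s => by ext; simp
  simp only [e]
  rw [mulVec_mulVec]
  exact h2

theorem continuous_exp_smul_mulVec {n : ℕ} (K : Matrix (Fin n) (Fin n) ℂ) (v : Fin n → ℂ) :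
    Continuous fun s : ℝ => NormedSpace.exp ((s : ℂ) • K) *ᵥ v :=
  continuous_iff_continuousAt.2 fun s => (hasDerivAt_exp_smul_mulVec K v s).continuousAt

theorem gammaSemigroup_coh {n : ℕ} {K : Matrix (Fin n) (Fin n) ℂ} {κ : ℝ} (hκ : 0 ≤ κ)
    (hK : Kᴴ = -K - (2 * κ : ℂ) • (1 : Matrix (Fin n) (Fin n) ℂ)) (c : ℂ) {t : ℝ} (ht : 0 ≤ t)
    (w : Fin n → ℂ) : gammaSemigroup K c t (toL2 (coh w)) =
      Complex.exp (t * c) • toL2 (coh (NormedSpace.exp ((t : ℂ) • K) *ᵥ w)) := by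
  rw [gammaSemigroup, _root_.smul_apply, Gamma_coh (isScaledUnitary_exp hκ hK ht)]

theorem norm_gammaSemigroup_le {n : ℕ} {K : Matrix (Fin n) (Fin n) ℂ} {κ : ℝ} (hκ : 0 ≤ κ)
    (hK : Kᴴ = -K - (2 * κ : ℂ) • (1 : Matrix (Fin n) (Fin n) ℂ)) {c : ℂ} (hc : c.re ≤ 0)
    {t : ℝ} (ht : 0 ≤ t) : ‖gammaSemigroup K c t‖ ≤ 1 := by
  rw [gammaSemigroup, norm_smul]
  refine mul_le_one₀ ?_ (norm_nonneg _) (norm_Gamma_le (isScaledUnitary_exp hκ hK ht))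
  rw [Complex.norm_exp, Real.exp_le_one_iff]
  simp only [Complex.mul_re, Complex.ofReal_re, Complex.ofReal_im, zero_mul, sub_zero]
  nlinarith

/-- On combinations of exponential vectors the orbit is explicit and continuous; contractivity makes
the approximation of other orbits uniform in t. -/
theorem continuousOn_gammaSemigroup {n : ℕ} {K : Matrix (Fin n) (Fin n) ℂ} {κ : ℝ} (hκ : 0 ≤ κ)
    (hK : Kᴴ = -K - (2 * κ : ℂ) • (1 : Matrix (Fin n) (Fin n) ℂ)) {c : ℂ} (hc : c.re ≤ 0)
    (f : L2 n) : ContinuousOn (fun t => gammaSemigroup K c t f) (Set.Ici 0) := by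
  refine continuousOn_of_uniform_approx_of_continuousOn fun u hu => ?_
  obtain ⟨ε, hε, hu⟩ := Metric.mem_uniformity_dist.1 hu
  obtain ⟨d, hd⟩ := (denseRange_cohSum n).exists_dist_lt f hε
  refine ⟨fun t => gammaSemigroup K c t (cohSum n d), ?_, fun t ht => hu ?_⟩
  · have : ContinuousOn (fun t : ℝ => ∑ w ∈ d.support, d w •
        Complex.exp (t * c) • toL2 (coh (NormedSpace.exp ((t : ℂ) • K) *ᵥ w))) (Set.Ici 0) := by
      refine Continuous.continuousOn (continuous_finsetSum _ fun w _ => ?_)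
      have h1 := (continuous_coh n).comp (continuous_exp_smul_mulVec K w)
      have h2 : Continuous fun t : ℝ => Complex.exp (t * c) := by fun_prop
      exact (h2.smul h1).const_smul (d w)
    refine this.congr fun t ht => ?_
    rw [cohSum, Finsupp.linearCombination_apply, Finsupp.sum, map_sum]
    exact Finset.sum_congr rfl fun w _ => by rw [map_smul, gammaSemigroup_coh hκ hK c ht]
  · rw [dist_eq_norm, ← map_sub]
    refine lt_of_le_of_lt ((gammaSemigroup K c t).le_of_opNorm_le
      (norm_gammaSemigroup_le hκ hK hc ht) _) ?_
    rwa [one_mul, ← dist_eq_norm]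

theorem inner_coh_gammaSemigroup {n : ℕ} {K : Matrix (Fin n) (Fin n) ℂ} {κ : ℝ} (hκ : 0 ≤ κ)
    (hK : Kᴴ = -K - (2 * κ : ℂ) • (1 : Matrix (Fin n) (Fin n) ℂ)) (c : ℂ) {t : ℝ} (ht : 0 ≤ t)
    (v : Fin n → ℂ) (f : L2 n) : ⟪toL2 (coh v), gammaSemigroup K c t f⟫_ℂ =
      Complex.exp (t * c) * ⟪toL2 (coh (NormedSpace.exp ((t : ℂ) • Kᴴ) *ᵥ v)), f⟫_ℂ := by
  rw [gammaSemigroup, _root_.smul_apply, inner_smul_right,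
    inner_coh_Gamma (isScaledUnitary_exp hκ hK ht), ← Matrix.exp_conjTranspose, conjTranspose_smul,
    RCLike.star_def, Complex.conj_ofReal]

/-- The left vector is dΓ(Kᴴ) ε_w, and dΓ(Kᴴ) is the formal adjoint of dΓ(K). -/
theorem inner_sum_cre_coh {n : ℕ} (K : Matrix (Fin n) (Fin n) ℂ) (w : Fin n → ℂ) (f : Sch n) :
    ⟪toL2 (∑ j, (Kᴴ *ᵥ w) j • cre j (coh w)), toL2 f⟫_ℂ =
      ⟪toL2 (coh w), toL2 (dGamma K f)⟫_ℂ := by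
  rw [inner_dGamma]
  congr 2
  ext x
  rw [cre_coh_sum_apply, dGamma_coh_apply, coh_apply]

/-- It is not known here that the orbit of a general Schwartz f stays Schwartz. The identity is
therefore tested against ε_v, the semigroup is moved to ε_v, where it acts by e^{sKᴴ}, and the
fundamental theorem of calculus is applied to scalars. -/
theorem gammaSemigroup_sub {n : ℕ} {K : Matrix (Fin n) (Fin n) ℂ} {κ : ℝ} (hκ : 0 ≤ κ)
    (hK : Kᴴ = -K - (2 * κ : ℂ) • (1 : Matrix (Fin n) (Fin n) ℂ)) {c : ℂ} (hc : c.re ≤ 0)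
    (f : Sch n) {t : ℝ} (ht : 0 ≤ t) : gammaSemigroup K c t (toL2 f) - toL2 f =
      ∫ s in (0 : ℝ)..t, gammaSemigroup K c s
        (toL2 ((dGamma K + c • (1 : Sch n →L[ℂ] Sch n)) f)) := by
  set Pf := (dGamma K + c • (1 : Sch n →L[ℂ] Sch n)) f with hPf
  have hsub : Set.uIcc 0 t ⊆ Set.Ici 0 := by
    rw [Set.uIcc_of_le ht]; exact Set.Icc_subset_Ici_self
  have hint : IntervalIntegrable (fun s => gammaSemigroup K c s (toL2 Pf)) volume 0 t :=
    ((continuousOn_gammaSemigroup hκ hK hc _).mono hsub).intervalIntegrable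
  refine ext_inner_coh fun v => ?_
  have e1 : ⟪toL2 (coh v), ∫ s in (0 : ℝ)..t, gammaSemigroup K c s (toL2 Pf)⟫_ℂ =
      ∫ s in (0 : ℝ)..t, ⟪toL2 (coh v), gammaSemigroup K c s (toL2 Pf)⟫_ℂ :=
    (((innerSL ℂ (toL2 (coh v))).intervalIntegral_comp_comm hint)).symm
  rw [e1]
  set F : ℝ → ℂ := fun s => Complex.exp (s * c) *
    ⟪toL2 (coh (NormedSpace.exp ((s : ℂ) • Kᴴ) *ᵥ v)), toL2 f⟫_ℂ with hF
  have hder : ∀ s : ℝ, HasDerivAt F (Complex.exp (s * c) *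
      ⟪toL2 (coh (NormedSpace.exp ((s : ℂ) • Kᴴ) *ᵥ v)), toL2 Pf⟫_ℂ) s := by
    intro s
    have h1 := hasDerivAt_inner_coh f (hasDerivAt_exp_smul_mulVec Kᴴ v)
      (by have := continuous_exp_smul_mulVec Kᴴ v; fun_prop) s
    have h2 : HasDerivAt (fun s : ℝ => Complex.exp (s * c)) (Complex.exp (s * c) * c) s := by
      have := ((Complex.ofRealCLM.hasDerivAt (x := s)).mul_const c).cexp
      simpa using this
    have h3 := h2.mul h1
    refine h3.congr_deriv ?_
    rw [inner_sum_cre_coh, hPf, _root_.add_apply, _root_.smul_apply, toL2_add, toL2_smul,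
      inner_add_right, inner_smul_right]
    simp only [one_apply_eq_self]
    ring
  have h4 : ∫ s in (0 : ℝ)..t, ⟪toL2 (coh v), gammaSemigroup K c s (toL2 Pf)⟫_ℂ =
      ∫ s in (0 : ℝ)..t, Complex.exp (s * c) *
        ⟪toL2 (coh (NormedSpace.exp ((s : ℂ) • Kᴴ) *ᵥ v)), toL2 Pf⟫_ℂ :=
    intervalIntegral.integral_congr fun s hs => inner_coh_gammaSemigroup hκ hK c (hsub hs) v _
  rw [h4, intervalIntegral.integral_eq_sub_of_hasDerivAt (f := F) (fun s _ => hder s)]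
  · rw [inner_sub_right, inner_coh_gammaSemigroup hκ hK c ht, hF]
    simp
  · refine Continuous.intervalIntegrable ?_ _ _
    have h1 := (continuous_coh n).comp (continuous_exp_smul_mulVec Kᴴ v)
    have h2 : Continuous fun t : ℝ => Complex.exp (t * c) := by fun_prop
    exact h2.mul (h1.inner continuous_const)

/-- The contraction semigroup generated by `dΓ(K) + c`. -/
theorem isContractionSemigroup_gammaSemigroup {n : ℕ} {K : Matrix (Fin n) (Fin n) ℂ} {κ : ℝ}
    (hκ : 0 ≤ κ) (hK : Kᴴ = -K - (2 * κ : ℂ) • (1 : Matrix (Fin n) (Fin n) ℂ)) {c : ℂ}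
    (hc : c.re ≤ 0) :
    IsContractionSemigroup (dGamma K + c • (1 : Sch n →L[ℂ] Sch n)) (gammaSemigroup K c) where
  map_zero := clm_ext_coh fun w => by
    rw [gammaSemigroup_coh hκ hK c le_rfl]
    simp
  map_add s t hs ht := clm_ext_coh fun w => by
    rw [gammaSemigroup_coh hκ hK c (add_nonneg hs ht), mul_apply_eq_comp,
      gammaSemigroup_coh hκ hK c ht, map_smul, gammaSemigroup_coh hκ hK c hs, mulVec_mulVec,
      exp_smul_mul_exp_smul, smul_smul, ← Complex.exp_add]
    congr 2
    push_cast
    ring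
  norm_le_one t ht := norm_gammaSemigroup_le hκ hK hc ht
  continuousOn f := continuousOn_gammaSemigroup hκ hK hc f
  hasDerivWithinAt f := by
    set Pf := (dGamma K + c • (1 : Sch n →L[ℂ] Sch n)) f
    have hcont := continuousOn_gammaSemigroup hκ hK hc (toL2 Pf)
    have h0 : gammaSemigroup K c 0 (toL2 Pf) = toL2 Pf := by
      have : gammaSemigroup K c 0 = 1 := clm_ext_coh fun w => by
        rw [gammaSemigroup_coh hκ hK c le_rfl]; simp
      rw [this, one_apply_eq_self]
    have h1 : HasDerivWithinAt (fun t => ∫ s in (0 : ℝ)..t, gammaSemigroup K c s (toL2 Pf))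
        (gammaSemigroup K c 0 (toL2 Pf)) (Set.Ici 0) 0 := by
      refine intervalIntegral.integral_hasDerivWithinAt_right (t := Set.Ioi 0)
        IntervalIntegrable.refl ?_ ?_
      · refine ⟨Set.Ici 0, ?_, hcont.aestronglyMeasurable measurableSet_Ici⟩
        exact mem_of_superset self_mem_nhdsWithin Set.Ioi_subset_Ici_self
      · exact (hcont 0 Set.self_mem_Ici).mono Set.Ioi_subset_Ici_self
    rw [h0] at h1
    refine (h1.add_const (toL2 f)).congr (fun t ht => ?_) ?_
    · rw [← gammaSemigroup_sub hκ hK hc f ht, sub_add_cancel]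
    · rw [← gammaSemigroup_sub hκ hK hc f le_rfl, sub_add_cancel]

theorem expOp_dGamma {n : ℕ} {K : Matrix (Fin n) (Fin n) ℂ} {κ : ℝ}
    (hκ : 0 ≤ κ) (hK : Kᴴ = -K - (2 * κ : ℂ) • (1 : Matrix (Fin n) (Fin n) ℂ)) {c : ℂ}
    (hc : c.re ≤ 0) {t : ℝ} (ht : 0 ≤ t) :
    expOp (dGamma K + c • (1 : Sch n →L[ℂ] Sch n)) t = gammaSemigroup K c t :=
  (isContractionSemigroup_gammaSemigroup hκ hK hc).expOp_eq
    (fun _ hs w => ⟨_, (gammaSemigroup_coh hκ hK c hs w).trans (toL2_smul _ _).symm⟩) ht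

/-- The heat operator is a second quantization. -/
theorem heatOp_eq (n : ℕ) {t : ℝ} (ht : 0 ≤ t) : heatOp n t =
    (Real.exp (-t * n / 2) : ℂ) • Gamma ((Real.exp (-t) : ℂ) • (1 : Matrix (Fin n) (Fin n) ℂ)) := by
  rw [heatOp, harmonicOsc_eq, sub_eq_add_neg, ← neg_smul, expOp_dGamma zero_le_one _ _ ht,
    gammaSemigroup, smul_neg, ← neg_smul, exp_smul_one]
  · push_cast
    congr 2
    ring
  · rw [conjTranspose_neg, conjTranspose_one]
    push_cast
    module
  · simp
    positivity

/-- The metaplectic operator is a second quantization. -/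
theorem metaplecticR_eq {n : ℕ} (g : Matrix.unitaryGroup (Fin n) ℂ)
    (hg : ∃ AB, IsLogarithm (g : Matrix (Fin n) (Fin n) ℂ) AB) :
    metaplecticR g = Gamma ((g : Matrix (Fin n) (Fin n) ℂ).map star) := by
  rw [metaplecticR, dif_pos hg]
  obtain ⟨hA, hB, hgAB⟩ := hg.choose_spec
  set A := hg.choose.1
  set B := hg.choose.2
  rw [weylQuadratic_eq A B hA hB, sub_eq_add_neg, ← neg_smul,
    expOp_dGamma le_rfl _ _ zero_le_one, gammaSemigroup, smul_smul, ← Complex.exp_add]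
  · have e : Complex.I * A.trace / 2 + ((1 : ℝ) : ℂ) * -(Complex.I * A.trace / 2) = 0 := by
      push_cast; ring
    rw [e, Complex.exp_zero, one_smul, Complex.ofReal_one, one_smul, hgAB]
    congr 1
    -- Entrywise conjugation is the transpose of the adjoint, and both commute with exp. Thus exp(B
    -- - iA), with A and B real, is the conjugate of exp(B + iA).
    have h1 : ∀ X : Matrix (Fin n) (Fin n) ℂ, X.map star = Xᴴᵀ := fun X => by
      ext; simp [conjTranspose_apply]
    rw [h1, ← Matrix.exp_conjTranspose, ← Matrix.exp_transpose, ← h1]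
    congr 1
    ext i j
    simp [sub_eq_add_neg]
  · ext i j
    have hA' : A j i = A i j := congrFun (congrFun hA i) j
    have hB' : B j i = -B i j := congrFun (congrFun hB i) j
    simp [hA', hB']
    ring
  · simp

end

end HeatTrace

namespace HeatTrace

noncomputable section

/-! ### Gaussian moments -/

/-- The moments `∫ x^k exp(-λ x² + β x) dx` of a complex Gaussian. -/
def gmom (l β : ℂ) (k : ℕ) : ℂ := ∫ x : ℝ, (x : ℂ) ^ k * Complex.exp (-l * x ^ 2 + β * x)

/-- The bound |x|^k ≤ k!(e^x + e^{-x}) dominates the integrand by two Gaussians with β shifted by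
±1. -/
theorem integrable_gmom {l : ℂ} (hl : 0 < l.re) (β : ℂ) (k : ℕ) :
    Integrable fun x : ℝ => (x : ℂ) ^ k * Complex.exp (-l * x ^ 2 + β * x) := by
  have h1 := (integrable_cexp_quadratic' (b := -l) (by simpa using hl) (β + 1) 0).norm
  have h2 := (integrable_cexp_quadratic' (b := -l) (by simpa using hl) (β - 1) 0).norm
  refine Integrable.mono' ((h1.add h2).const_mul (k.factorial : ℝ))
    (by fun_prop) (Eventually.of_forall fun x => ?_)
  have e1 : ‖Complex.exp (-l * x ^ 2 + (β + 1) * x + 0)‖ =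
      ‖Complex.exp (-l * x ^ 2 + β * x)‖ * Real.exp x := by
    rw [← Real.norm_of_nonneg (Real.exp_pos x).le, ← Complex.norm_real, ← norm_mul,
      Complex.ofReal_exp, ← Complex.exp_add]
    ring_nf
  have e2 : ‖Complex.exp (-l * x ^ 2 + (β - 1) * x + 0)‖ =
      ‖Complex.exp (-l * x ^ 2 + β * x)‖ * Real.exp (-x) := by
    rw [← Real.norm_of_nonneg (Real.exp_pos (-x)).le, ← Complex.norm_real, ← norm_mul,
      Complex.ofReal_exp, ← Complex.exp_add]
    push_cast
    ring_nf
  simp only [Pi.add_apply]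
  rw [e1, e2, norm_mul, norm_pow, Complex.norm_real, Real.norm_eq_abs, ← mul_add, mul_left_comm,
    mul_comm (|x| ^ k)]
  refine mul_le_mul_of_nonneg_left ?_ (norm_nonneg _)
  have h3 := Real.pow_div_factorial_le_exp |x| (abs_nonneg x) k
  rw [div_le_iff₀' (by positivity)] at h3
  refine h3.trans (mul_le_mul_of_nonneg_left ?_ (by positivity))
  rcases abs_cases x with ⟨h, _⟩ | ⟨h, _⟩ <;> rw [h] <;>
    linarith [Real.exp_pos x, Real.exp_pos (-x)]

theorem gmom_zero {l : ℂ} (hl : 0 < l.re) (β : ℂ) :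
    gmom l β 0 = (Real.pi / l) ^ (1 / 2 : ℂ) * Complex.exp (β ^ 2 / (4 * l)) := by
  have := integral_cexp_quadratic (b := -l) (by simpa using hl) β 0
  simp only [gmom, pow_zero, one_mul]
  simp only [add_zero, neg_neg, zero_sub] at this
  rw [this]
  congr 2
  rw [mul_neg, div_neg, neg_neg]

/-- Integration by parts: the derivative of x^k exp(-λx² + βx) has integral zero. For k = 0 the
truncated index k - 1 is harmless, since its coefficient is zero. -/
theorem gmom_succ {l : ℂ} (hl : 0 < l.re) (β : ℂ) (k : ℕ) :
    2 * l * gmom l β (k + 1) = β * gmom l β k + k * gmom l β (k - 1) := by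
  have hd : ∀ x : ℝ, HasDerivAt (fun x : ℝ => (x : ℂ) ^ k * Complex.exp (-l * x ^ 2 + β * x))
      (k * ((x : ℂ) ^ (k - 1) * Complex.exp (-l * x ^ 2 + β * x)) +
        β * ((x : ℂ) ^ k * Complex.exp (-l * x ^ 2 + β * x)) -
          2 * l * ((x : ℂ) ^ (k + 1) * Complex.exp (-l * x ^ 2 + β * x))) x := by
    intro x
    have hx := Complex.ofRealCLM.hasDerivAt (x := x)
    have h1 := hx.pow k
    have h2 := (((hx.pow 2).const_mul (-l)).add (hx.const_mul β)).cexp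
    have := h1.mul h2
    refine this.congr_deriv ?_
    simp
    ring
  have i1 := (integrable_gmom hl β (k - 1)).const_mul (k : ℂ)
  have i2 := (integrable_gmom hl β k).const_mul β
  have i3 := (integrable_gmom hl β (k + 1)).const_mul (2 * l)
  have i12 : Integrable (fun x : ℝ => k * ((x : ℂ) ^ (k - 1) * Complex.exp (-l * x ^ 2 + β * x)) +
      β * ((x : ℂ) ^ k * Complex.exp (-l * x ^ 2 + β * x))) := i1.add i2
  have := integral_eq_zero_of_hasDerivAt_of_integrable hd (i12.sub i3) (integrable_gmom hl β k)
  rw [integral_sub i12 i3, integral_add i1 i2, integral_const_mul, integral_const_mul,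
    integral_const_mul] at this
  simp only [gmom]
  linear_combination -this

/-- The Gaussian moments are controlled by the zeroth moment. -/
theorem exists_norm_gmom_le (k : ℕ) : ∃ C : ℝ, 0 ≤ C ∧ ∀ (l β : ℂ) (ρ : ℝ), 0 < l.re → 0 ≤ ρ →
    ‖β‖ ≤ ρ * ‖l‖ → 1 ≤ ρ ^ 2 * ‖l‖ → ‖gmom l β k‖ ≤ C * ρ ^ k * ‖gmom l β 0‖ := by
  induction k using Nat.strong_induction_on with
  | _ k ih =>
  match k with
  | 0 => exact ⟨1, zero_le_one, fun l β ρ _ _ _ _ => by simp⟩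
  | k + 1 =>
    obtain ⟨C1, hC1, h1⟩ := ih k (by omega)
    obtain ⟨C2, hC2, h2⟩ := ih (k - 1) (by omega)
    -- The constant that the recursion produces after division by ‖l‖; the favourable factor 2 is
    -- given away at the end.
    refine ⟨C1 + k * C2, by positivity, fun l β ρ hl hρ hβ hρl => ?_⟩
    have hl0 : l ≠ 0 := by rintro rfl; simp at hl
    have hl' : 0 < ‖l‖ := norm_pos_iff.2 hl0
    have h3 := gmom_succ hl β k
    have h4 : 2 * ‖l‖ * ‖gmom l β (k + 1)‖ ≤
        ‖β‖ * ‖gmom l β k‖ + k * ‖gmom l β (k - 1)‖ := by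
      calc 2 * ‖l‖ * ‖gmom l β (k + 1)‖ = ‖2 * l * gmom l β (k + 1)‖ := by simp
        _ = ‖β * gmom l β k + k * gmom l β (k - 1)‖ := by rw [h3]
        _ ≤ _ := (norm_add_le _ _).trans (by simp)
    have h5 : ‖β‖ * ‖gmom l β k‖ ≤ ρ * ‖l‖ * (C1 * ρ ^ k * ‖gmom l β 0‖) := by
      have := h1 l β ρ hl hρ hβ hρl
      gcongr
    -- The moment of order k - 1 lacks two powers of ρ; they are supplied by 1 ≤ ρ²‖l‖, which also
    -- supplies the ‖l‖ to be divided out.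
    have h6 : k * ‖gmom l β (k - 1)‖ ≤ ‖l‖ * (k * C2 * ρ ^ (k + 1) * ‖gmom l β 0‖) := by
      rcases Nat.eq_zero_or_pos k with rfl | hk
      · simp
      · obtain ⟨k, rfl⟩ : ∃ j, k = j + 1 := ⟨k - 1, by omega⟩
        have := h2 l β ρ hl hρ hβ hρl
        simp only [Nat.add_sub_cancel] at this ⊢
        calc ((k + 1 : ℕ) : ℝ) * ‖gmom l β k‖
            ≤ (k + 1 : ℕ) * (1 * (C2 * ρ ^ k * ‖gmom l β 0‖)) := by rw [one_mul]; gcongr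
          _ ≤ (k + 1 : ℕ) * ((ρ ^ 2 * ‖l‖) * (C2 * ρ ^ k * ‖gmom l β 0‖)) := by gcongr
          _ = _ := by ring
    have h7 : ‖l‖ * (2 * ‖gmom l β (k + 1)‖) ≤
        ‖l‖ * ((C1 + k * C2) * ρ ^ (k + 1) * ‖gmom l β 0‖) := by
      calc _ = 2 * ‖l‖ * ‖gmom l β (k + 1)‖ := by ring
        _ ≤ _ := h4.trans (add_le_add h5 h6)
        _ = _ := by ring
    have h8 := le_of_mul_le_mul_left h7 hl'
    linarith [norm_nonneg (gmom l β (k + 1))]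

/-- A Gaussian on `ℂ` times a monomial in the real and imaginary parts. -/
def cgauss (l b c : ℂ) (p q : ℕ) (u : ℂ) : ℂ :=
  (u.re : ℂ) ^ p * (u.im : ℂ) ^ q * Complex.exp (-l * ((‖u‖ ^ 2 : ℝ) : ℂ) + b * u + c * star u)

/-- With u = x + iy one has bu + cū = (b + c)x + i(b - c)y, so the Gaussian on ℂ splits into two on
ℝ. -/
theorem cgauss_eq (l b c : ℂ) (p q : ℕ) (x y : ℝ) :
    cgauss l b c p q (Complex.measurableEquivRealProd.symm (x, y)) =
      ((x : ℂ) ^ p * Complex.exp (-l * x ^ 2 + (b + c) * x)) *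
        ((y : ℂ) ^ q * Complex.exp (-l * y ^ 2 + (Complex.I * (b - c)) * y)) := by
  have e : Complex.measurableEquivRealProd.symm (x, y) = ⟨x, y⟩ := rfl
  rw [e, cgauss, mul_mul_mul_comm, ← Complex.exp_add]
  congr 2
  rw [← Complex.normSq_eq_norm_sq, Complex.normSq_mk, RCLike.star_def, Complex.mk_eq_add_mul_I]
  push_cast
  simp only [map_add, map_mul, Complex.conj_ofReal, Complex.conj_I]
  ring

theorem integrable_cgauss {l : ℂ} (hl : 0 < l.re) (b c : ℂ) (p q : ℕ) :
    Integrable (cgauss l b c p q) := by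
  rw [← Complex.volume_preserving_equiv_real_prod.symm.integrable_comp_emb
    (MeasurableEquiv.measurableEmbedding _)]
  refine ((integrable_gmom hl (b + c) p).mul_prod (integrable_gmom hl (Complex.I * (b - c)) q)).congr
    (Eventually.of_forall fun z => ?_)
  exact (cgauss_eq l b c p q z.1 z.2).symm

theorem integral_cgauss (l b c : ℂ) (p q : ℕ) :
    ∫ u, cgauss l b c p q u = gmom l (b + c) p * gmom l (Complex.I * (b - c)) q := by
  rw [← Complex.volume_preserving_equiv_real_prod.symm.integral_comp
    (MeasurableEquiv.measurableEmbedding _), gmom, gmom, ← integral_prod_mul]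
  exact integral_congr_ae (Eventually.of_forall fun z => cgauss_eq l b c p q z.1 z.2)

/-- The exponents add up by (b + c)² - (b - c)² = 4bc. The same square root of π/λ occurs twice, so
no choice of branch remains. -/
theorem integral_cgauss_zero {l : ℂ} (hl : 0 < l.re) (b c : ℂ) :
    ∫ u, cgauss l b c 0 0 u = Real.pi / l * Complex.exp (b * c / l) := by
  have hl0 : l ≠ 0 := by rintro rfl; simp at hl
  rw [integral_cgauss, gmom_zero hl, gmom_zero hl, mul_mul_mul_comm, ← Complex.exp_add]
  congr 1
  · rw [← pow_two, ← Complex.cpow_nat_mul]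
    simp
  · congr 1
    field_simp
    linear_combination (b - c) ^ 2 * Complex.I_sq

/-- A product Gaussian on `ℂⁿ` times a monomial. -/
def cgaussPi {n : ℕ} (l b c : Fin n → ℂ) (p q : Fin n → ℕ) (u : Fin n → ℂ) : ℂ :=
  ∏ j, cgauss (l j) (b j) (c j) (p j) (q j) (u j)

theorem integrable_cgaussPi {n : ℕ} {l : Fin n → ℂ} (hl : ∀ j, 0 < (l j).re) (b c : Fin n → ℂ)
    (p q : Fin n → ℕ) : Integrable (cgaussPi l b c p q) :=
  Integrable.fintype_prod fun j => integrable_cgauss (hl j) (b j) (c j) (p j) (q j)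

theorem integral_cgaussPi {n : ℕ} (l b c : Fin n → ℂ) (p q : Fin n → ℕ) :
    ∫ u, cgaussPi l b c p q u = ∏ j, ∫ u, cgauss (l j) (b j) (c j) (p j) (q j) u :=
  integral_fintype_prod_volume_eq_prod fun j => cgauss (l j) (b j) (c j) (p j) (q j)

theorem cgaussPi_zero {n : ℕ} (l b c : Fin n → ℂ) (u : Fin n → ℂ) :
    cgaussPi l b c 0 0 u =
      Complex.exp (∑ j, (-l j * ((‖u j‖ ^ 2 : ℝ) : ℂ) + b j * u j + c j * star (u j))) := by
  simp [cgaussPi, cgauss, Complex.exp_sum]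

theorem cgaussPi_eq {n : ℕ} (l b c : Fin n → ℂ) (p q : Fin n → ℕ) (u : Fin n → ℂ) :
    cgaussPi l b c p q u = (∏ j, ((u j).re : ℂ) ^ p j * ((u j).im : ℂ) ^ q j) *
      cgaussPi l b c 0 0 u := by
  simp [cgaussPi, cgauss, Finset.prod_mul_distrib]

end

end HeatTrace

namespace HeatTrace

noncomputable section

/-! ### The resolution of the identity -/

open scoped Matrix
open Matrix (star_dotProduct)

/-- The normalized coherent states, in the coordinates given by a unitary matrix. -/
def cohState {n : ℕ} (h : Matrix.unitaryGroup (Fin n) ℂ) (u : Fin n → ℂ) : L2 n :=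
  ((√(Real.pi ^ n))⁻¹ * Real.exp (-sqSum u / 2) : ℝ) •
    toL2 (coh ((h : Matrix (Fin n) (Fin n) ℂ) *ᵥ u))

theorem continuous_cohState {n : ℕ} (h : Matrix.unitaryGroup (Fin n) ℂ) :
    Continuous (cohState h) := by
  have h1 : Continuous fun u : Fin n → ℂ => (h : Matrix (Fin n) (Fin n) ℂ) *ᵥ u :=
    Continuous.matrix_mulVec continuous_const continuous_id
  have h2 : Continuous fun u : Fin n → ℂ =>
      ((√(Real.pi ^ n))⁻¹ * Real.exp (-sqSum u / 2) : ℝ) := by unfold sqSum; fun_prop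
  exact h2.smul ((continuous_coh n).comp h1)

theorem inner_cohState_left {n : ℕ} (h : Matrix.unitaryGroup (Fin n) ℂ) (u : Fin n → ℂ)
    (f : L2 n) : ⟪cohState h u, f⟫_ℂ = ((√(Real.pi ^ n))⁻¹ * Real.exp (-sqSum u / 2) : ℝ) *
      ⟪toL2 (coh ((h : Matrix (Fin n) (Fin n) ℂ) *ᵥ u)), f⟫_ℂ := by
  rw [cohState, inner_smul_left_eq_smul, Complex.real_smul]

theorem inner_cohState_mul_inner_cohState {n : ℕ} (h : Matrix.unitaryGroup (Fin n) ℂ)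
    (u : Fin n → ℂ) (f g : L2 n) :
    ⟪f, cohState h u⟫_ℂ * ⟪cohState h u, g⟫_ℂ = ((Real.pi : ℂ) ^ n)⁻¹ *
      (Complex.exp (-(sqSum u : ℂ)) * (⟪f, toL2 (coh ((h : Matrix (Fin n) (Fin n) ℂ) *ᵥ u))⟫_ℂ *
        ⟪toL2 (coh ((h : Matrix (Fin n) (Fin n) ℂ) *ᵥ u)), g⟫_ℂ)) := by
  have h1 : ((√(Real.pi ^ n))⁻¹ * Real.exp (-sqSum u / 2) : ℝ) *
      ((√(Real.pi ^ n))⁻¹ * Real.exp (-sqSum u / 2) : ℝ) =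
        (Real.pi ^ n)⁻¹ * Real.exp (-sqSum u) := by
    rw [mul_mul_mul_comm, ← mul_inv, Real.mul_self_sqrt (by positivity), ← Real.exp_add]
    ring_nf
  have h2 : (((√(Real.pi ^ n))⁻¹ * Real.exp (-sqSum u / 2) : ℝ) : ℂ) *
      ((√(Real.pi ^ n))⁻¹ * Real.exp (-sqSum u / 2) : ℝ) =
        ((Real.pi : ℂ) ^ n)⁻¹ * Complex.exp (-(sqSum u : ℂ)) := by
    rw [← Complex.ofReal_mul, h1]
    push_cast
    ring
  rw [← inner_conj_symm f, inner_cohState_left, inner_cohState_left, map_mul, inner_conj_symm,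
    Complex.conj_ofReal, mul_mul_mul_comm, h2, mul_assoc]

theorem unitary_dotProduct {n : ℕ} (h : Matrix.unitaryGroup (Fin n) ℂ) (v w : Fin n → ℂ) :
    star ((h : Matrix (Fin n) (Fin n) ℂ)ᴴ *ᵥ v) ⬝ᵥ ((h : Matrix (Fin n) (Fin n) ℂ)ᴴ *ᵥ w) =
      star v ⬝ᵥ w := by
  rw [star_mulVec_dotProduct, Matrix.conjTranspose_conjTranspose, Matrix.mulVec_mulVec]
  have : (h : Matrix (Fin n) (Fin n) ℂ) * (h : Matrix (Fin n) (Fin n) ℂ)ᴴ = 1 :=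
    Matrix.mem_unitaryGroup_iff.1 h.2
  rw [this, Matrix.one_mulVec]

/-- In the coordinates u the integrand is π^{-n} times a product Gaussian with λ = 1, whose integral
is π^n exp(v̄·w) because h preserves the Hermitian product. -/
theorem resolution_coh {n : ℕ} (h : Matrix.unitaryGroup (Fin n) ℂ) (v w : Fin n → ℂ) :
    Integrable (fun u => ⟪toL2 (coh v), cohState h u⟫_ℂ * ⟪cohState h u, toL2 (coh w)⟫_ℂ) ∧
      ∫ u, ⟪toL2 (coh v), cohState h u⟫_ℂ * ⟪cohState h u, toL2 (coh w)⟫_ℂ =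
        ⟪toL2 (coh v), toL2 (coh w)⟫_ℂ := by
  set H := (h : Matrix (Fin n) (Fin n) ℂ)
  have e : (fun u => ⟪toL2 (coh v), cohState h u⟫_ℂ * ⟪cohState h u, toL2 (coh w)⟫_ℂ) =
      fun u => ((Real.pi : ℂ) ^ n)⁻¹ *
        cgaussPi (fun _ => 1) (star (Hᴴ *ᵥ v)) (Hᴴ *ᵥ w) 0 0 u := by
    funext u
    rw [inner_cohState_mul_inner_cohState, cgaussPi_zero, inner_coh, inner_coh, ← Complex.exp_add,
      ← Complex.exp_add]
    congr 2
    have e1 : star v ⬝ᵥ H *ᵥ u = ∑ j, star (Hᴴ *ᵥ v) j * u j := by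
      have := star_mulVec_dotProduct Hᴴ v u
      rw [Matrix.conjTranspose_conjTranspose] at this
      exact this.symm
    have e2 : star (H *ᵥ u) ⬝ᵥ w = ∑ j, (Hᴴ *ᵥ w) j * star (u j) := by
      rw [star_mulVec_dotProduct, dotProduct_comm]
      rfl
    rw [e1, e2]
    simp only [sqSum, Finset.sum_add_distrib]
    push_cast
    simp only [neg_mul, one_mul, Finset.sum_neg_distrib]
    ring
  rw [e]
  refine ⟨(integrable_cgaussPi (fun _ => by simp) _ _ _ _).const_mul _, ?_⟩
  rw [integral_const_mul, integral_cgaussPi]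
  simp only [Pi.zero_apply]
  rw [Finset.prod_congr rfl fun j _ => integral_cgauss_zero (by simp) _ _]
  rw [Finset.prod_mul_distrib, ← Complex.exp_sum, inner_coh, ← unitary_dotProduct h v w]
  simp only [div_one, Finset.prod_const, Finset.card_univ, Fintype.card_fin]
  rw [← mul_assoc, inv_mul_cancel₀ (by simp [Real.pi_ne_zero]), one_mul]
  rfl

theorem memLp_inner_cohState_cohSum {n : ℕ} (h : Matrix.unitaryGroup (Fin n) ℂ)
    (c : (Fin n → ℂ) →₀ ℂ) : MemLp (fun u => ⟪cohState h u, cohSum n c⟫_ℂ) 2 := by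
  have h1 : ∀ w : Fin n → ℂ, MemLp (fun u => ⟪cohState h u, toL2 (coh w)⟫_ℂ) 2 := by
    intro w
    have hm : AEStronglyMeasurable (fun u => ⟪cohState h u, toL2 (coh w)⟫_ℂ) volume :=
      ((continuous_cohState h).inner continuous_const).aestronglyMeasurable
    rw [memLp_two_iff_integrable_sq_norm hm]
    refine (resolution_coh h w w).1.norm.congr (Eventually.of_forall fun u => ?_)
    simp only
    rw [norm_mul, norm_inner_symm, ← pow_two]
  have h2 : (fun u => ⟪cohState h u, cohSum n c⟫_ℂ) =
      fun u => ∑ w ∈ c.support, c w * ⟪cohState h u, toL2 (coh w)⟫_ℂ := by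
    funext u
    simp only [cohSum, Finsupp.linearCombination_apply, Finsupp.sum, inner_sum, inner_smul_right]
  rw [h2]
  exact memLp_finsetSum _ fun w _ => (h1 w).const_mul (c w)

theorem integral_norm_sq_inner_cohState_cohSum {n : ℕ} (h : Matrix.unitaryGroup (Fin n) ℂ)
    (c : (Fin n → ℂ) →₀ ℂ) :
    ∫ u, ‖⟪cohState h u, cohSum n c⟫_ℂ‖ ^ 2 = ‖cohSum n c‖ ^ 2 := by
  have h1 : ∫ u, ⟪cohSum n c, cohState h u⟫_ℂ * ⟪cohState h u, cohSum n c⟫_ℂ =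
      ⟪cohSum n c, cohSum n c⟫_ℂ := by
    have e1 : ∀ u, ⟪cohSum n c, cohState h u⟫_ℂ * ⟪cohState h u, cohSum n c⟫_ℂ =
        ∑ v ∈ c.support, ∑ w ∈ c.support, (starRingEnd ℂ (c v) * c w) *
          (⟪toL2 (coh v), cohState h u⟫_ℂ * ⟪cohState h u, toL2 (coh w)⟫_ℂ) := by
      intro u
      simp only [cohSum, Finsupp.linearCombination_apply, Finsupp.sum, inner_sum,
        inner_smul_right, sum_inner, inner_smul_left, Finset.sum_mul_sum]
      exact Finset.sum_congr rfl fun v _ => Finset.sum_congr rfl fun w _ => by ring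
    have e2 : ⟪cohSum n c, cohSum n c⟫_ℂ = ∑ v ∈ c.support, ∑ w ∈ c.support,
        (starRingEnd ℂ (c v) * c w) * ⟪toL2 (coh v), toL2 (coh w)⟫_ℂ := by
      simp only [cohSum, inner_cohSum (fun w => w) (fun w => w), inner_coh, RCLike.star_def]
    simp_rw [e1]
    rw [e2, integral_finsetSum _ fun v _ => integrable_finsetSum _ fun w _ =>
      (resolution_coh h v w).1.const_mul _]
    refine Finset.sum_congr rfl fun v _ => ?_
    rw [integral_finsetSum _ fun w _ => (resolution_coh h v w).1.const_mul _]
    refine Finset.sum_congr rfl fun w _ => ?_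
    rw [integral_const_mul, (resolution_coh h v w).2]
  have h2 : ∀ u, ⟪cohSum n c, cohState h u⟫_ℂ * ⟪cohState h u, cohSum n c⟫_ℂ =
      ((‖⟪cohState h u, cohSum n c⟫_ℂ‖ ^ 2 : ℝ) : ℂ) := by
    intro u
    rw [← inner_conj_symm, RCLike.conj_mul]
    norm_cast
  rw [integral_congr_ae (Eventually.of_forall h2), integral_complex_ofReal,
    inner_self_eq_norm_sq_to_K] at h1
  exact Complex.ofReal_injective (h1.trans (by simp))

/-- The transform is isometric on the dense span of the exponential vectors; Fatou's lemma passes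
this to the limit as an inequality, which suffices to define it on L². -/
theorem eLpNorm_inner_cohState_le {n : ℕ} (h : Matrix.unitaryGroup (Fin n) ℂ) (f : L2 n) :
    eLpNorm (fun u => ⟪cohState h u, f⟫_ℂ) 2 volume ≤ ENNReal.ofReal ‖f‖ := by
  have hd : ∀ k : ℕ, ∃ c, dist f (cohSum n c) < 1 / ((k : ℝ) + 1) := fun k =>
    (denseRange_cohSum n).exists_dist_lt f (by positivity)
  choose c hc using hd
  have hlim : Tendsto (fun k => cohSum n (c k)) atTop (𝓝 f) := by
    rw [tendsto_iff_dist_tendsto_zero]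
    refine squeeze_zero (fun _ => dist_nonneg) (fun k => ?_) tendsto_one_div_add_atTop_nhds_zero_nat
    rw [dist_comm]
    exact (hc k).le
  have hE : ∀ k, eLpNorm (fun u => ⟪cohState h u, cohSum n (c k)⟫_ℂ) 2 volume =
      ENNReal.ofReal ‖cohSum n (c k)‖ := by
    intro k
    rw [(memLp_inner_cohState_cohSum h (c k)).eLpNorm_eq_integral_rpow_norm (by norm_num)
      (by norm_num)]
    congr 1
    simp only [ENNReal.toReal_ofNat, Real.rpow_two]
    rw [integral_norm_sq_inner_cohState_cohSum, ← Real.rpow_natCast, ← Real.rpow_mul (norm_nonneg _)]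
    norm_num
  refine (Lp.eLpNorm_lim_le_liminf_eLpNorm (fun k => (memLp_inner_cohState_cohSum h (c k)).1) _
    (Eventually.of_forall fun u => tendsto_const_nhds.inner hlim)).trans ?_
  simp_rw [hE]
  exact (ENNReal.tendsto_ofReal hlim.norm).liminf_eq.le

theorem memLp_inner_cohState {n : ℕ} (h : Matrix.unitaryGroup (Fin n) ℂ) (f : L2 n) :
    MemLp (fun u => ⟪cohState h u, f⟫_ℂ) 2 :=
  ⟨((continuous_cohState h).inner continuous_const).aestronglyMeasurable,
    (eLpNorm_inner_cohState_le h f).trans_lt ENNReal.ofReal_lt_top⟩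

/-- The coherent state transform. -/
def cohTransform {n : ℕ} (h : Matrix.unitaryGroup (Fin n) ℂ) :
    L2 n →L[ℂ] Lp ℂ 2 (volume : Measure (Fin n → ℂ)) :=
  LinearMap.mkContinuous
    { toFun := fun f => (memLp_inner_cohState h f).toLp
      map_add' := fun f g => by
        rw [← MemLp.toLp_add]
        exact MemLp.toLp_congr _ _ (Eventually.of_forall fun u => inner_add_right _ _ _)
      map_smul' := fun c f => by
        rw [RingHom.id_apply, ← MemLp.toLp_const_smul]
        exact MemLp.toLp_congr _ _ (Eventually.of_forall fun u => inner_smul_right _ _ _) }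
    1 (fun f => by
      rw [one_mul]
      simp only [LinearMap.coe_mk, AddHom.coe_mk, Lp.norm_toLp]
      exact ENNReal.toReal_le_of_le_ofReal (norm_nonneg _) (eLpNorm_inner_cohState_le h f))

theorem inner_cohTransform {n : ℕ} (h : Matrix.unitaryGroup (Fin n) ℂ) (f g : L2 n) :
    ⟪cohTransform h f, cohTransform h g⟫_ℂ =
      ∫ u, ⟪f, cohState h u⟫_ℂ * ⟪cohState h u, g⟫_ℂ := by
  rw [L2.inner_def]
  refine integral_congr_ae ?_
  filter_upwards [(memLp_inner_cohState h f).coeFn_toLp, (memLp_inner_cohState h g).coeFn_toLp]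
    with u hf hg
  have hf' : cohTransform h f u = ⟪cohState h u, f⟫_ℂ := hf
  have hg' : cohTransform h g u = ⟪cohState h u, g⟫_ℂ := hg
  rw [hf', hg', RCLike.inner_apply', inner_conj_symm]

theorem adjoint_cohTransform_comp {n : ℕ} (h : Matrix.unitaryGroup (Fin n) ℂ) :
    (ContinuousLinearMap.adjoint (cohTransform h)) ∘L cohTransform h = 1 :=
  clm_ext_coh fun w => ext_inner_coh fun v => by
    rw [ContinuousLinearMap.comp_apply, ContinuousLinearMap.adjoint_inner_right,
      inner_cohTransform, (resolution_coh h v w).2, one_apply_eq_self]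

/-- The resolution of the identity by coherent states. -/
theorem integral_inner_cohState {n : ℕ} (h : Matrix.unitaryGroup (Fin n) ℂ) (f g : L2 n) :
    ∫ u, ⟪f, cohState h u⟫_ℂ * ⟪cohState h u, g⟫_ℂ = ⟪f, g⟫_ℂ := by
  rw [← inner_cohTransform, ← ContinuousLinearMap.adjoint_inner_right]
  have := DFunLike.congr_fun (adjoint_cohTransform_comp h) g
  rw [ContinuousLinearMap.comp_apply, one_apply_eq_self] at this
  rw [this]

/-! ### Traces -/

/-- Balls of radius 1/2 around orthonormal vectors are disjoint and L² is separable. Countability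
makes dominated convergence available along the finite subsets of a basis. -/
theorem countable_of_orthonormal {n : ℕ} {ι : Type*} {b : ι → L2 n} (hb : Orthonormal ℂ b) :
    Countable ι := by
  have : Fact ((2 : ℝ≥0∞) ≠ ⊤) := ⟨by norm_num⟩
  rw [← Set.countable_univ_iff]
  refine Set.PairwiseDisjoint.countable_of_isOpen (s := fun i => Metric.ball (b i) (1 / 2)) ?_
    (fun i _ => Metric.isOpen_ball) fun i _ => ⟨b i, Metric.mem_ball_self (by norm_num)⟩
  intro i _ j _ hij
  refine Metric.ball_disjoint_ball ?_
  have h1 : ‖b i - b j‖ ^ 2 = 2 := by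
    rw [@norm_sub_sq ℂ, hb.1, hb.1, hb.2 hij]
    norm_num
  rw [dist_eq_norm]
  nlinarith [norm_nonneg (b i - b j)]

/-- Cauchy–Schwarz and Bessel. The bound is uniform in the finite set and serves as the dominating
function. -/
theorem norm_sum_inner_mul_inner_le {n : ℕ} {ι : Type*} {b : ι → L2 n} (hb : Orthonormal ℂ b)
    (s : Finset ι) (x y : L2 n) : ‖∑ i ∈ s, ⟪x, b i⟫_ℂ * ⟪b i, y⟫_ℂ‖ ≤ ‖x‖ * ‖y‖ := by
  refine (norm_sum_le _ _).trans ?_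
  simp only [norm_mul]
  refine le_of_sq_le_sq ?_ (by positivity)
  refine (Finset.sum_mul_sq_le_sq_mul_sq _ _ _).trans ?_
  rw [mul_pow]
  refine mul_le_mul ?_ (hb.sum_inner_products_le y) (by positivity) (by positivity)
  simp_rw [norm_inner_symm x]
  exact hb.sum_inner_products_le x

/-- Inserting the resolution of the identity into ⟨b_i, Y b_i⟩ and exchanging sum and integral,
Parseval turns the sum over i into ⟨cohState u, Y cohState u⟩. The partial sums are dominated by
‖cohState u‖‖Y cohState u‖. -/
theorem hasSum_inner_of_integrable {n : ℕ} (h : Matrix.unitaryGroup (Fin n) ℂ)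
    (Y : L2 n →L[ℂ] L2 n) (hY : Integrable fun u => ‖cohState h u‖ * ‖Y (cohState h u)‖)
    {w : Set (L2 n)} (b : HilbertBasis w ℂ (L2 n)) :
    HasSum (fun i => ⟪b i, Y (b i)⟫_ℂ) (∫ u, ⟪cohState h u, Y (cohState h u)⟫_ℂ) := by
  have := countable_of_orthonormal b.orthonormal
  have hc := continuous_cohState h
  have e : ∀ i, ⟪b i, Y (b i)⟫_ℂ =
      ∫ u, ⟪cohState h u, b i⟫_ℂ * ⟪b i, Y (cohState h u)⟫_ℂ := by
    intro i
    rw [← ContinuousLinearMap.adjoint_inner_left, ← integral_inner_cohState h]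
    congr 1
    funext u
    rw [ContinuousLinearMap.adjoint_inner_left, mul_comm]
  simp_rw [e]
  have hint : ∀ i, Integrable fun u => ⟪cohState h u, b i⟫_ℂ * ⟪b i, Y (cohState h u)⟫_ℂ := by
    intro i
    refine hY.mono ((hc.inner continuous_const).mul
      (continuous_const.inner (Y.continuous.comp hc))).aestronglyMeasurable
      (Eventually.of_forall fun u => ?_)
    have := norm_sum_inner_mul_inner_le b.orthonormal {i} (cohState h u) (Y (cohState h u))
    rw [Finset.sum_singleton] at this
    rw [Real.norm_of_nonneg (mul_nonneg (norm_nonneg _) (norm_nonneg _))]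
    exact this
  rw [HasSum]
  simp only [SummationFilter.unconditional_filter]
  have hs : ∀ s : Finset w, ∑ i ∈ s, ∫ u, ⟪cohState h u, b i⟫_ℂ * ⟪b i, Y (cohState h u)⟫_ℂ =
      ∫ u, ∑ i ∈ s, ⟪cohState h u, b i⟫_ℂ * ⟪b i, Y (cohState h u)⟫_ℂ := fun s =>
    (integral_finsetSum _ fun i _ => hint i).symm
  simp_rw [hs]
  refine tendsto_integral_filter_of_dominated_convergence _ ?_ ?_ hY ?_
  · exact Eventually.of_forall fun s => (integrable_finsetSum _ fun i _ => hint i).1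
  · exact Eventually.of_forall fun s => Eventually.of_forall fun u =>
      norm_sum_inner_mul_inner_le b.orthonormal s _ _
  · exact Eventually.of_forall fun u => b.hasSum_inner_mul_inner _ _

/-- One has (WS)*(WS) = S W*W S ≤ ‖W‖² S², and the square root is operator monotone. -/
theorem abs_le_of_factor {E : Type*} [NormedAddCommGroup E] [InnerProductSpace ℂ E]
    [CompleteSpace E] (W S : E →L[ℂ] E) (hS : 0 ≤ S) : CFC.abs (W * S) ≤ ‖W‖ • S := by
  have h1 : star (W * S) * (W * S) ≤ star (‖W‖ • S) * (‖W‖ • S) := by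
    have h2 : star W * W ≤ algebraMap ℝ _ (‖W‖ ^ 2) := by
      have := CStarAlgebra.star_mul_le_algebraMap_norm_sq (a := W)
      exact this
    have h3 := star_left_conjugate_le_conjugate h2 S
    rw [star_mul]
    calc star S * star W * (W * S) = star S * (star W * W) * S := by simp only [mul_assoc]
      _ ≤ _ := h3
      _ = _ := by
        rw [star_smul, Algebra.algebraMap_eq_smul_one, mul_smul_comm, smul_mul_assoc, mul_one,
          smul_mul_smul_comm, pow_two]
        simp
  have h4 := CFC.sqrt_le_sqrt _ _ h1
  have h5 : 0 ≤ ‖W‖ • S := smul_nonneg (norm_nonneg _) hS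
  rw [IsSelfAdjoint.of_nonneg h5 |>.star_eq, CFC.sqrt_mul_self _ h5] at h4
  exact h4

theorem isTraceClass_of_factor {E : Type*} [NormedAddCommGroup E] [InnerProductSpace ℂ E]
    [CompleteSpace E] (W S : E →L[ℂ] E) (hS : 0 ≤ S)
    (h : ∀ (w : Set E) (b : HilbertBasis w ℂ E), Summable fun i => ⟪b i, S (b i)⟫_ℂ) :
    IsTraceClass (W * S) := fun w b => by
  have h2 : Summable fun i => ‖W‖ * (⟪b i, S (b i)⟫_ℂ).re :=
    (Complex.reCLM.summable (h w b)).mul_left _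
  have hpos : 0 ≤ CFC.abs (W * S) := CFC.abs_nonneg _
  refine Summable.of_nonneg_of_le (fun i => ?_) (fun i => ?_) h2
  · exact ((ContinuousLinearMap.nonneg_iff_isPositive _).1 hpos).re_inner_nonneg_right (b i)
  · have h3 := (ContinuousLinearMap.le_def _ _).1 (abs_le_of_factor W S hS)
    have h4 := h3.re_inner_nonneg_right (b i)
    simp only [_root_.sub_apply, _root_.smul_apply, inner_sub_right, inner_smul_right_eq_smul,
      map_sub, RCLike.re_eq_complex_re, Complex.smul_re, smul_eq_mul] at h4
    linarith

/-- The product of a bounded operator and a positive operator with integrable lower symbol has a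
trace. -/
theorem hasTrace_of_factor {n : ℕ} (h : Matrix.unitaryGroup (Fin n) ℂ) (W S : L2 n →L[ℂ] L2 n)
    (hS : 0 ≤ S) (hSi : Integrable fun u => ‖cohState h u‖ * ‖S (cohState h u)‖) :
    HasTrace (W * S) (∫ u, ⟪cohState h u, (W * S) (cohState h u)⟫_ℂ) := by
  refine ⟨isTraceClass_of_factor W S hS fun w b => (hasSum_inner_of_integrable h S hSi b).summable,
    fun w b => hasSum_inner_of_integrable h _ ?_ b⟩
  refine (hSi.const_mul ‖W‖).mono ?_ (Eventually.of_forall fun u => ?_)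
  · have hc := continuous_cohState h
    exact (hc.norm.mul (((W * S).continuous.comp hc)).norm).aestronglyMeasurable
  · rw [Real.norm_of_nonneg (by positivity), Real.norm_of_nonneg (by positivity), mul_left_comm]
    exact mul_le_mul_of_nonneg_left (W.le_opNorm _) (norm_nonneg _)

/-- A Hilbert basis exists, so the condition in `HasTrace` is not vacuous. This makes traces
computed in different diagonalizations equal. -/
theorem HasTrace.unique {n : ℕ} {X : L2 n →L[ℂ] L2 n} {τ τ' : ℂ} (h : HasTrace X τ)
    (h' : HasTrace X τ') : τ = τ' := by
  obtain ⟨w, b, -⟩ := exists_hilbertBasis ℂ (L2 n)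
  exact (h.2 w b).unique (h'.2 w b)

end

end HeatTrace

namespace HeatTrace

noncomputable section

/-! ### Smoothing -/

section ParametricIntegral

variable {α : Type*} [MeasurableSpace α] {μ : Measure α} {E : Type*} [NormedAddCommGroup E]
  [NormedSpace ℝ E] {G : α → E → ℂ} {B : ℕ → α → ℝ}

/-- The isometry L stands for the currying that identifies a derivative of order m + 1 with the
derivative of one of order m; it commutes with the integral. -/
theorem hasFDerivAt_integral_of_linearIsometry {V V' : Type*} [NormedAddCommGroup V]
    [NormedSpace ℝ V] [NormedAddCommGroup V'] [NormedSpace ℝ V'] [CompleteSpace V]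
    [CompleteSpace V'] (L : V' ≃ₗᵢ[ℝ] (E →L[ℝ] V)) {F : α → E → V} {D : α → E → V'} {b : α → ℝ}
    {x : E} (hm : ∀ y, AEStronglyMeasurable (fun w => F w y) μ)
    (hFi : Integrable (fun w => F w x) μ) (hDm : AEStronglyMeasurable (fun w => D w x) μ)
    (hDb : ∀ w y, ‖D w y‖ ≤ b w) (hb : Integrable b μ)
    (hd : ∀ w y, HasFDerivAt (F w) (L (D w y)) y) :
    HasFDerivAt (fun y => ∫ w, F w y ∂μ) (L (∫ w, D w x ∂μ)) x := by
  have h := hasFDerivAt_integral_of_dominated_of_fderiv_le (μ := μ) (𝕜 := ℝ) (s := Set.univ)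
    (F := fun y w => F w y) (F' := fun y w => L (D w y)) (x₀ := x) (bound := b)
    univ_mem (Eventually.of_forall fun y => hm y) hFi (L.continuous.comp_aestronglyMeasurable hDm)
    (Eventually.of_forall fun w y _ => by
      rw [LinearIsometryEquiv.norm_map]
      exact hDb w y) hb (Eventually.of_forall fun w y _ => hd w y)
  have h2 : ∫ w, L (D w x) ∂μ = L (∫ w, D w x ∂μ) :=
    L.toContinuousLinearEquiv.toContinuousLinearMap.integral_comp_comm
      (hb.mono' hDm (Eventually.of_forall fun w => hDb w x))
  rwa [h2] at h

/-- Each order of derivative has an integrable bound independent of x, so one differentiates under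
the integral order by order. -/
theorem hasFTaylorSeriesUpTo_integral (hG : ∀ w, ContDiff ℝ ⊤ (G w))
    (hm : ∀ m x, AEStronglyMeasurable (fun w => iteratedFDeriv ℝ m (G w) x) μ)
    (hB : ∀ m w x, ‖iteratedFDeriv ℝ m (G w) x‖ ≤ B m w) (hBi : ∀ m, Integrable (B m) μ) :
    HasFTaylorSeriesUpTo (⊤ : ℕ∞) (fun x => ∫ w, G w x ∂μ)
      (fun x m => ∫ w, iteratedFDeriv ℝ m (G w) x ∂μ) := by
  have hint : ∀ m x, Integrable (fun w => iteratedFDeriv ℝ m (G w) x) μ := fun m x =>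
    (hBi m).mono' (hm m x) (Eventually.of_forall fun w => hB m w x)
  have hder : ∀ (m : ℕ) (x : E), HasFDerivAt (fun y => ∫ w, iteratedFDeriv ℝ m (G w) y ∂μ)
      (∫ w, iteratedFDeriv ℝ (m + 1) (G w) x ∂μ).curryLeft x := by
    intro m x
    refine hasFDerivAt_integral_of_linearIsometry
      (continuousMultilinearCurryLeftEquiv ℝ (fun _ : Fin (m + 1) => E) ℂ) (hm m)
      (hint m x) (hm (m + 1) x) (hB (m + 1)) (hBi (m + 1))
      (fun w y => ?_)
    have h := ((hG w).differentiable_iteratedFDeriv (m := m)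
      (by exact_mod_cast WithTop.coe_lt_top _) y).hasFDerivAt
    rw [fderiv_iteratedFDeriv] at h
    exact h
  refine ⟨fun x => ?_, fun m _ x => hder m x, fun m _ => ?_⟩
  · simp only [ContinuousMultilinearMap.curry0]
    rw [ContinuousMultilinearMap.integral_apply (hint 0 x)]
    simp
  · exact continuous_iff_continuousAt.2 fun x => (hder m x).continuousAt

theorem contDiff_integral (hG : ∀ w, ContDiff ℝ ⊤ (G w))
    (hm : ∀ m x, AEStronglyMeasurable (fun w => iteratedFDeriv ℝ m (G w) x) μ)
    (hB : ∀ m w x, ‖iteratedFDeriv ℝ m (G w) x‖ ≤ B m w) (hBi : ∀ m, Integrable (B m) μ) :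
    ContDiff ℝ (⊤ : ℕ∞) (fun x => ∫ w, G w x ∂μ) :=
  (hasFTaylorSeriesUpTo_integral hG hm hB hBi).contDiff

theorem iteratedFDeriv_integral (hG : ∀ w, ContDiff ℝ ⊤ (G w))
    (hm : ∀ m x, AEStronglyMeasurable (fun w => iteratedFDeriv ℝ m (G w) x) μ)
    (hB : ∀ m w x, ‖iteratedFDeriv ℝ m (G w) x‖ ≤ B m w) (hBi : ∀ m, Integrable (B m) μ)
    (m : ℕ) (x : E) : iteratedFDeriv ℝ m (fun x => ∫ w, G w x ∂μ) x =
      ∫ w, iteratedFDeriv ℝ m (G w) x ∂μ :=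
  ((hasFTaylorSeriesUpTo_integral hG hm hB hBi).eq_iteratedFDeriv
    (by exact_mod_cast le_top) x).symm

end ParametricIntegral

/-! ### Superpositions of exponential vectors as Schwartz functions. -/

open scoped Matrix

/-- ε_w(x) is jointly smooth in (w, x), and the derivatives in x alone are the joint ones restricted
along the second inclusion. -/
theorem continuous_iteratedFDeriv_cohFun {n : ℕ} (m : ℕ) (x : EuclideanSpace ℝ (Fin n)) :
    Continuous fun w : Fin n → ℂ => iteratedFDeriv ℝ m (cohFun w) x := by
  set F : (Fin n → ℂ) × EuclideanSpace ℝ (Fin n) → ℂ := fun p => cohFun p.1 p.2 with hF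
  have hFs : ContDiff ℝ ⊤ F := contDiff_cohFun_comp contDiff_fst contDiff_snd
  have e : ∀ w : Fin n → ℂ, iteratedFDeriv ℝ m (cohFun w) x =
      (iteratedFDeriv ℝ m F (w, x)).compContinuousLinearMap
        (fun _ => ContinuousLinearMap.inr ℝ (Fin n → ℂ) (EuclideanSpace ℝ (Fin n))) := by
    intro w
    have h1 : cohFun w = (fun p => F (p + (w, 0))) ∘
        ContinuousLinearMap.inr ℝ (Fin n → ℂ) (EuclideanSpace ℝ (Fin n)) := by
      funext y
      simp [hF]
    have h2 : ContDiff ℝ ⊤ (fun p => F (p + (w, 0))) :=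
      hFs.comp (contDiff_id.add contDiff_const)
    rw [h1, ContinuousLinearMap.iteratedFDeriv_comp_right _ h2 x le_top,
      iteratedFDeriv_comp_add_right]
    simp
  simp_rw [e]
  exact (ContinuousMultilinearMap.compContinuousLinearMapL (𝕜 := ℝ) (F := ℂ) (fun _ : Fin m =>
    ContinuousLinearMap.inr ℝ (Fin n → ℂ) (EuclideanSpace ℝ (Fin n)))).continuous.comp
    ((hFs.continuous_iteratedFDeriv (m := m) le_top).comp (continuous_id.prodMk continuous_const))

/-- Half of the quadratic term absorbs the linear one: a r - δr² ≤ a²/(2δ) - δr²/2 in each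
coordinate. -/
theorem integrable_exp_absSum_sub_sqSum (n : ℕ) (a : ℝ) {δ : ℝ} (hδ : 0 < δ) :
    Integrable fun u : Fin n → ℂ => Real.exp (a * absSum u - δ * sqSum u) := by
  have h1 := (integrable_cgaussPi (n := n) (l := fun _ => ((δ / 2 : ℝ) : ℂ))
    (fun _ => by simpa using hδ) 0 0 0 0).norm.const_mul (Real.exp (n * (a ^ 2 / (2 * δ))))
  refine h1.mono' ?_ (Eventually.of_forall fun u => ?_)
  · refine Continuous.aestronglyMeasurable ?_
    unfold absSum sqSum
    fun_prop
  · rw [Real.norm_of_nonneg (Real.exp_pos _).le, cgaussPi_zero, Complex.norm_exp, ← Real.exp_add,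
      Real.exp_le_exp]
    simp only [Pi.zero_apply, zero_mul, add_zero, Complex.re_sum, ← Complex.ofReal_neg,
      ← Complex.ofReal_mul, Complex.ofReal_re]
    have : (n : ℝ) * (a ^ 2 / (2 * δ)) = ∑ _j : Fin n, a ^ 2 / (2 * δ) := by simp
    rw [this, absSum, sqSum, Finset.mul_sum, Finset.mul_sum, ← Finset.sum_sub_distrib,
      ← Finset.sum_add_distrib]
    refine Finset.sum_le_sum fun j _ => ?_
    have h2 : a ^ 2 / (2 * δ) + -(δ / 2) * ‖u j‖ ^ 2 - (a * ‖u j‖ - δ * ‖u j‖ ^ 2) =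
        (a - δ * ‖u j‖) ^ 2 / (2 * δ) := by
      field_simp
      ring
    have h3 : 0 ≤ (a - δ * ‖u j‖) ^ 2 / (2 * δ) := by positivity
    linarith

theorem sqSum_eq_dotProduct {n : ℕ} (u : Fin n → ℂ) : (sqSum u : ℂ) = star u ⬝ᵥ u := by
  simp only [sqSum, dotProduct, Pi.star_apply, RCLike.star_def]
  push_cast
  exact Finset.sum_congr rfl fun j _ => (Complex.conj_mul' (u j)).symm

theorem sqSum_mulVec {n : ℕ} {C : Matrix (Fin n) (Fin n) ℂ} {q : ℝ}
    (hC : Cᴴ * C = ((q : ℂ) ^ 2) • (1 : Matrix (Fin n) (Fin n) ℂ)) (u : Fin n → ℂ) :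
    sqSum (C *ᵥ u) = q ^ 2 * sqSum u := by
  apply Complex.ofReal_injective
  push_cast
  rw [sqSum_eq_dotProduct, sqSum_eq_dotProduct, star_mulVec_dotProduct, Matrix.mulVec_mulVec, hC,
    Matrix.smul_mulVec, Matrix.one_mulVec, dotProduct_smul, smul_eq_mul]

theorem sqSum_nonneg {n : ℕ} (u : Fin n → ℂ) : 0 ≤ sqSum u :=
  Finset.sum_nonneg fun _ _ => by positivity

theorem absSum_mulVec_le {n : ℕ} {C : Matrix (Fin n) (Fin n) ℂ} {q : ℝ} (hq0 : 0 ≤ q)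
    (hq1 : q ≤ 1) (hC : Cᴴ * C = ((q : ℂ) ^ 2) • (1 : Matrix (Fin n) (Fin n) ℂ)) (u : Fin n → ℂ) :
    absSum (C *ᵥ u) ≤ n * absSum u := by
  have h : ∀ j, ‖(C *ᵥ u) j‖ ≤ absSum u := by
    intro j
    refine le_of_sq_le_sq ?_ (absSum_nonneg u)
    have h1 : ‖(C *ᵥ u) j‖ ^ 2 ≤ sqSum (C *ᵥ u) :=
      Finset.single_le_sum (f := fun j => ‖(C *ᵥ u) j‖ ^ 2) (fun _ _ => by positivity)
        (Finset.mem_univ j)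
    have h2 : sqSum u ≤ absSum u ^ 2 :=
      Finset.sum_sq_le_sq_sum_of_nonneg fun _ _ => norm_nonneg _
    rw [sqSum_mulVec hC] at h1
    have h3 : q ^ 2 * sqSum u ≤ 1 * sqSum u :=
      mul_le_mul_of_nonneg_right (pow_le_one₀ hq0 hq1) (sqSum_nonneg u)
    linarith
  refine (Finset.sum_le_sum fun j _ => h j).trans ?_
  simp

theorem norm_toL2_coh {n : ℕ} (w : Fin n → ℂ) : ‖toL2 (coh w)‖ = Real.exp (sqSum w / 2) := by
  have h : ‖toL2 (coh w)‖ ^ 2 = Real.exp (sqSum w / 2) ^ 2 := by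
    rw [← inner_self_eq_norm_sq (𝕜 := ℂ), inner_coh, ← sqSum_eq_dotProduct, ← Complex.ofReal_exp,
      RCLike.re_eq_complex_re, Complex.ofReal_re, ← Real.exp_nat_mul]
    congr 1
    push_cast
    ring
  exact (sq_eq_sq₀ (norm_nonneg _) (Real.exp_pos _).le).1 h

theorem norm_cohState {n : ℕ} (h : Matrix.unitaryGroup (Fin n) ℂ) (u : Fin n → ℂ) :
    ‖cohState h u‖ = (√(Real.pi ^ n))⁻¹ := by
  have hh : (h : Matrix (Fin n) (Fin n) ℂ)ᴴ * (h : Matrix (Fin n) (Fin n) ℂ) =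
      (((1 : ℝ) : ℂ) ^ 2) • (1 : Matrix (Fin n) (Fin n) ℂ) := by
    rw [Complex.ofReal_one, one_pow, one_smul]
    exact Matrix.mem_unitaryGroup_iff'.1 h.2
  rw [cohState, norm_smul, norm_toL2_coh, sqSum_mulVec hh, Real.norm_of_nonneg (by positivity),
    mul_assoc, ← Real.exp_add]
  ring_nf
  simp


theorem continuous_cohFun_mulVec {n : ℕ} (C : Matrix (Fin n) (Fin n) ℂ) :
    Continuous fun p : EuclideanSpace ℝ (Fin n) × (Fin n → ℂ) => cohFun (C *ᵥ p.2) p.1 := by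
  have h0 : ContDiff ℝ ⊤ fun p : (Fin n → ℂ) × EuclideanSpace ℝ (Fin n) => cohFun p.1 p.2 :=
    contDiff_cohFun_comp contDiff_fst contDiff_snd
  have h1 := h0.continuous
  have h2 : Continuous fun u : Fin n → ℂ => C *ᵥ u := by fun_prop
  exact Continuous.comp (g := fun p : (Fin n → ℂ) × EuclideanSpace ℝ (Fin n) => cohFun p.1 p.2)
    (f := fun p : EuclideanSpace ℝ (Fin n) × (Fin n → ℂ) => (C *ᵥ p.2, p.1)) h1
    ((h2.comp continuous_snd).prodMk continuous_fst)

/-- The Schwartz function `∑_w φ(w) ε_{C w}` (an integral over `w`) for a rapidly decreasing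
weight `φ`. -/
theorem exists_schwartz_integral_coh {n : ℕ} {C : Matrix (Fin n) (Fin n) ℂ} {q : ℝ} (hq0 : 0 ≤ q)
    (hq1 : q < 1) (hC : Cᴴ * C = ((q : ℂ) ^ 2) • (1 : Matrix (Fin n) (Fin n) ℂ))
    (k l : ℕ) : ∃ K : ℝ, 0 ≤ K ∧ ∀ (φ : (Fin n → ℂ) → ℂ) (M : ℝ), Continuous φ → 0 ≤ M →
      (∀ u, ‖φ u‖ ≤ M * Real.exp (-sqSum u / 2)) →
      (∃ b : (Fin n → ℂ) → ℝ, Integrable b ∧ ∀ u x, ‖φ u * cohFun (C *ᵥ u) x‖ ≤ b u) ∧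
      (ContDiff ℝ (⊤ : ℕ∞) fun x => ∫ u, φ u * cohFun (C *ᵥ u) x) ∧
      ∀ x, ‖x‖ ^ k * ‖iteratedFDeriv ℝ l (fun x => ∫ u, φ u * cohFun (C *ᵥ u) x) x‖ ≤ K * M := by
  have hδ : 0 < (1 - q ^ 2) / 2 := by nlinarith
  -- The decay -|u|²/2 of φ against the growth q²|u|²/2 + 4n|u|₁ of the seminorms of ε_{Cu};
  -- integrability uses q < 1.
  set W : (Fin n → ℂ) → ℝ := fun u => Real.exp (4 * n * absSum u - (1 - q ^ 2) / 2 * sqSum u)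
    with hW
  have hWi : Integrable W := integrable_exp_absSum_sub_sqSum n _ hδ
  choose A hA0 hA using fun k l => exists_bound_cohFun n k l
  -- The constant does not depend on φ, so the bound is linear in M. This later gives continuity
  -- into the Schwartz space.
  refine ⟨A k l * ∫ u, W u, mul_nonneg (hA0 k l) (integral_nonneg fun u => (Real.exp_pos _).le),
    fun φ M hφ hM hφM => ?_⟩
  have key : ∀ k l u x, ‖x‖ ^ k * ‖iteratedFDeriv ℝ l (fun x => φ u * cohFun (C *ᵥ u) x) x‖ ≤
      A k l * M * W u := by
    intro k l u x
    have e : (fun x => φ u * cohFun (C *ᵥ u) x) = φ u • cohFun (C *ᵥ u) := rfl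
    rw [e, iteratedFDeriv_const_smul_apply (((contDiff_cohFun_right _).of_le le_top).contDiffAt),
      norm_smul]
    have h1 := hA k l (C *ᵥ u) x
    rw [sqSum_mulVec hC] at h1
    have h2 : Real.exp (4 * absSum (C *ᵥ u) + q ^ 2 * sqSum u / 2) ≤
        Real.exp (4 * (n * absSum u) + q ^ 2 * sqSum u / 2) := by
      gcongr
      exact absSum_mulVec_le hq0 hq1.le hC u
    calc ‖x‖ ^ k * (‖φ u‖ * ‖iteratedFDeriv ℝ l (cohFun (C *ᵥ u)) x‖)
        = ‖φ u‖ * (‖x‖ ^ k * ‖iteratedFDeriv ℝ l (cohFun (C *ᵥ u)) x‖) := by ring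
      _ ≤ (M * Real.exp (-sqSum u / 2)) *
          (A k l * Real.exp (4 * (n * absSum u) + q ^ 2 * sqSum u / 2)) := by
        refine mul_le_mul (hφM u) (h1.trans ?_) (by positivity) (by positivity)
        exact mul_le_mul_of_nonneg_left h2 (hA0 k l)
      _ = A k l * M * W u := by
        simp only [hW]
        rw [show 4 * n * absSum u - (1 - q ^ 2) / 2 * sqSum u =
          -sqSum u / 2 + (4 * (n * absSum u) + q ^ 2 * sqSum u / 2) by ring,
          Real.exp_add (-sqSum u / 2)]
        ring
  have hG : ∀ u, ContDiff ℝ ⊤ (fun x => φ u * cohFun (C *ᵥ u) x) := fun u =>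
    contDiff_const.mul (contDiff_cohFun_right _)
  have hm : ∀ m x, AEStronglyMeasurable
      (fun u => iteratedFDeriv ℝ m (fun x => φ u * cohFun (C *ᵥ u) x) x) volume := by
    intro m x
    have e : (fun u => iteratedFDeriv ℝ m (fun x => φ u * cohFun (C *ᵥ u) x) x) =
        fun u => φ u • iteratedFDeriv ℝ m (cohFun (C *ᵥ u)) x := by
      funext u
      have e' : (fun x => φ u * cohFun (C *ᵥ u) x) = φ u • cohFun (C *ᵥ u) := rfl
      rw [e', iteratedFDeriv_const_smul_apply
        (((contDiff_cohFun_right _).of_le le_top).contDiffAt)]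
    rw [e]
    refine (hφ.smul ((continuous_iteratedFDeriv_cohFun m x).comp ?_)).aestronglyMeasurable
    fun_prop
  have hB : ∀ m u x, ‖iteratedFDeriv ℝ m (fun x => φ u * cohFun (C *ᵥ u) x) x‖ ≤
      A 0 m * M * W u := fun m u x => by
    have := key 0 m u x
    rwa [pow_zero, one_mul] at this
  have hBi : ∀ m, Integrable fun u => A 0 m * M * W u := fun m => hWi.const_mul _
  refine ⟨⟨_, hBi 0, fun u x => ?_⟩, contDiff_integral hG hm hB hBi, fun x => ?_⟩
  · have := hB 0 u x
    rwa [norm_iteratedFDeriv_zero] at this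
  rw [iteratedFDeriv_integral hG hm hB hBi]
  calc ‖x‖ ^ k * ‖∫ u, iteratedFDeriv ℝ l (fun x => φ u * cohFun (C *ᵥ u) x) x‖
      ≤ ‖x‖ ^ k * ∫ u, ‖iteratedFDeriv ℝ l (fun x => φ u * cohFun (C *ᵥ u) x) x‖ := by
        gcongr
        exact norm_integral_le_integral_norm _
    _ = ∫ u, ‖x‖ ^ k * ‖iteratedFDeriv ℝ l (fun x => φ u * cohFun (C *ᵥ u) x) x‖ :=
        (integral_const_mul _ _).symm
    _ ≤ ∫ u, A k l * M * W u :=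
        integral_mono_of_nonneg (Eventually.of_forall fun u => by positivity)
          (hWi.const_mul _) (Eventually.of_forall fun u => key k l u x)
    _ = (A k l * ∫ u, W u) * M := by
        rw [integral_const_mul]
        ring


open scoped ComplexOrder in
/-- The operator `Γ(C)` maps `L²(ℝⁿ)` continuously to the Schwartz space if `C` is a strict
scaled contraction. -/
theorem exists_schwartz_Gamma {n : ℕ} {C : Matrix (Fin n) (Fin n) ℂ} {q : ℝ} (hq0 : 0 ≤ q)
    (hq1 : q < 1) (hC : Cᴴ * C = ((q : ℂ) ^ 2) • (1 : Matrix (Fin n) (Fin n) ℂ)) :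
    ∃ Z : L2 n →L[ℂ] Sch n, ∀ f, toL2 (Z f) = Gamma C f := by
  have hC' : IsScaledUnitary C := ⟨q, hq0, hq1.le, hC⟩
  set c₀ : ℝ := (√(Real.pi ^ n))⁻¹ with hc₀
  have hc₀p : 0 ≤ c₀ := by positivity
  -- The weight obtained by applying Γ(C) to f = ∫ ⟨cohState u, f⟩ cohState u, since Γ(C) maps
  -- cohState u to c₀ e^{-|u|²/2} ε_{Cu}.
  set φ : L2 n → (Fin n → ℂ) → ℂ := fun f u =>
    ((c₀ * Real.exp (-sqSum u / 2) : ℝ) : ℂ) * ⟪cohState 1 u, f⟫_ℂ with hφ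
  have hsq : Continuous fun u : Fin n → ℂ => sqSum u := by
    unfold sqSum
    fun_prop
  have hφc : ∀ f, Continuous (φ f) := fun f => by
    refine Continuous.mul ?_ ((continuous_cohState 1).inner continuous_const)
    fun_prop
  have hφb : ∀ f u, ‖φ f u‖ ≤ (c₀ * c₀ * ‖f‖) * Real.exp (-sqSum u / 2) := fun f u => by
    rw [hφ, norm_mul, Complex.norm_real, Real.norm_of_nonneg (by positivity)]
    have h1 : ‖⟪cohState 1 u, f⟫_ℂ‖ ≤ c₀ * ‖f‖ := by
      rw [hc₀, ← norm_cohState 1 u]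
      exact norm_inner_le_norm _ _
    calc c₀ * Real.exp (-sqSum u / 2) * ‖⟪cohState 1 u, f⟫_ℂ‖
        ≤ c₀ * Real.exp (-sqSum u / 2) * (c₀ * ‖f‖) := by gcongr
      _ = _ := by ring
  choose K hK0 hK using exists_schwartz_integral_coh hq0 hq1 hC
  have hib := fun f => (hK 0 0 (φ f) _ (hφc f) (by positivity) (hφb f)).1
  have hcd := fun f => (hK 0 0 (φ f) _ (hφc f) (by positivity) (hφb f)).2.1
  have hbd := fun k l f => (hK k l (φ f) _ (hφc f) (by positivity) (hφb f)).2.2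
  set Z₀ : L2 n → Sch n := fun f =>
    { toFun := fun x => ∫ u, φ f u * cohFun (C *ᵥ u) x
      smooth' := hcd f
      decay' := fun k l => ⟨_, fun x => hbd k l f x⟩ } with hZ₀
  have hZ : ∀ f, toL2 (Z₀ f) = Gamma C f := by
    intro f
    refine ext_inner_coh fun v => ?_
    obtain ⟨b, hbi, hb⟩ := hib f
    have hint : Integrable (Function.uncurry fun (x : EuclideanSpace ℝ (Fin n)) (u : Fin n → ℂ) =>
        (starRingEnd ℂ) (coh v x) * (φ f u * cohFun (C *ᵥ u) x)) (volume.prod volume) := by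
      refine (((coh v).integrable (μ := volume)).norm.mul_prod hbi).mono' ?_
        (Eventually.of_forall fun p => ?_)
      · refine Continuous.aestronglyMeasurable ?_
        refine Continuous.mul ?_ (Continuous.mul ((hφc f).comp continuous_snd) ?_)
        · exact Complex.continuous_conj.comp ((coh v).continuous.comp continuous_fst)
        · exact continuous_cohFun_mulVec C
      · simp only [Function.uncurry]
        rw [norm_mul, RCLike.norm_conj]
        exact mul_le_mul_of_nonneg_left (hb _ _) (norm_nonneg _)
    -- Testing against ε_v and applying Fubini replaces the vector-valued integral by the scalar
    -- resolution of the identity.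
    calc ⟪toL2 (coh v), toL2 (Z₀ f)⟫_ℂ
        = ∫ x, ∫ u, (starRingEnd ℂ) (coh v x) * (φ f u * cohFun (C *ᵥ u) x) := by
          rw [inner_toL2]
          exact integral_congr_ae (Eventually.of_forall fun x => (integral_const_mul _ _).symm)
      _ = ∫ u, ∫ x, (starRingEnd ℂ) (coh v x) * (φ f u * cohFun (C *ᵥ u) x) :=
          integral_integral_swap hint
      _ = ∫ u, ⟪toL2 (coh (Cᴴ *ᵥ v)), cohState 1 u⟫_ℂ * ⟪cohState 1 u, f⟫_ℂ := by
          refine integral_congr_ae (Eventually.of_forall fun u => ?_)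
          have e1 : ∀ x, (starRingEnd ℂ) (coh v x) * (φ f u * cohFun (C *ᵥ u) x) =
              φ f u * ((starRingEnd ℂ) (coh v x) * coh (C *ᵥ u) x) := fun x => by
            rw [coh_apply (C *ᵥ u)]
            ring
          simp only [e1]
          rw [integral_const_mul, ← inner_toL2, inner_coh]
          simp only [hφ, cohState]
          rw [inner_smul_right_eq_smul, inner_coh, star_mulVec_dotProduct,
            Matrix.conjTranspose_conjTranspose, Complex.real_smul]
          simp only [OneMemClass.coe_one, Matrix.one_mulVec]
          ring
      _ = ⟪toL2 (coh v), Gamma C f⟫_ℂ := by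
          rw [integral_inner_cohState, inner_coh_Gamma hC']
  let ZL : L2 n →ₗ[ℂ] Sch n :=
    { toFun := Z₀
      map_add' := fun f g => toL2_injective (by rw [toL2_add, hZ, hZ, hZ, map_add])
      map_smul' := fun a f => toL2_injective (by rw [toL2_smul, hZ, hZ, map_smul]; rfl) }
  refine ⟨⟨ZL, ?_⟩, hZ⟩
  refine WithSeminorms.continuous_normedSpace_dom (𝕝 := ℂ) (𝕝₂ := ℂ) (L2 n)
    (schwartz_withSeminorms ℂ _ ℂ) ZL fun i => ⟨⟨K i.1 i.2 * (c₀ * c₀), ?_⟩, fun f => ?_⟩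
  · have := hK0 i.1 i.2
    positivity
  · refine (SchwartzMap.seminorm_le_bound ℂ i.1 i.2 (Z₀ f) ?_ (hbd i.1 i.2 f)).trans_eq ?_
    · have := hK0 i.1 i.2
      positivity
    · change K i.1 i.2 * (c₀ * c₀ * ‖f‖) = K i.1 i.2 * (c₀ * c₀) * ‖f‖
      ring

end

end HeatTrace

namespace HeatTrace

noncomputable section

open scoped Matrix

/-! ### Heisenberg-Weyl operators and exponential vectors -/

theorem iteratedDeriv_cexp_I_mul (k : ℕ) :
    iteratedDeriv k (fun t : ℝ => Complex.exp (Complex.I * t)) =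
      fun t : ℝ => Complex.I ^ k * Complex.exp (Complex.I * t) := by
  induction k with
  | zero => simp
  | succ k ih =>
    rw [iteratedDeriv_succ, ih]
    funext t
    have h : HasDerivAt (fun t : ℝ => Complex.I ^ k * Complex.exp (Complex.I * t))
        (Complex.I ^ k * (Complex.exp (Complex.I * t) * (Complex.I * 1))) t :=
      (((hasDerivAt_id (t : ℂ)).const_mul Complex.I).cexp.comp_ofReal).const_mul _
    rw [h.deriv]
    ring

/-- All derivatives of e^{it} have modulus one. Hence multiplication by the Weyl phase preserves
Schwartz functions. -/
theorem hasTemperateGrowth_cexp_I_mul :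
    Function.HasTemperateGrowth (fun t : ℝ => Complex.exp (Complex.I * t)) := by
  have hc : ContDiff ℝ ⊤ fun t : ℝ => (t : ℂ) := Complex.ofRealCLM.contDiff
  refine ⟨(contDiff_const.mul (hc.of_le le_top)).cexp, fun k => ⟨0, 1, fun t => ?_⟩⟩
  rw [norm_iteratedFDeriv_eq_norm_iteratedDeriv, iteratedDeriv_cexp_I_mul, norm_mul, norm_pow,
    Complex.norm_I, one_pow, mul_comm Complex.I, Complex.norm_exp_ofReal_mul_I]
  simp

/-- The phase of the Heisenberg-Weyl operator. -/
def weylPhase {n : ℕ} (z : Fin n → ℂ) (x : EuclideanSpace ℝ (Fin n)) : ℝ :=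
  ∑ j, kVec z j * x j - (∑ j, reVec z j * kVec z j) / 2

theorem hasTemperateGrowth_weylPhase {n : ℕ} (z : Fin n → ℂ) :
    Function.HasTemperateGrowth (weylPhase z) := by
  have h : ∀ j : Fin n, Function.HasTemperateGrowth
      (fun x : EuclideanSpace ℝ (Fin n) => x j) := fun j =>
    (EuclideanSpace.proj (𝕜 := ℝ) j : _ →L[ℝ] ℝ).hasTemperateGrowth
  unfold weylPhase
  refine Function.HasTemperateGrowth.sub ?_ (.const _)
  exact Function.HasTemperateGrowth.sum fun j _ => (Function.HasTemperateGrowth.const _).mul (h j)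

/-- The Heisenberg-Weyl operator on the Schwartz space. -/
def weylS {n : ℕ} (z : Fin n → ℂ) : Sch n →L[ℂ] Sch n :=
  SchwartzMap.smulLeftCLM ℂ (fun x => Complex.exp (Complex.I * weylPhase z x)) ∘L
    SchwartzMap.compSubConstCLM ℂ (reVec z)

theorem weylS_apply {n : ℕ} (z : Fin n → ℂ) (f : Sch n) (x : EuclideanSpace ℝ (Fin n)) :
    weylS z f x = Complex.exp (Complex.I * weylPhase z x) * f (x - reVec z) := by
  have h : Function.HasTemperateGrowth (fun x => Complex.exp (Complex.I * weylPhase z x)) :=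
    hasTemperateGrowth_cexp_I_mul.comp (hasTemperateGrowth_weylPhase z)
  rw [weylS, ContinuousLinearMap.comp_apply, SchwartzMap.smulLeftCLM_apply_apply h,
    SchwartzMap.compSubConstCLM_apply, smul_eq_mul]

theorem weylT_toL2 {n : ℕ} (z : Fin n → ℂ) (f : Sch n) :
    weylT z (toL2 f) = toL2 (weylS z f) := by
  refine Lp.ext ?_
  have h1 := weylT_coeFn z (toL2 f)
  have h2 : toL2 (weylS z f) =ᵐ[volume] weylS z f := SchwartzMap.coeFn_toLp _ _ _
  have h3 : toL2 f =ᵐ[volume] f := SchwartzMap.coeFn_toLp _ _ _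
  have h4 := (measurePreserving_sub_right (volume : Measure (EuclideanSpace ℝ (Fin n)))
    (reVec z)).quasiMeasurePreserving.ae_eq_comp h3
  filter_upwards [h1, h2, h4] with x hx1 hx2 hx4
  rw [hx1, hx2, weylS_apply]
  have : toL2 f (x - reVec z) = f (x - reVec z) := hx4
  rw [this, weylPhase]

/-- The point of `ℂⁿ` by which the Heisenberg-Weyl operator shifts exponential vectors. -/
def weylShift {n : ℕ} (z : Fin n → ℂ) : Fin n → ℂ := fun j => star (z j) / √2

/-- Translation and modulation change only the lower order terms of the Gaussian exponent: the
coefficient √2 w_j of x_j becomes √2 w_j + a_j + ik_j = √2(w_j + z̄_j/√2). -/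
theorem weylS_coh {n : ℕ} (z w : Fin n → ℂ) : weylS z (coh w) =
    Complex.exp (-sqSum (weylShift z) / 2 - star (weylShift z) ⬝ᵥ w) •
      coh (w + weylShift z) := by
  ext x
  rw [weylS_apply, smul_apply, coh_apply, coh_apply, cohFun, cohFun, smul_eq_mul,
    mul_left_comm, mul_left_comm _ (cohConst n : ℂ), ← Complex.exp_add, ← Complex.exp_add]
  congr 2
  simp only [weylPhase, expo, sqSum, weylShift, dotProduct, Pi.star_apply, Pi.add_apply]
  push_cast
  rw [Finset.sum_div, mul_sub, Finset.mul_sum, Finset.mul_sum, ← Finset.sum_sub_distrib,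
    ← Finset.sum_add_distrib, ← Finset.sum_neg_distrib, Finset.sum_div, ← Finset.sum_sub_distrib,
    ← Finset.sum_add_distrib]
  refine Finset.sum_congr rfl fun j _ => ?_
  have h1 : (√2 : ℂ) * √2 = 2 := sqrt_two_mul_self
  have h2 : ((√2 : ℝ) : ℂ)⁻¹ = √2 / 2 := by
    field_simp [show ((√2 : ℝ) : ℂ) ≠ 0 by simp]
    rw [sq, h1]
  have h3 : ((‖star (z j) / (√2 : ℂ)‖ : ℝ) : ℂ) ^ 2 =
      ((z j).re ^ 2 + (z j).im ^ 2) / 2 := by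
    rw [← Complex.ofReal_pow, norm_div, Complex.norm_real, Real.norm_of_nonneg (Real.sqrt_nonneg 2),
      div_pow, Real.sq_sqrt (by norm_num), norm_star, Complex.sq_norm, Complex.normSq_apply]
    push_cast
    ring
  have h4 : (starRingEnd ℂ) (z j) = (z j).re - (z j).im * Complex.I := by
    apply Complex.ext <;> simp
  rw [h3]
  simp only [PiLp.sub_apply, reVec, kVec, RCLike.star_def,
    div_eq_mul_inv _ ((√2 : ℝ) : ℂ), h2, h4]
  generalize (z j).re = a at *
  generalize (z j).im = b at *
  have h6 : (starRingEnd ℂ) (((a : ℂ) - b * Complex.I) * (((√2 : ℝ) : ℂ) / 2)) =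
      ((a : ℂ) + b * Complex.I) * (((√2 : ℝ) : ℂ) / 2) := by
    simp [Complex.conj_ofNat]
  rw [h6]
  push_cast
  generalize ((√2 : ℝ) : ℂ) = s at *
  ring_nf
  simp only [Complex.I_sq, show s ^ 2 = 2 by rw [sq]; exact h1]
  ring

/-! ### Normal ordering -/

/-- The normally ordered product of creation and annihilation operators. -/
def word {n : ℕ} (l₁ l₂ : List (Fin n)) : Sch n →L[ℂ] Sch n :=
  (l₁.map cre).prod * (l₂.map ann).prod

/-- The span of the normally ordered products of at most `d` factors. -/
def normalOps (n d : ℕ) : Submodule ℂ (Sch n →L[ℂ] Sch n) :=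
  Submodule.span ℂ {P | ∃ l₁ l₂ : List (Fin n), l₁.length + l₂.length ≤ d ∧ P = word l₁ l₂}

theorem word_mem {n d : ℕ} {l₁ l₂ : List (Fin n)} (h : l₁.length + l₂.length ≤ d) :
    word l₁ l₂ ∈ normalOps n d := Submodule.subset_span ⟨l₁, l₂, h, rfl⟩

theorem normalOps_mono {n d e : ℕ} (h : d ≤ e) : normalOps n d ≤ normalOps n e := by
  refine Submodule.span_mono ?_
  rintro P ⟨l₁, l₂, hl, rfl⟩
  exact ⟨l₁, l₂, hl.trans h, rfl⟩

theorem mul_mem_normalOps_of_word {n d e : ℕ} {A P : Sch n →L[ℂ] Sch n}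
    (h : ∀ l₁ l₂ : List (Fin n), l₁.length + l₂.length ≤ d → A * word l₁ l₂ ∈ normalOps n e)
    (hP : P ∈ normalOps n d) : A * P ∈ normalOps n e := by
  induction hP using Submodule.span_induction with
  | mem P hP =>
    obtain ⟨l₁, l₂, hl, rfl⟩ := hP
    exact h l₁ l₂ hl
  | zero => rw [mul_zero]; exact zero_mem _
  | add P Q _ _ hP hQ => rw [mul_add]; exact add_mem hP hQ
  | smul c P _ hP => rw [mul_smul_comm]; exact Submodule.smul_mem _ _ hP

theorem cre_mul_word {n : ℕ} (j : Fin n) (l₁ l₂ : List (Fin n)) :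
    cre j * word l₁ l₂ = word (j :: l₁) l₂ := by
  simp [word, mul_assoc]

theorem cre_mul_mem {n d : ℕ} (j : Fin n) {P : Sch n →L[ℂ] Sch n} (hP : P ∈ normalOps n d) :
    cre j * P ∈ normalOps n (d + 1) :=
  mul_mem_normalOps_of_word (fun l₁ l₂ hl => by
    rw [cre_mul_word]
    exact word_mem (by simp; omega)) hP

/-- The annihilator is moved past the creators one at a time; each commutator is a scalar and only
shortens the word. -/
theorem ann_mul_word_mem {n : ℕ} (j : Fin n) (l₁ l₂ : List (Fin n)) :
    ann j * word l₁ l₂ ∈ normalOps n (l₁.length + l₂.length + 1) := by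
  induction l₁ with
  | nil =>
    have h : ann j * word [] l₂ = word [] (j :: l₂) := by simp [word]
    rw [h]
    exact word_mem (by simp)
  | cons k l₁ ih =>
    rw [← cre_mul_word, ← mul_assoc, ann_mul_cre, add_mul, mul_assoc]
    refine add_mem ?_ ?_
    · refine normalOps_mono ?_ (cre_mul_mem k ih)
      simp only [List.length_cons]
      omega
    · split_ifs
      · rw [one_mul]
        exact word_mem (by simp; omega)
      · rw [zero_mul]
        exact zero_mem _

theorem ann_mul_mem {n d : ℕ} (j : Fin n) {P : Sch n →L[ℂ] Sch n} (hP : P ∈ normalOps n d) :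
    ann j * P ∈ normalOps n (d + 1) :=
  mul_mem_normalOps_of_word (fun l₁ l₂ hl =>
    normalOps_mono (by omega) (ann_mul_word_mem j l₁ l₂)) hP

theorem mulX_mul_mem {n d : ℕ} (j : Fin n) {P : Sch n →L[ℂ] Sch n} (hP : P ∈ normalOps n d) :
    mulX j * P ∈ normalOps n (d + 1) := by
  rw [mulX_eq, smul_mul_assoc, add_mul]
  exact Submodule.smul_mem _ _ (add_mem (ann_mul_mem j hP) (cre_mul_mem j hP))

theorem partialD_mul_mem {n d : ℕ} (j : Fin n) {P : Sch n →L[ℂ] Sch n}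
    (hP : P ∈ normalOps n d) : partialD j * P ∈ normalOps n (d + 1) := by
  rw [partialD_eq, smul_mul_assoc, sub_mul]
  exact Submodule.smul_mem _ _ (sub_mem (ann_mul_mem j hP) (cre_mul_mem j hP))

theorem list_prod_pow_mul_mem {n : ℕ} {A : Fin n → (Sch n →L[ℂ] Sch n)}
    (hA : ∀ (j : Fin n) (d : ℕ) (P : Sch n →L[ℂ] Sch n), P ∈ normalOps n d →
      A j * P ∈ normalOps n (d + 1)) (α : Fin n → ℕ) (l : List (Fin n)) {d : ℕ}
    {P : Sch n →L[ℂ] Sch n} (hP : P ∈ normalOps n d) :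
    (l.map fun j => A j ^ α j).prod * P ∈ normalOps n (d + (l.map α).sum) := by
  have hpow : ∀ (j : Fin n) (a d : ℕ) (P : Sch n →L[ℂ] Sch n), P ∈ normalOps n d →
      A j ^ a * P ∈ normalOps n (d + a) := by
    intro j a
    induction a with
    | zero => intro d P hP; simpa using hP
    | succ a ih =>
      intro d P hP
      rw [pow_succ', mul_assoc]
      exact hA j _ _ (ih d P hP)
  induction l with
  | nil => simpa using hP
  | cons j l ih =>
    simp only [List.map_cons, List.prod_cons, List.sum_cons, mul_assoc]
    exact normalOps_mono (by omega) (hpow j (α j) _ _ ih)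

/-- Both x_j and ∂_j are combinations of one annihilator and one creator, and restoring normal order
never raises the degree. -/
theorem diffOps_le_normalOps (n d : ℕ) : diffOps n d ≤ normalOps n d := by
  refine Submodule.span_le.2 ?_
  rintro P ⟨α, β, h, rfl⟩
  have h1 : (1 : Sch n →L[ℂ] Sch n) ∈ normalOps n 0 := by
    have : (1 : Sch n →L[ℂ] Sch n) = word [] [] := by simp [word]
    rw [this]
    exact word_mem (by simp)
  have h2 := list_prod_pow_mul_mem (fun j _ _ => mulX_mul_mem j) α (List.finRange n)
    (list_prod_pow_mul_mem (fun j _ _ => partialD_mul_mem j) β (List.finRange n) h1)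
  rw [mul_one] at h2
  refine normalOps_mono ?_ h2
  rw [← Fin.sum_univ_def, ← Fin.sum_univ_def]
  omega

/-- This is the purpose of normal ordering: the annihilators act on the right vector by eigenvalues,
and the creators become annihilators acting on the left one. -/
theorem inner_coh_word {n : ℕ} (l₁ l₂ : List (Fin n)) (w v : Fin n → ℂ) :
    ⟪toL2 (coh w), toL2 (word l₁ l₂ (coh v))⟫_ℂ =
      (l₁.map fun j => star (w j)).prod * (l₂.map v).prod * Complex.exp (star w ⬝ᵥ v) := by
  have h2 : (l₂.map ann).prod (coh v) = (l₂.map v).prod • coh v := by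
    induction l₂ with
    | nil => simp
    | cons j l ih =>
      simp only [List.map_cons, List.prod_cons, mul_apply_eq_comp, ih, map_smul, ann_coh,
        smul_smul, mul_comm]
  have h1 : ∀ f : Sch n, ⟪toL2 (coh w), toL2 ((l₁.map cre).prod f)⟫_ℂ =
      (l₁.map fun j => star (w j)).prod * ⟪toL2 (coh w), toL2 f⟫_ℂ := by
    intro f
    induction l₁ with
    | nil => simp
    | cons j l ih =>
      simp only [List.map_cons, List.prod_cons, mul_apply_eq_comp, inner_cre, ann_coh, toL2_smul,
        inner_smul_left, ih, RCLike.star_def, mul_assoc]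
  rw [word, mul_apply_eq_comp, h1, h2, toL2_smul, inner_smul_right, inner_coh, mul_assoc]

end

end HeatTrace

namespace HeatTrace

noncomputable section

open scoped Matrix ComplexOrder

/-! ### The operators `T_z R_g e^{-tH}` on exponential vectors -/

theorem isScaledUnitary_smul_one {n : ℕ} {q : ℝ} (hq0 : 0 ≤ q) (hq1 : q ≤ 1) :
    IsScaledUnitary ((q : ℂ) • (1 : Matrix (Fin n) (Fin n) ℂ)) :=
  ⟨q, hq0, hq1, by
    rw [Matrix.conjTranspose_smul, Matrix.conjTranspose_one, Matrix.smul_mul, Matrix.one_mul,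
      smul_smul, RCLike.star_def, Complex.conj_ofReal, sq]⟩

theorem conjTranspose_mul_map_star {n : ℕ} (g : Matrix.unitaryGroup (Fin n) ℂ) :
    ((g : Matrix (Fin n) (Fin n) ℂ).map star)ᴴ * (g : Matrix (Fin n) (Fin n) ℂ).map star = 1 := by
  have h : (g : Matrix (Fin n) (Fin n) ℂ)ᴴ * (g : Matrix (Fin n) (Fin n) ℂ) = 1 :=
    Matrix.mem_unitaryGroup_iff'.1 g.2
  have h2 := congrArg (fun M : Matrix (Fin n) (Fin n) ℂ => M.map (starRingEnd ℂ)) h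
  simp only [Matrix.map_mul, Matrix.map_one _ (map_zero _) (map_one _)] at h2
  exact h2

/-- The matrix `e^{-t} \bar g`. -/
def heatMatrix {n : ℕ} (g : Matrix.unitaryGroup (Fin n) ℂ) (t : ℝ) : Matrix (Fin n) (Fin n) ℂ :=
  (Real.exp (-t) : ℂ) • (g : Matrix (Fin n) (Fin n) ℂ).map star

theorem heatMatrix_conjTranspose_mul {n : ℕ} (g : Matrix.unitaryGroup (Fin n) ℂ) (t : ℝ) :
    (heatMatrix g t)ᴴ * heatMatrix g t =
      ((Real.exp (-t) : ℂ) ^ 2) • (1 : Matrix (Fin n) (Fin n) ℂ) := by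
  rw [heatMatrix, Matrix.conjTranspose_smul, Matrix.smul_mul, Matrix.mul_smul,
    conjTranspose_mul_map_star, smul_smul, RCLike.star_def, Complex.conj_ofReal, sq]

theorem isScaledUnitary_map_star {n : ℕ} (g : Matrix.unitaryGroup (Fin n) ℂ) :
    IsScaledUnitary ((g : Matrix (Fin n) (Fin n) ℂ).map star) :=
  ⟨1, zero_le_one, le_rfl, by rw [conjTranspose_mul_map_star]; simp⟩

theorem heatOp_coh (n : ℕ) {t : ℝ} (ht : 0 ≤ t) (w : Fin n → ℂ) : heatOp n t (toL2 (coh w)) =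
    (Real.exp (-t * n / 2) : ℂ) • toL2 (coh ((Real.exp (-t) : ℂ) • w)) := by
  rw [heatOp_eq n ht, smul_apply, Gamma_coh
    (isScaledUnitary_smul_one (Real.exp_pos _).le (Real.exp_le_one_iff.2 (by linarith))),
    Matrix.smul_mulVec, Matrix.one_mulVec]

theorem heatOp_add (n : ℕ) {s t : ℝ} (hs : 0 ≤ s) (ht : 0 ≤ t) :
    heatOp n (s + t) = heatOp n s ∘L heatOp n t :=
  clm_ext_coh fun w => by
    rw [ContinuousLinearMap.comp_apply, heatOp_coh n (add_nonneg hs ht), heatOp_coh n ht,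
      map_smul, heatOp_coh n hs, smul_smul, smul_smul, ← Complex.ofReal_mul, ← Complex.ofReal_mul,
      ← Real.exp_add, ← Real.exp_add]
    ring_nf

theorem adjoint_heatOp (n : ℕ) {t : ℝ} (ht : 0 ≤ t) :
    ContinuousLinearMap.adjoint (heatOp n t) = heatOp n t := by
  rw [heatOp_eq n ht, map_smulₛₗ, adjoint_Gamma
    (isScaledUnitary_smul_one (Real.exp_pos _).le (Real.exp_le_one_iff.2 (by linarith))),
    Complex.conj_ofReal, Matrix.conjTranspose_smul, Matrix.conjTranspose_one, RCLike.star_def,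
    Complex.conj_ofReal]

/-- The operator is the square of the self-adjoint e^{-tH/2}. -/
theorem heatOp_nonneg (n : ℕ) {t : ℝ} (ht : 0 ≤ t) : 0 ≤ heatOp n t := by
  have ht' : 0 ≤ t / 2 := by linarith
  have h := heatOp_add n ht' ht'
  rw [add_halves] at h
  rw [h, ContinuousLinearMap.nonneg_iff_isPositive]
  nth_rewrite 1 [← adjoint_heatOp n ht']
  exact ContinuousLinearMap.isPositive_adjoint_comp_self _

theorem twistedHeat_coh {n : ℕ} (z : Fin n → ℂ) {g : Matrix.unitaryGroup (Fin n) ℂ}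
    (hg : ∃ AB, IsLogarithm (g : Matrix (Fin n) (Fin n) ℂ) AB) {t : ℝ} (ht : 0 ≤ t)
    (w : Fin n → ℂ) : twistedHeat z g t (toL2 (coh w)) =
      toL2 (((Real.exp (-t * n / 2) : ℂ) * Complex.exp (-sqSum (weylShift z) / 2 -
        star (weylShift z) ⬝ᵥ (heatMatrix g t *ᵥ w))) •
        coh (heatMatrix g t *ᵥ w + weylShift z)) := by
  rw [twistedHeat, ContinuousLinearMap.comp_apply, ContinuousLinearMap.comp_apply,
    heatOp_coh n ht, map_smul, map_smul, metaplecticR_eq g hg,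
    Gamma_coh (isScaledUnitary_map_star g), weylT_toL2, weylS_coh, ← toL2_smul, smul_smul,
    heatMatrix, Matrix.mulVec_smul, Matrix.smul_mulVec]

/-- R_g e^{-tH} is a scalar times Γ(e^{-t}ḡ), and e^{-t}ḡ is a strict scaled contraction for t > 0.
The remaining factor T_z preserves Schwartz functions. -/
theorem exists_schwartz_twistedHeat {n : ℕ} (z : Fin n → ℂ) {g : Matrix.unitaryGroup (Fin n) ℂ}
    (hg : ∃ AB, IsLogarithm (g : Matrix (Fin n) (Fin n) ℂ) AB) {t : ℝ} (ht : 0 < t) :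
    ∃ X : L2 n →L[ℂ] Sch n, ∀ f, toL2 (X f) = twistedHeat z g t f := by
  have hC := heatMatrix_conjTranspose_mul g t
  obtain ⟨Z, hZ⟩ := exists_schwartz_Gamma (Real.exp_pos _).le
    (Real.exp_lt_one_iff.2 (by linarith)) hC
  refine ⟨(Real.exp (-t * n / 2) : ℂ) • (weylS z ∘L Z), fun f => ?_⟩
  rw [smul_apply, ContinuousLinearMap.comp_apply, toL2_smul, ← weylT_toL2, hZ, twistedHeat,
    ContinuousLinearMap.comp_apply, ContinuousLinearMap.comp_apply, heatOp_eq n ht.le,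
    metaplecticR_eq g hg, smul_apply, map_smul, map_smul, ← mul_apply_eq_comp (Gamma _), ← Gamma_mul
    (isScaledUnitary_map_star g)
    (isScaledUnitary_smul_one (Real.exp_pos _).le (Real.exp_le_one_iff.2 (by linarith))),
    Matrix.mul_smul, Matrix.mul_one, heatMatrix]

open Classical in
/-- The operator `T_z R_g e^{-tH}` as a map to the Schwartz space. -/
def twistedHeatS {n : ℕ} (z : Fin n → ℂ) (g : Matrix.unitaryGroup (Fin n) ℂ) (t : ℝ) :
    L2 n →L[ℂ] Sch n :=
  if h : ∃ X : L2 n →L[ℂ] Sch n, ∀ f, toL2 (X f) = twistedHeat z g t f then h.choose else 0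

theorem toL2_twistedHeatS {n : ℕ} (z : Fin n → ℂ) {g : Matrix.unitaryGroup (Fin n) ℂ}
    (hg : ∃ AB, IsLogarithm (g : Matrix (Fin n) (Fin n) ℂ) AB) {t : ℝ} (ht : 0 < t) (f : L2 n) :
    toL2 (twistedHeatS z g t f) = twistedHeat z g t f := by
  have h := exists_schwartz_twistedHeat z hg ht
  rw [twistedHeatS, dif_pos h]
  exact h.choose_spec f

/-- The operator `B T_z R_g e^{-tH}` on `L²(ℝⁿ)`. -/
def diffTwistedHeat {n : ℕ} (B : Sch n →L[ℂ] Sch n) (z : Fin n → ℂ)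
    (g : Matrix.unitaryGroup (Fin n) ℂ) (t : ℝ) : L2 n →L[ℂ] L2 n :=
  SchwartzMap.toLpCLM ℂ ℂ 2 (volume : Measure (EuclideanSpace ℝ (Fin n))) ∘L B ∘L
    twistedHeatS z g t

theorem diffTwistedHeat_apply {n : ℕ} (B : Sch n →L[ℂ] Sch n) (z : Fin n → ℂ)
    (g : Matrix.unitaryGroup (Fin n) ℂ) (t : ℝ) (f : L2 n) :
    diffTwistedHeat B z g t f = toL2 (B (twistedHeatS z g t f)) := rfl

theorem isDiffOpComp_diffTwistedHeat {n : ℕ} (B : Sch n →L[ℂ] Sch n) (z : Fin n → ℂ)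
    {g : Matrix.unitaryGroup (Fin n) ℂ}
    (hg : ∃ AB, IsLogarithm (g : Matrix (Fin n) (Fin n) ℂ) AB) {t : ℝ} (ht : 0 < t) :
    IsDiffOpComp B (twistedHeat z g t) (diffTwistedHeat B z g t) := fun f =>
  ⟨twistedHeatS z g t f, (toL2_twistedHeatS z hg ht f).symm, rfl⟩

theorem diffTwistedHeat_one {n : ℕ} (z : Fin n → ℂ) {g : Matrix.unitaryGroup (Fin n) ℂ}
    (hg : ∃ AB, IsLogarithm (g : Matrix (Fin n) (Fin n) ℂ) AB) {t : ℝ} (ht : 0 < t) :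
    diffTwistedHeat 1 z g t = twistedHeat z g t := by
  ext1 f
  exact toL2_twistedHeatS z hg ht f

/-- Half of the heat flow suffices to absorb B; the other half is the positive factor required for
trace class. -/
theorem diffTwistedHeat_half {n : ℕ} (B : Sch n →L[ℂ] Sch n) (z : Fin n → ℂ)
    {g : Matrix.unitaryGroup (Fin n) ℂ}
    (hg : ∃ AB, IsLogarithm (g : Matrix (Fin n) (Fin n) ℂ) AB) {t : ℝ} (ht : 0 < t) :
    diffTwistedHeat B z g t = diffTwistedHeat B z g (t / 2) * heatOp n (t / 2) := by
  ext1 f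
  rw [mul_apply_eq_comp, diffTwistedHeat_apply, diffTwistedHeat_apply]
  congr 2
  refine toL2_injective ?_
  rw [toL2_twistedHeatS z hg ht, toL2_twistedHeatS z hg (half_pos ht), twistedHeat, twistedHeat]
  have h := heatOp_add n (half_pos ht).le (half_pos ht).le
  rw [add_halves] at h
  rw [h]
  rfl

theorem norm_heatOp_cohState {n : ℕ} (h : Matrix.unitaryGroup (Fin n) ℂ) {t : ℝ} (ht : 0 ≤ t)
    (u : Fin n → ℂ) : ‖heatOp n t (cohState h u)‖ =
      (√(Real.pi ^ n))⁻¹ * Real.exp (-t * n / 2) *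
        Real.exp (-((1 - Real.exp (-t) ^ 2) / 2) * sqSum u) := by
  have hh : (h : Matrix (Fin n) (Fin n) ℂ)ᴴ * (h : Matrix (Fin n) (Fin n) ℂ) =
      (((1 : ℝ) : ℂ) ^ 2) • (1 : Matrix (Fin n) (Fin n) ℂ) := by
    rw [Complex.ofReal_one, one_pow, one_smul]
    exact Matrix.mem_unitaryGroup_iff'.1 h.2
  have hs : ∀ w : Fin n → ℂ, sqSum ((Real.exp (-t) : ℂ) • w) = Real.exp (-t) ^ 2 * sqSum w := by
    intro w
    simp only [sqSum, Pi.smul_apply, smul_eq_mul, norm_mul, mul_pow, Finset.mul_sum,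
      Complex.norm_real, Real.norm_of_nonneg (Real.exp_pos _).le]
  rw [cohState, ContinuousLinearMap.map_smul_of_tower, heatOp_coh n ht, norm_smul, norm_smul, norm_toL2_coh, hs,
    sqSum_mulVec hh, Complex.norm_real, Real.norm_of_nonneg (Real.exp_pos _).le,
    Real.norm_of_nonneg (by positivity), show -((1 - Real.exp (-t) ^ 2) / 2) * sqSum u =
      -sqSum u / 2 + Real.exp (-t) ^ 2 * (1 ^ 2 * sqSum u) / 2 by ring,
    Real.exp_add (-sqSum u / 2)]
  ring

/-- The unitary coordinates h are free here; they are later chosen to diagonalize ḡ. -/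
theorem hasTrace_diffTwistedHeat {n : ℕ} (B : Sch n →L[ℂ] Sch n) (z : Fin n → ℂ)
    {g : Matrix.unitaryGroup (Fin n) ℂ}
    (hg : ∃ AB, IsLogarithm (g : Matrix (Fin n) (Fin n) ℂ) AB) {t : ℝ} (ht : 0 < t)
    (h : Matrix.unitaryGroup (Fin n) ℂ) :
    (Integrable fun u => ⟪cohState h u, diffTwistedHeat B z g t (cohState h u)⟫_ℂ) ∧
    HasTrace (diffTwistedHeat B z g t)
      (∫ u, ⟪cohState h u, diffTwistedHeat B z g t (cohState h u)⟫_ℂ) := by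
  have hq : Real.exp (-(t / 2)) ^ 2 < 1 := by
    rw [← Real.exp_nat_mul]
    exact Real.exp_lt_one_iff.2 (by push_cast; linarith)
  have hi : Integrable fun u => ‖cohState h u‖ * ‖heatOp n (t / 2) (cohState h u)‖ := by
    simp only [norm_cohState, norm_heatOp_cohState h (half_pos ht).le, ← mul_assoc]
    have := integrable_exp_absSum_sub_sqSum n 0 (δ := (1 - Real.exp (-(t / 2)) ^ 2) / 2)
      (by linarith)
    simp only [zero_mul, zero_sub, ← neg_mul] at this
    exact this.const_mul _
  have hm : Continuous fun u => ⟪cohState h u, diffTwistedHeat B z g t (cohState h u)⟫_ℂ :=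
    (continuous_cohState h).inner ((ContinuousLinearMap.continuous _).comp (continuous_cohState h))
  constructor
  · refine (hi.const_mul ‖diffTwistedHeat B z g (t / 2)‖).mono' hm.aestronglyMeasurable
      (Eventually.of_forall fun u => ?_)
    rw [diffTwistedHeat_half B z hg ht, mul_apply_eq_comp]
    refine (norm_inner_le_norm _ _).trans ?_
    calc _ ≤ ‖cohState h u‖ * (‖diffTwistedHeat B z g (t / 2)‖ *
          ‖heatOp n (t / 2) (cohState h u)‖) :=
        mul_le_mul_of_nonneg_left (ContinuousLinearMap.le_opNorm _ _) (norm_nonneg _)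
      _ = _ := by ring
  · rw [diffTwistedHeat_half B z hg ht]
    exact hasTrace_of_factor h _ _ (heatOp_nonneg n (half_pos ht).le) hi

end

end HeatTrace

namespace HeatTrace

noncomputable section

/-! ### Gaussian integrals of products of affine forms -/

/-- `F` is an affine form in the real coordinates of `ℂⁿ`, with coefficients bounded by `K`. -/
def IsAffineForm {n : ℕ} (K : ℝ) (F : (Fin n → ℂ) → ℂ) : Prop :=
  ∃ (a : ℂ) (c d : Fin n → ℂ), ‖a‖ ≤ K ∧ (∀ j, ‖c j‖ ≤ K) ∧ (∀ j, ‖d j‖ ≤ K) ∧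
    ∀ u, F u = a + ∑ j, (c j * (u j).re + d j * (u j).im)

theorem cgaussPi_add_single_left {n : ℕ} (l b c : Fin n → ℂ) (p q : Fin n → ℕ) (j : Fin n)
    (u : Fin n → ℂ) :
    cgaussPi l b c (p + Pi.single j 1) q u = (u j).re * cgaussPi l b c p q u := by
  rw [cgaussPi_eq, cgaussPi_eq l b c p]
  simp only [Pi.add_apply, pow_add, Finset.prod_mul_distrib]
  rw [Finset.prod_eq_single j (f := fun k => ((u k).re : ℂ) ^ (Pi.single j 1 : Fin n → ℕ) k)]
  · simp only [Pi.single_eq_same, pow_one]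
    ring
  · intro k _ hk
    simp [Pi.single_eq_of_ne hk]
  · simp

theorem cgaussPi_add_single_right {n : ℕ} (l b c : Fin n → ℂ) (p q : Fin n → ℕ) (j : Fin n)
    (u : Fin n → ℂ) :
    cgaussPi l b c p (q + Pi.single j 1) u = (u j).im * cgaussPi l b c p q u := by
  rw [cgaussPi_eq, cgaussPi_eq l b c p q]
  simp only [Pi.add_apply, pow_add, Finset.prod_mul_distrib]
  rw [Finset.prod_eq_single j (f := fun k => ((u k).im : ℂ) ^ (Pi.single j 1 : Fin n → ℕ) k)]
  · simp only [Pi.single_eq_same, pow_one]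
    ring
  · intro k _ hk
    simp [Pi.single_eq_of_ne hk]
  · simp

theorem sum_add_single {n : ℕ} (p : Fin n → ℕ) (j : Fin n) :
    ∑ k, (p + Pi.single j 1 : Fin n → ℕ) k = ∑ k, p k + 1 := by
  simp [Finset.sum_add_distrib]

/-- Expanding one affine form replaces the integral by 2n + 1 integrals with coefficients at most K,
each of degree higher by at most one. The condition ρ ≥ 1 puts the constant term under the same
bound. -/
theorem norm_integral_affineForms_le {n D : ℕ} {l b c : Fin n → ℂ} (hl : ∀ j, 0 < (l j).re)
    {A K ρ : ℝ} (hA : 0 ≤ A) (hK : 0 ≤ K) (hρ : 1 ≤ ρ)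
    (hM : ∀ p q : Fin n → ℕ, ∑ j, p j + ∑ j, q j ≤ D →
      ‖∫ u, cgaussPi l b c p q u‖ ≤ A * ρ ^ (∑ j, p j + ∑ j, q j))
    (Fs : List ((Fin n → ℂ) → ℂ)) (hFs : ∀ F ∈ Fs, IsAffineForm K F) (p q : Fin n → ℕ) :
    Integrable (fun u => (Fs.map fun F => F u).prod * cgaussPi l b c p q u) ∧
    (Fs.length + (∑ j, p j + ∑ j, q j) ≤ D →
      ‖∫ u, (Fs.map fun F => F u).prod * cgaussPi l b c p q u‖ ≤
        (K * (2 * n + 1)) ^ Fs.length * A * ρ ^ (Fs.length + (∑ j, p j + ∑ j, q j))) := by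
  induction Fs generalizing p q with
  | nil =>
    simp only [List.map_nil, List.prod_nil, one_mul, List.length_nil, zero_add, pow_zero]
    exact ⟨integrable_cgaussPi hl b c p q, hM p q⟩
  | cons F Fs ih =>
    have ih := ih fun G hG => hFs G (List.mem_cons_of_mem _ hG)
    obtain ⟨a, cc, d, ha, hc, hd, hF⟩ := hFs F List.mem_cons_self
    set G : (Fin n → ℕ) → (Fin n → ℕ) → (Fin n → ℂ) → ℂ := fun p q u =>
      (Fs.map fun F => F u).prod * cgaussPi l b c p q u with hG
    have hGi : ∀ p q, Integrable (G p q) := fun p q => (ih p q).1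
    have e : (fun u => ((F :: Fs).map fun F => F u).prod * cgaussPi l b c p q u) =
        fun u => a * G p q u + ∑ j, (cc j * G (p + Pi.single j 1) q u +
          d j * G p (q + Pi.single j 1) u) := by
      funext u
      simp only [List.map_cons, List.prod_cons, hF, hG, cgaussPi_add_single_left,
        cgaussPi_add_single_right]
      rw [mul_assoc, add_mul, Finset.sum_mul]
      congr 1
      exact Finset.sum_congr rfl fun j _ => by ring
    have hi : ∀ j, Integrable (fun u => cc j * G (p + Pi.single j 1) q u +
        d j * G p (q + Pi.single j 1) u) := fun j =>
      ((hGi _ _).const_mul _).add ((hGi _ _).const_mul _)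
    have hs := integrable_finsetSum Finset.univ fun j _ => hi j
    rw [e]
    refine ⟨((hGi p q).const_mul a).add hs, fun hD => ?_⟩
    rw [integral_add ((hGi p q).const_mul a) hs, integral_finsetSum _ fun j _ => hi j,
      integral_const_mul]
    simp only [List.length_cons] at hD ⊢
    set N := Fs.length
    set s := ∑ j, p j + ∑ j, q j with hsdef
    set Bd : ℝ := (K * (2 * n + 1)) ^ N * A * ρ ^ (N + 1 + s) with hBd
    have h0 : ‖∫ u, G p q u‖ ≤ Bd := by
      refine ((ih p q).2 (by omega)).trans ?_
      rw [hBd]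
      gcongr
      omega
    have h1 : ∀ j, ‖∫ u, G (p + Pi.single j 1) q u‖ ≤ Bd := fun j => by
      have := (ih (p + Pi.single j 1) q).2 (by rw [sum_add_single]; omega)
      rwa [sum_add_single, show Fs.length + (∑ k, p k + 1 + ∑ k, q k) = N + 1 + s by omega] at this
    have h2 : ∀ j, ‖∫ u, G p (q + Pi.single j 1) u‖ ≤ Bd := fun j => by
      have := (ih p (q + Pi.single j 1)).2 (by rw [sum_add_single]; omega)
      rwa [sum_add_single, show Fs.length + (∑ k, p k + (∑ k, q k + 1)) = N + 1 + s by omega]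
        at this
    have h3 : ∀ j, ‖∫ u, (cc j * G (p + Pi.single j 1) q u +
        d j * G p (q + Pi.single j 1) u)‖ ≤ K * Bd + K * Bd := fun j => by
      rw [integral_add ((hGi _ _).const_mul _) ((hGi _ _).const_mul _), integral_const_mul,
        integral_const_mul]
      refine (norm_add_le _ _).trans ?_
      rw [norm_mul, norm_mul]
      exact add_le_add (mul_le_mul (hc j) (h1 j) (norm_nonneg _) hK)
        (mul_le_mul (hd j) (h2 j) (norm_nonneg _) hK)
    calc _ ≤ ‖a * ∫ u, G p q u‖ + ∑ j : Fin n, (K * Bd + K * Bd) :=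
          (norm_add_le _ _).trans (add_le_add le_rfl
            ((norm_sum_le _ _).trans (Finset.sum_le_sum fun j _ => h3 j)))
      _ ≤ K * Bd + ∑ j : Fin n, (K * Bd + K * Bd) := by
          rw [norm_mul]
          gcongr
      _ = (K * (2 * n + 1)) ^ (N + 1) * A * ρ ^ (N + 1 + s) := by
          rw [Finset.sum_const, Finset.card_univ, Fintype.card_fin, nsmul_eq_mul, hBd]
          ring

/-- The integral is a product over real and imaginary coordinates, each controlled by the
one-dimensional moment estimate. The sum of the constants up to order D serves all exponents at
once. -/
theorem exists_norm_integral_cgaussPi_le (n D : ℕ) : ∃ C : ℝ, 0 ≤ C ∧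
    ∀ (l b c : Fin n → ℂ) (ρ : ℝ), (∀ j, 0 < (l j).re) → 0 ≤ ρ →
      (∀ j, ‖b j‖ + ‖c j‖ ≤ ρ * ‖l j‖) → (∀ j, 1 ≤ ρ ^ 2 * ‖l j‖) →
      ∀ p q : Fin n → ℕ, ∑ j, p j + ∑ j, q j ≤ D →
        ‖∫ u, cgaussPi l b c p q u‖ ≤
          C * ‖∫ u, cgaussPi l b c 0 0 u‖ * ρ ^ (∑ j, p j + ∑ j, q j) := by
  choose C hC0 hC using exists_norm_gmom_le
  set M : ℝ := ∑ k ∈ Finset.range (D + 1), C k with hM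
  have hM0 : 0 ≤ M := Finset.sum_nonneg fun k _ => hC0 k
  have hCM : ∀ k ≤ D, C k ≤ M := fun k hk =>
    Finset.single_le_sum (f := C) (fun k _ => hC0 k) (Finset.mem_range.2 (by omega))
  refine ⟨∏ _j : Fin n, (M * M), Finset.prod_nonneg fun _ _ => by positivity,
    fun l b c ρ hl hρ hbc hρl p q hpq => ?_⟩
  have key : ∀ (k : ℕ) (j : Fin n) (β : ℂ), k ≤ D → ‖β‖ ≤ ‖b j‖ + ‖c j‖ →
      ‖gmom (l j) β k‖ ≤ M * ρ ^ k * ‖gmom (l j) β 0‖ := fun k j β hk hβ =>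
    (hC k (l j) β ρ (hl j) hρ (hβ.trans (hbc j)) (hρl j)).trans (by
      gcongr
      exact hCM k hk)
  rw [integral_cgaussPi, integral_cgaussPi, norm_prod, norm_prod, ← Finset.prod_mul_distrib,
    ← Finset.sum_add_distrib, ← Finset.prod_pow_eq_pow_sum, ← Finset.prod_mul_distrib]
  refine Finset.prod_le_prod (fun _ _ => norm_nonneg _) fun j _ => ?_
  simp only [integral_cgauss, norm_mul, Pi.zero_apply]
  have hp : p j ≤ D := (Finset.single_le_sum (f := p) (fun _ _ => Nat.zero_le _)
    (Finset.mem_univ j)).trans (by omega)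
  have hq : q j ≤ D := (Finset.single_le_sum (f := q) (fun _ _ => Nat.zero_le _)
    (Finset.mem_univ j)).trans (by omega)
  have h1 := key (p j) j (b j + c j) hp (norm_add_le _ _)
  have h2 := key (q j) j (Complex.I * (b j - c j)) hq (by
    rw [norm_mul, Complex.norm_I, one_mul]
    exact norm_sub_le _ _)
  calc _ ≤ (M * ρ ^ p j * ‖gmom (l j) (b j + c j) 0‖) *
        (M * ρ ^ q j * ‖gmom (l j) (Complex.I * (b j - c j)) 0‖) :=
      mul_le_mul h1 h2 (norm_nonneg _) (by positivity)
    _ = _ := by rw [pow_add]; ring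

theorem exists_norm_integral_affineForms_le (n D : ℕ) {K : ℝ} (hK : 0 ≤ K) : ∃ C : ℝ, 0 ≤ C ∧
    ∀ (l b c : Fin n → ℂ) (ρ : ℝ), (∀ j, 0 < (l j).re) → 1 ≤ ρ →
      (∀ j, ‖b j‖ + ‖c j‖ ≤ ρ * ‖l j‖) → (∀ j, 1 ≤ ρ ^ 2 * ‖l j‖) →
      ∀ Fs : List ((Fin n → ℂ) → ℂ), Fs.length ≤ D → (∀ F ∈ Fs, IsAffineForm K F) →
        ‖∫ u, (Fs.map fun F => F u).prod * cgaussPi l b c 0 0 u‖ ≤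
          C * ρ ^ D * ‖∫ u, cgaussPi l b c 0 0 u‖ := by
  obtain ⟨C, hC0, hC⟩ := exists_norm_integral_cgaussPi_le n D
  refine ⟨(1 + K * (2 * n + 1)) ^ D * C, by positivity, fun l b c ρ hl hρ hbc hρl Fs hD hFs => ?_⟩
  have h := (norm_integral_affineForms_le hl (b := b) (c := c) (by positivity) hK hρ
    (hC l b c ρ hl (zero_le_one.trans hρ) hbc hρl) Fs hFs 0 0).2 (by simpa using hD)
  simp only [Pi.zero_apply, Finset.sum_const_zero, add_zero] at h
  refine h.trans ?_
  have h1 : (K * (2 * n + 1)) ^ Fs.length ≤ (1 + K * (2 * n + 1)) ^ D :=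
    (pow_le_pow_left₀ (by positivity) (by linarith) _).trans
      (pow_le_pow_right₀ (le_add_of_nonneg_right (by positivity)) hD)
  have h2 : ρ ^ Fs.length ≤ ρ ^ D := pow_le_pow_right₀ hρ hD
  calc _ ≤ (1 + K * (2 * n + 1)) ^ D * (C * ‖∫ u, cgaussPi l b c 0 0 u‖) * ρ ^ D := by gcongr
    _ = _ := by ring

end

end HeatTrace

namespace HeatTrace

noncomputable section

open scoped Matrix

/-! ### The trace as a Gaussian integral -/

/-- The entrywise complex conjugate of a unitary matrix. -/
def conjUnitary {n : ℕ} (h : Matrix.unitaryGroup (Fin n) ℂ) : Matrix.unitaryGroup (Fin n) ℂ :=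
  ⟨(h : Matrix (Fin n) (Fin n) ℂ).map star,
    Matrix.mem_unitaryGroup_iff'.2 (conjTranspose_mul_map_star h)⟩

theorem coe_inv_unitary {n : ℕ} (h : Matrix.unitaryGroup (Fin n) ℂ) :
    ((h⁻¹ : Matrix.unitaryGroup (Fin n) ℂ) : Matrix (Fin n) (Fin n) ℂ) =
      (h : Matrix (Fin n) (Fin n) ℂ)ᴴ := rfl

theorem unitary_mul_conjTranspose {n : ℕ} (h : Matrix.unitaryGroup (Fin n) ℂ) :
    (h : Matrix (Fin n) (Fin n) ℂ) * (h : Matrix (Fin n) (Fin n) ℂ)ᴴ = 1 :=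
  Matrix.mem_unitaryGroup_iff.1 h.2

theorem conjTranspose_mul_unitary {n : ℕ} (h : Matrix.unitaryGroup (Fin n) ℂ) :
    (h : Matrix (Fin n) (Fin n) ℂ)ᴴ * (h : Matrix (Fin n) (Fin n) ℂ) = 1 :=
  Matrix.mem_unitaryGroup_iff'.1 h.2

theorem herm_eigvec {n : ℕ} (h : Matrix.unitaryGroup (Fin n) ℂ) (z : Fin n → ℂ) (j : Fin n) :
    herm z (eigvec h j) =
      ((h⁻¹ : Matrix.unitaryGroup (Fin n) ℂ) : Matrix (Fin n) (Fin n) ℂ).mulVec z j := by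
  rw [coe_inv_unitary]
  simp only [herm, eigvec, Matrix.mulVec, dotProduct, Matrix.conjTranspose_apply, mul_comm]

/-- The shift of the Heisenberg-Weyl operator in the coordinates given by `h`. -/
def coordShift {n : ℕ} (h : Matrix.unitaryGroup (Fin n) ℂ) (z : Fin n → ℂ) : Fin n → ℂ :=
  fun j => star (herm z (eigvec h j)) / √2

/-- Since R_g = Γ(ḡ), the adapted basis is h̄, and the shift z̄/√2 has there the conjugated
components of z. -/
theorem conjUnitary_mulVec_coordShift {n : ℕ} (h : Matrix.unitaryGroup (Fin n) ℂ)
    (z : Fin n → ℂ) :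
    (conjUnitary h : Matrix (Fin n) (Fin n) ℂ) *ᵥ coordShift h z = weylShift z := by
  have h1 : (h : Matrix (Fin n) (Fin n) ℂ) *ᵥ (fun j => herm z (eigvec h j)) = z := by
    have : (fun j => herm z (eigvec h j)) = (h : Matrix (Fin n) (Fin n) ℂ)ᴴ *ᵥ z :=
      funext fun j => herm_eigvec h z j
    rw [this, Matrix.mulVec_mulVec, unitary_mul_conjTranspose, Matrix.one_mulVec]
  funext i
  have h2 := congrArg star (congrFun h1 i)
  simp only [weylShift, coordShift, conjUnitary, Matrix.mulVec, dotProduct, Matrix.map_apply,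
    star_sum, star_mul'] at h2 ⊢
  rw [← h2, Finset.sum_div]
  exact Finset.sum_congr rfl fun j _ => (mul_div_assoc _ _ _).symm

/-- The eigenvalues of `e^{-t} \bar g`. -/
def heatEigval {n : ℕ} (φ : Fin n → ℝ) (t : ℝ) (j : Fin n) : ℂ :=
  Complex.exp (-t - Complex.I * φ j)

theorem norm_heatEigval {n : ℕ} (φ : Fin n → ℝ) (t : ℝ) (j : Fin n) :
    ‖heatEigval φ t j‖ = Real.exp (-t) := by
  rw [heatEigval, Complex.norm_exp]
  simp

theorem heatMatrix_mulVec {n : ℕ} {g h : Matrix.unitaryGroup (Fin n) ℂ} {φ : Fin n → ℝ}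
    (hd : IsDiagonalization g h φ) (t : ℝ) (u : Fin n → ℂ) :
    heatMatrix g t *ᵥ ((conjUnitary h : Matrix (Fin n) (Fin n) ℂ) *ᵥ u) =
      (conjUnitary h : Matrix (Fin n) (Fin n) ℂ) *ᵥ (fun j => heatEigval φ t j * u j) := by
  have h1 : (g : Matrix (Fin n) (Fin n) ℂ) * (h : Matrix (Fin n) (Fin n) ℂ) =
      (h : Matrix (Fin n) (Fin n) ℂ) *
        Matrix.diagonal (fun j => Complex.exp (Complex.I * φ j)) := by
    rw [hd.eq, coe_inv_unitary, Matrix.mul_assoc, conjTranspose_mul_unitary, Matrix.mul_one]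
  have h2 := congrArg (fun M : Matrix (Fin n) (Fin n) ℂ => M.map (starRingEnd ℂ)) h1
  simp only [Matrix.map_mul, Matrix.diagonal_map (map_zero (starRingEnd ℂ))] at h2
  have h3 : (g : Matrix (Fin n) (Fin n) ℂ).map star * (conjUnitary h : Matrix (Fin n) (Fin n) ℂ) =
      (conjUnitary h : Matrix (Fin n) (Fin n) ℂ) *
        Matrix.diagonal (fun j => Complex.exp (-(Complex.I * φ j))) := by
    refine h2.trans ?_
    congr 2
    funext j
    simp only [← Complex.exp_conj]
    simp
  rw [heatMatrix, Matrix.smul_mulVec, Matrix.mulVec_mulVec, h3, ← Matrix.mulVec_mulVec,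
    ← Matrix.mulVec_smul]
  congr 1
  funext j
  rw [Pi.smul_apply, Matrix.mulVec_diagonal, smul_eq_mul, ← mul_assoc, heatEigval,
    Complex.ofReal_exp, ← Complex.exp_add]
  congr 2
  push_cast
  ring

/-- The scalar factor of the Gaussian integral. -/
def gaussFactor {n : ℕ} (h : Matrix.unitaryGroup (Fin n) ℂ) (z : Fin n → ℂ) (t : ℝ) : ℂ :=
  ((Real.pi : ℂ) ^ n)⁻¹ * ((Real.exp (-t * n / 2) : ℂ) *
    Complex.exp (-sqSum (coordShift h z) / 2))

/-- In the basis h̄ the operator sends u to qu + η. The exponent is -|u|² + ū·(qu + η) - η̄·(qu) -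
|η|²/2, and the normally ordered word contributes only affine prefactors. -/
theorem inner_cohState_diffTwistedHeat {n : ℕ} {g h : Matrix.unitaryGroup (Fin n) ℂ}
    {φ : Fin n → ℝ} (hd : IsDiagonalization g h φ) (z : Fin n → ℂ)
    (hg : ∃ AB, IsLogarithm (g : Matrix (Fin n) (Fin n) ℂ) AB) {t : ℝ} (ht : 0 < t)
    (l₁ l₂ : List (Fin n)) (u : Fin n → ℂ) :
    ⟪cohState (conjUnitary h) u,
      diffTwistedHeat (word l₁ l₂) z g t (cohState (conjUnitary h) u)⟫_ℂ =
    gaussFactor h z t *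
      (((l₁.map fun i => star (((conjUnitary h : Matrix (Fin n) (Fin n) ℂ) *ᵥ u) i)).prod *
        (l₂.map ((conjUnitary h : Matrix (Fin n) (Fin n) ℂ) *ᵥ
          (fun j => heatEigval φ t j * u j + coordShift h z j))).prod) *
        cgaussPi (fun j => 1 - heatEigval φ t j)
          (fun j => -(star (coordShift h z j) * heatEigval φ t j)) (coordShift h z) 0 0 u) := by
  set H : Matrix (Fin n) (Fin n) ℂ := (conjUnitary h : Matrix (Fin n) (Fin n) ℂ) with hH
  set η := coordShift h z with hη
  set q := heatEigval φ t with hq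
  have hsum : H *ᵥ (fun j => q j * u j) + H *ᵥ η = H *ᵥ (fun j => q j * u j + η j) := by
    rw [← Matrix.mulVec_add]
    rfl
  have hdot : ∀ v w : Fin n → ℂ, star (H *ᵥ v) ⬝ᵥ (H *ᵥ w) = star v ⬝ᵥ w := fun v w => by
    rw [star_mulVec_dotProduct, Matrix.mulVec_mulVec, hH, conjTranspose_mul_unitary,
      Matrix.one_mulVec]
  have hX : diffTwistedHeat (word l₁ l₂) z g t (toL2 (coh (H *ᵥ u))) =
      ((Real.exp (-t * n / 2) : ℂ) * Complex.exp (-sqSum η / 2 -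
        star η ⬝ᵥ (fun j => q j * u j))) •
        toL2 (word l₁ l₂ (coh (H *ᵥ (fun j => q j * u j + η j)))) := by
    have h1 : twistedHeatS z g t (toL2 (coh (H *ᵥ u))) = _ := toL2_injective
      ((toL2_twistedHeatS z hg ht _).trans (twistedHeat_coh z hg ht.le (H *ᵥ u)))
    have h2 : (sqSum (weylShift z) : ℂ) = sqSum η := by
      rw [sqSum_eq_dotProduct, sqSum_eq_dotProduct, ← conjUnitary_mulVec_coordShift h z, hdot]
    rw [diffTwistedHeat_apply, h1, map_smul, toL2_smul, h2, hH, heatMatrix_mulVec hd, ← hH,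
      ← conjUnitary_mulVec_coordShift h z, ← hH, ← hη, ← hq, hdot, hsum]
  rw [cohState, ContinuousLinearMap.map_smul_of_tower, inner_smul_left_eq_smul,
    inner_smul_right_eq_smul, hX, inner_smul_right, inner_coh_word, hdot, cgaussPi_zero,
    Complex.real_smul, Complex.real_smul]
  have h1 : ((√(Real.pi ^ n))⁻¹ * Real.exp (-sqSum u / 2) : ℝ) *
      ((√(Real.pi ^ n))⁻¹ * Real.exp (-sqSum u / 2) : ℝ) =
        (Real.pi ^ n)⁻¹ * Real.exp (-sqSum u) := by
    rw [mul_mul_mul_comm, ← mul_inv, Real.mul_self_sqrt (by positivity), ← Real.exp_add]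
    ring_nf
  have h2 : (((√(Real.pi ^ n))⁻¹ * Real.exp (-sqSum u / 2) : ℝ) : ℂ) *
      ((√(Real.pi ^ n))⁻¹ * Real.exp (-sqSum u / 2) : ℝ) =
        ((Real.pi : ℂ) ^ n)⁻¹ * Complex.exp (-(sqSum u : ℂ)) := by
    rw [← Complex.ofReal_mul, h1]
    push_cast
    ring
  have h3 : Complex.exp (-(sqSum u : ℂ)) * (Complex.exp (-sqSum η / 2 -
      star η ⬝ᵥ (fun j => q j * u j)) * Complex.exp (star u ⬝ᵥ (fun j => q j * u j + η j))) =
      Complex.exp (-sqSum η / 2) * Complex.exp (∑ j, (-(1 - q j) * ((‖u j‖ ^ 2 : ℝ) : ℂ) +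
        -(star (η j) * q j) * u j + η j * star (u j))) := by
    rw [← Complex.exp_add, ← Complex.exp_add, ← Complex.exp_add]
    congr 1
    have h4 : ∀ j, ((‖u j‖ ^ 2 : ℝ) : ℂ) = star (u j) * u j := fun j => by
      push_cast
      exact (Complex.conj_mul' (u j)).symm
    rw [sqSum_eq_dotProduct u]
    simp only [dotProduct, Pi.star_apply, h4, Finset.sum_add_distrib, mul_add, neg_mul,
      Finset.sum_neg_distrib, sub_mul, one_mul, Finset.sum_sub_distrib]
    have e1 : ∑ j, star (u j) * (q j * u j) = ∑ j, q j * (star (u j) * u j) :=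
      Finset.sum_congr rfl fun j _ => by ring
    have e2 : ∑ j, star (η j) * (q j * u j) = ∑ j, star (η j) * q j * u j :=
      Finset.sum_congr rfl fun j _ => by ring
    have e3 : ∑ j, star (u j) * η j = ∑ j, η j * star (u j) :=
      Finset.sum_congr rfl fun j _ => by ring
    rw [e1, e2, e3]
    ring
  rw [gaussFactor]
  linear_combination (exp := 1) ((l₁.map fun i => star ((H *ᵥ u) i)).prod *
      (l₂.map (H *ᵥ fun j => q j * u j + η j)).prod * (Real.exp (-t * n / 2) : ℂ)) *
      (((Real.pi : ℂ) ^ n)⁻¹ * h3) +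
    ((l₁.map fun i => star ((H *ᵥ u) i)).prod *
      (l₂.map (H *ᵥ fun j => q j * u j + η j)).prod * (Real.exp (-t * n / 2) : ℂ) *
      (Complex.exp (-sqSum η / 2 - star η ⬝ᵥ (fun j => q j * u j)) *
        Complex.exp (star u ⬝ᵥ (fun j => q j * u j + η j)))) * h2

end

end HeatTrace

namespace HeatTrace

noncomputable section

/-! ### The factors of the trace -/

/-- The contribution of an eigenvalue `e^{iφ}` of `g` to the trace; `a` is the squared modulus of
the component of `z`. -/
def traceFactor (φ a t : ℝ) : ℂ :=
  Complex.exp (-t / 2) * (1 - Complex.exp (-t - Complex.I * φ))⁻¹ *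
    Complex.exp (-(a / 4) * ((1 + Complex.exp (-t - Complex.I * φ)) /
      (1 - Complex.exp (-t - Complex.I * φ))))

theorem one_sub_exp_neg_ne_zero {φ : ℝ} (hφ : φ ∈ Set.Ioo 0 (2 * Real.pi)) :
    1 - Complex.exp (-Complex.I * φ) ≠ 0 := by
  intro h
  obtain ⟨k, hk⟩ := Complex.exp_eq_one_iff.1 (sub_eq_zero.1 h).symm
  have h1 : φ = -k * (2 * Real.pi) := by
    have h2 := congrArg Complex.im hk
    have h3 : -φ = k * (2 * Real.pi) := by simpa using h2
    linarith
  have hpi := Real.pi_pos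
  obtain ⟨h2, h3⟩ := hφ
  have h4 : 0 < (-k : ℤ) := by
    by_contra hc
    have : ((-k : ℤ) : ℝ) ≤ 0 := by exact_mod_cast not_lt.1 hc
    push_cast at this
    nlinarith
  have h5 : (-k : ℤ) < 1 := by
    by_contra hc
    have : (1 : ℝ) ≤ ((-k : ℤ) : ℝ) := by exact_mod_cast not_lt.1 hc
    push_cast at this
    nlinarith
  omega

theorem tendsto_exp_neg_sub (φ : ℝ) :
    Tendsto (fun t : ℝ => Complex.exp (-t - Complex.I * φ)) (𝓝[>] 0)
      (𝓝 (Complex.exp (-Complex.I * φ))) := by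
  have h : Continuous fun t : ℝ => Complex.exp (-(t : ℂ) - Complex.I * φ) := by fun_prop
  have := (h.tendsto 0).mono_left (nhdsWithin_le_nhds (s := Set.Ioi 0))
  simpa using this

/-- Multiplying numerator and denominator by e^{iφ/2} gives 2cos(φ/2) over 2i sin(φ/2). -/
theorem one_add_div_one_sub_exp {φ : ℝ} (hφ : φ ∈ Set.Ioo 0 (2 * Real.pi)) :
    (1 + Complex.exp (-Complex.I * φ)) / (1 - Complex.exp (-Complex.I * φ)) =
      -Complex.I * (Real.cot (φ / 2) : ℂ) := by
  have hs : Real.sin (φ / 2) ≠ 0 :=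
    (Real.sin_pos_of_pos_of_lt_pi (by linarith [hφ.1]) (by linarith [hφ.2])).ne'
  have hs' : Complex.sin ((φ : ℂ) / 2) ≠ 0 := by
    rw [show (φ : ℂ) / 2 = ((φ / 2 : ℝ) : ℂ) by push_cast; rfl, ← Complex.ofReal_sin]
    exact_mod_cast hs
  rw [div_eq_iff (one_sub_exp_neg_ne_zero hφ), Real.cot_eq_cos_div_sin]
  push_cast
  rw [mul_div_assoc', div_mul_eq_mul_div, eq_div_iff hs']
  have e1 : Complex.exp (-Complex.I * φ) =
      Complex.exp (-((φ : ℂ) / 2) * Complex.I) * Complex.exp (-((φ : ℂ) / 2) * Complex.I) := by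
    rw [← Complex.exp_add]
    ring_nf
  have e2 : Complex.exp (((φ : ℂ) / 2) * Complex.I) *
      Complex.exp (-((φ : ℂ) / 2) * Complex.I) = 1 := by
    rw [← Complex.exp_add]
    simp
  rw [e1, Complex.sin, Complex.cos]
  set x := Complex.exp (((φ : ℂ) / 2) * Complex.I)
  set y := Complex.exp (-((φ : ℂ) / 2) * Complex.I)
  linear_combination (-(y * Complex.I)) * e2

theorem tendsto_traceFactor {φ : ℝ} (hφ : φ ∈ Set.Ioo 0 (2 * Real.pi)) (a : ℝ) :
    Tendsto (traceFactor φ a) (𝓝[>] 0)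
      (𝓝 (Complex.exp (Complex.I / 4 * ((a * Real.cot (φ / 2) : ℝ) : ℂ)) /
        (1 - Complex.exp (-Complex.I * φ)))) := by
  have hq := tendsto_exp_neg_sub φ
  have h0 := one_sub_exp_neg_ne_zero hφ
  have h1 : Tendsto (fun t : ℝ => Complex.exp (-(t : ℂ) / 2)) (𝓝[>] 0) (𝓝 1) := by
    have h : Continuous fun t : ℝ => Complex.exp (-(t : ℂ) / 2) := by fun_prop
    have := (h.tendsto 0).mono_left (nhdsWithin_le_nhds (s := Set.Ioi 0))
    simpa using this
  have h2 := ((hq.const_sub 1).inv₀ h0)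
  have h3 := (((hq.const_add 1).div (hq.const_sub 1) h0).const_mul (-((a : ℂ) / 4))).cexp
  have h4 := (h1.mul h2).mul h3
  rw [one_add_div_one_sub_exp hφ] at h4
  have e : (1 : ℂ) * (1 - Complex.exp (-Complex.I * φ))⁻¹ *
      Complex.exp (-((a : ℂ) / 4) * (-Complex.I * (Real.cot (φ / 2) : ℂ))) =
      Complex.exp (Complex.I / 4 * ((a * Real.cot (φ / 2) : ℝ) : ℂ)) /
        (1 - Complex.exp (-Complex.I * φ)) := by
    rw [one_mul, div_eq_mul_inv, mul_comm]
    congr 2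
    rw [Complex.ofReal_mul]
    ring
  rw [e] at h4
  exact h4

/-- For `φ = 0` the factor is real. -/
theorem traceFactor_zero (a t : ℝ) : traceFactor 0 a t =
    ((Real.exp (-t / 2) * (1 - Real.exp (-t))⁻¹ *
      Real.exp (-(a / 4) * ((1 + Real.exp (-t)) / (1 - Real.exp (-t)))) : ℝ) : ℂ) := by
  rw [traceFactor]
  push_cast
  simp

theorem one_sub_exp_neg_le (t : ℝ) : 1 - Real.exp (-t) ≤ t := by
  linarith [Real.add_one_le_exp (-t)]

theorem half_le_one_sub_exp_neg {t : ℝ} (ht : 0 ≤ t) (ht1 : t ≤ 1) :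
    t / 2 ≤ 1 - Real.exp (-t) := by
  have h1 : (1 + t) * Real.exp (-t) ≤ 1 := by
    have h2 := mul_le_mul_of_nonneg_right (Real.add_one_le_exp t) (Real.exp_pos (-t)).le
    rw [← Real.exp_add, add_neg_cancel, Real.exp_zero] at h2
    linarith
  nlinarith [Real.exp_pos (-t)]

theorem eventually_mem_Ioc : ∀ᶠ t : ℝ in 𝓝[>] 0, 0 < t ∧ t ≤ 1 := by
  filter_upwards [Ioc_mem_nhdsGT (zero_lt_one' ℝ)] with t ht using ht

/-- The quotient t/(1 - e^{-t}) is the negative inverse of a difference quotient of e^{-t} at 0. -/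
theorem tendsto_mul_traceFactor_zero :
    Tendsto (fun t : ℝ => (t : ℂ) * traceFactor 0 0 t) (𝓝[>] 0) (𝓝 1) := by
  have hd : HasDerivAt (fun t : ℝ => Real.exp (-t)) (-1) 0 := by
    simpa using (hasDerivAt_neg (0 : ℝ)).exp
  have h1 := (hasDerivAt_iff_tendsto_slope.1 hd).mono_left
    (nhdsWithin_mono 0 (fun t ht => ne_of_gt ht : Set.Ioi (0 : ℝ) ⊆ {0}ᶜ))
  have h2 : Tendsto (fun t : ℝ => Real.exp (-t / 2)) (𝓝[>] 0) (𝓝 1) := by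
    have h : Continuous fun t : ℝ => Real.exp (-t / 2) := by fun_prop
    have := (h.tendsto 0).mono_left (nhdsWithin_le_nhds (s := Set.Ioi 0))
    simpa using this
  have h3 := h2.mul (h1.inv₀ (by norm_num)).neg
  have h4 : Tendsto (fun t : ℝ => t * (Real.exp (-t / 2) * (1 - Real.exp (-t))⁻¹)) (𝓝[>] 0)
      (𝓝 1) := by
    have e : (1 : ℝ) * -(-1)⁻¹ = 1 := by norm_num
    rw [e] at h3
    refine h3.congr fun t => ?_
    rw [slope_def_field, neg_zero, Real.exp_zero, sub_zero, inv_div]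
    rw [← neg_sub (Real.exp (-t)) 1, inv_neg]
    ring
  have h5 := (Complex.continuous_ofReal.tendsto 1).comp h4
  rw [Complex.ofReal_one] at h5
  refine h5.congr fun t => ?_
  rw [traceFactor_zero]
  simp

theorem exp_neg_div_isBigO {c : ℝ} (hc : 0 < c) (N : ℕ) :
    (fun t : ℝ => Real.exp (-(c / t))) =O[𝓝[>] 0] fun t => t ^ N := by
  have h1 : (fun x : ℝ => Real.exp (-c * x)) =o[atTop] fun x => x ^ (-(N : ℝ)) :=
    isLittleO_exp_neg_mul_rpow_atTop hc _
  have h2 := h1.isBigO.comp_tendsto (tendsto_inv_nhdsGT_zero (𝕜 := ℝ))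
  refine (h2.congr' ?_ ?_)
  · refine Eventually.of_forall fun t => ?_
    simp only [Function.comp, div_eq_mul_inv, neg_mul]
  · filter_upwards [eventually_mem_Ioc] with t ht
    simp only [Function.comp]
    rw [Real.inv_rpow ht.1.le, Real.rpow_neg ht.1.le, inv_inv, Real.rpow_natCast]

/-- For 0 < t ≤ 1 one has t/2 ≤ 1 - e^{-t} ≤ t: the lower bound controls the prefactor, the upper
one makes the exponent at most -a/(4t). -/
theorem norm_traceFactor_zero_le {a t : ℝ} (ha : 0 ≤ a) (ht : 0 < t) (ht1 : t ≤ 1) :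
    ‖traceFactor 0 a t‖ ≤ 2 * t⁻¹ * Real.exp (-(a / 4 / t)) := by
  have h1 := half_le_one_sub_exp_neg ht.le ht1
  have h2 := one_sub_exp_neg_le t
  have h3 : 0 < 1 - Real.exp (-t) := by linarith
  rw [traceFactor_zero, Complex.norm_real, Real.norm_of_nonneg (by positivity)]
  refine mul_le_mul ?_ (Real.exp_le_exp.2 ?_) (Real.exp_pos _).le (by positivity)
  · calc Real.exp (-t / 2) * (1 - Real.exp (-t))⁻¹ ≤ 1 * (t / 2)⁻¹ := by
          gcongr
          rw [Real.exp_le_one_iff]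
          linarith
      _ = 2 * t⁻¹ := by rw [inv_div, one_mul, div_eq_mul_inv]
  · rw [neg_mul, neg_le_neg_iff, div_eq_mul_inv _ t]
    refine mul_le_mul_of_nonneg_left ?_ (by positivity)
    rw [inv_eq_one_div]
    have := Real.exp_pos (-t)
    gcongr
    linarith

theorem traceFactor_zero_isBigO {a : ℝ} (ha : 0 < a) (N : ℕ) :
    traceFactor 0 a =O[𝓝[>] 0] fun t => t ^ N := by
  have h1 : traceFactor 0 a =O[𝓝[>] 0] fun t => t⁻¹ * Real.exp (-(a / 4 / t)) := by
    refine IsBigO.of_bound 2 ?_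
    filter_upwards [eventually_mem_Ioc] with t ht
    have h0 : 0 < t := ht.1
    refine (norm_traceFactor_zero_le ha.le ht.1 ht.2).trans_eq ?_
    rw [Real.norm_of_nonneg (by positivity)]
    ring
  refine h1.trans (((isBigO_refl (fun t : ℝ => t⁻¹) _).mul
    -- One extra power of t compensates the prefactor t⁻¹.
    (exp_neg_div_isBigO (c := a / 4) (by positivity) (N + 1))).congr' EventuallyEq.rfl ?_)
  filter_upwards [eventually_mem_Ioc] with t ht
  have h0 : t ≠ 0 := ht.1.ne'
  rw [pow_succ', inv_mul_cancel_left₀ h0]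

theorem traceFactor_isBigO_inv {φ a : ℝ} (hφ : φ = 0 ∨ φ ∈ Set.Ioo 0 (2 * Real.pi))
    (ha : 0 ≤ a) : traceFactor φ a =O[𝓝[>] 0] fun t => t⁻¹ := by
  rcases hφ with rfl | hφ
  · refine IsBigO.of_bound 2 ?_
    filter_upwards [eventually_mem_Ioc] with t ht
    have h0 : 0 < t := ht.1
    refine (norm_traceFactor_zero_le ha ht.1 ht.2).trans ?_
    rw [Real.norm_of_nonneg (by positivity)]
    have : Real.exp (-(a / 4 / t)) ≤ 1 := Real.exp_le_one_iff.2 (by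
      rw [neg_nonpos]
      positivity)
    exact mul_le_of_le_one_right (by positivity) this
  · refine ((tendsto_traceFactor hφ a).isBigO_one ℝ).trans (IsBigO.of_bound 1 ?_)
    filter_upwards [eventually_mem_Ioc] with t ht
    have h0 : 0 < t := ht.1
    rw [one_mul, norm_one, Real.norm_of_nonneg (by positivity)]
    exact (one_le_inv₀ h0).2 ht.2

/-! ### The asymptotics of the product -/

theorem card_filter_lt {n m : ℕ} (hm : m ≤ n) :
    (Finset.univ.filter fun j : Fin n => (j : ℕ) < m).card = m := by
  rw [← Finset.card_image_of_injective _ Fin.val_injective]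
  have : (Finset.univ.filter fun j : Fin n => (j : ℕ) < m).image Fin.val = Finset.range m := by
    ext k
    simp only [Finset.mem_image, Finset.mem_filter, Finset.mem_univ, true_and, Finset.mem_range]
    exact ⟨fun ⟨j, hj, e⟩ => e ▸ hj, fun hk => ⟨⟨k, by omega⟩, hk, rfl⟩⟩
  rw [this, Finset.card_range]

theorem card_filter_not_lt {n m : ℕ} (hm : m ≤ n) :
    (Finset.univ.filter fun j : Fin n => ¬(j : ℕ) < m).card = n - m := by
  have h := Finset.card_filter_add_card_filter_not (s := Finset.univ)
    (fun j : Fin n => (j : ℕ) < m)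
  rw [card_filter_lt hm, Finset.card_univ, Fintype.card_fin] at h
  omega

/-- One flat factor outweighs the at most 1/t growth of each of the others. -/
theorem prod_traceFactor_isBigOInfty {n : ℕ} {φ a : Fin n → ℝ}
    (hφ : ∀ j, φ j = 0 ∨ φ j ∈ Set.Ioo 0 (2 * Real.pi)) (ha : ∀ j, 0 ≤ a j)
    (hj : ∃ j, φ j = 0 ∧ 0 < a j) :
    IsBigOInfty fun t => ∏ j, traceFactor (φ j) (a j) t := by
  obtain ⟨j, hj, haj⟩ := hj
  intro N
  have h1 : (fun t => ∏ k ∈ Finset.univ.erase j, traceFactor (φ k) (a k) t) =O[𝓝[>] (0 : ℝ)]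
      fun t => ∏ _k ∈ Finset.univ.erase j, t⁻¹ :=
    IsBigO.finsetProd fun k _ => traceFactor_isBigO_inv (hφ k) (ha k)
  have h2 := (traceFactor_zero_isBigO haj (N + (Finset.univ.erase j).card)).mul h1
  refine (h2.congr' (Eventually.of_forall fun t => ?_) ?_)
  · simp only [← Finset.mul_prod_erase _ _ (Finset.mem_univ j), hj]
  · filter_upwards [eventually_mem_Ioc] with t ht
    have h0 : t ≠ 0 := ht.1.ne'
    rw [Finset.prod_const, pow_add, inv_pow, mul_assoc, mul_inv_cancel₀ (pow_ne_zero _ h0), mul_one]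

/-- Each nontrivial eigenvalue gives a nonzero limit, and each eigenvalue 1 with vanishing component
of z gives one factor 1/t. -/
theorem prod_traceFactor_isEquivalent {n m : ℕ} {φ a : Fin n → ℝ} (hm : m ≤ n)
    (hφ : ∀ j : Fin n, (j : ℕ) < m → φ j ∈ Set.Ioo 0 (2 * Real.pi))
    (hφ0 : ∀ j : Fin n, m ≤ (j : ℕ) → φ j = 0) (ha : ∀ j : Fin n, m ≤ (j : ℕ) → a j = 0) :
    (fun t => ∏ j, traceFactor (φ j) (a j) t) ~[𝓝[>] (0 : ℝ)] fun t =>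
      ((t : ℂ) ^ (n - m))⁻¹ * ∏ j ∈ Finset.univ.filter (fun j : Fin n => (j : ℕ) < m),
        Complex.exp (Complex.I / 4 * ((a j * Real.cot (φ j / 2) : ℝ) : ℂ)) /
          (1 - Complex.exp (-Complex.I * φ j)) := by
  have h1 : ∀ j : Fin n, traceFactor (φ j) (a j) ~[𝓝[>] (0 : ℝ)] fun t =>
      if (j : ℕ) < m then Complex.exp (Complex.I / 4 * ((a j * Real.cot (φ j / 2) : ℝ) : ℂ)) /
          (1 - Complex.exp (-Complex.I * φ j)) else (t : ℂ)⁻¹ := by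
    intro j
    split_ifs with hj
    · refine (isEquivalent_const_iff_tendsto ?_).2 (tendsto_traceFactor (hφ j hj) (a j))
      exact div_ne_zero (Complex.exp_ne_zero _) (one_sub_exp_neg_ne_zero (hφ j hj))
    · rw [hφ0 j (not_lt.1 hj), ha j (not_lt.1 hj)]
      refine (isEquivalent_iff_tendsto_one ?_).2 ?_
      · filter_upwards [eventually_mem_Ioc] with t ht
        have : (t : ℂ) ≠ 0 := by exact_mod_cast ht.1.ne'
        exact inv_ne_zero this
      · refine tendsto_mul_traceFactor_zero.congr fun t => ?_
        rw [Pi.div_apply, div_inv_eq_mul, mul_comm]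
  have h2 := IsEquivalent.finsetProd (s := Finset.univ) fun j _ => h1 j
  refine h2.trans (EventuallyEq.isEquivalent (Eventually.of_forall fun t => ?_))
  simp only
  rw [Finset.prod_ite, Finset.prod_const, mul_comm, inv_pow]
  congr 3
  rw [card_filter_not_lt hm]

end

end HeatTrace

namespace HeatTrace

noncomputable section

open scoped Matrix

/-! ### The trace formula -/

section TraceFormula

variable {n : ℕ} {g h : Matrix.unitaryGroup (Fin n) ℂ} {φ : Fin n → ℝ}

theorem sq_norm_coordShift (h : Matrix.unitaryGroup (Fin n) ℂ) (z : Fin n → ℂ) (j : Fin n) :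
    ‖coordShift h z j‖ ^ 2 = ‖herm z (eigvec h j)‖ ^ 2 / 2 := by
  rw [coordShift, norm_div, norm_star, div_pow, Complex.norm_real,
    Real.norm_of_nonneg (Real.sqrt_nonneg 2), Real.sq_sqrt (by norm_num)]

theorem re_one_sub_heatEigval_pos (φ : Fin n → ℝ) {t : ℝ} (ht : 0 < t) (j : Fin n) :
    0 < (1 - heatEigval φ t j).re := by
  have h1 := (Complex.re_le_norm (heatEigval φ t j)).trans_eq (norm_heatEigval φ t j)
  have h2 : Real.exp (-t) < 1 := Real.exp_lt_one_iff.2 (by linarith)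
  rw [Complex.sub_re, Complex.one_re]
  linarith

/-- Per coordinate, the exponents -|η|²/2 and -|η|²q/(1 - q) combine to -(|η|²/2)(1 + q)/(1 - q),
and |η_j|² = |(z, e_j)|²/2. -/
theorem gaussFactor_mul_integral (h : Matrix.unitaryGroup (Fin n) ℂ) (φ : Fin n → ℝ)
    (z : Fin n → ℂ) {t : ℝ} (ht : 0 < t) :
    gaussFactor h z t * ∫ u, cgaussPi (fun j => 1 - heatEigval φ t j)
      (fun j => -(star (coordShift h z j) * heatEigval φ t j)) (coordShift h z) 0 0 u =
    ∏ j, traceFactor (φ j) (‖herm z (eigvec h j)‖ ^ 2) t := by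
  have hpi : (Real.pi : ℂ) ≠ 0 := by exact_mod_cast Real.pi_ne_zero
  have h1 : gaussFactor h z t = ∏ j, ((Real.pi : ℂ)⁻¹ * (Complex.exp (-t / 2) *
      Complex.exp (-((‖coordShift h z j‖ ^ 2 : ℝ) : ℂ) / 2))) := by
    rw [Finset.prod_mul_distrib, Finset.prod_mul_distrib, Finset.prod_const, Finset.prod_const,
      ← Complex.exp_sum, Finset.card_univ, Fintype.card_fin, gaussFactor, inv_pow,
      ← Complex.exp_nat_mul, sqSum]
    push_cast
    rw [← Finset.sum_neg_distrib, Finset.sum_div]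
    congr 3
    ring_nf
  rw [h1, integral_cgaussPi, ← Finset.prod_mul_distrib]
  refine Finset.prod_congr rfl fun j _ => ?_
  have hre := re_one_sub_heatEigval_pos φ ht j
  have h0 : 1 - heatEigval φ t j ≠ 0 := fun h => by
    rw [h, Complex.zero_re] at hre
    exact lt_irrefl _ hre
  simp only [Pi.zero_apply]
  rw [integral_cgauss_zero hre, traceFactor, show Complex.exp (-t - Complex.I * φ j) =
    heatEigval φ t j from rfl]
  set q := heatEigval φ t j
  have h2 : Complex.exp (-((‖herm z (eigvec h j)‖ ^ 2 : ℝ) / 4) * ((1 + q) / (1 - q))) =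
      Complex.exp (-((‖coordShift h z j‖ ^ 2 : ℝ) : ℂ) / 2) *
        Complex.exp (-(star (coordShift h z j) * q) * coordShift h z j / (1 - q)) := by
    rw [← Complex.exp_add]
    congr 1
    have h3 : star (coordShift h z j) * coordShift h z j =
        ((‖coordShift h z j‖ ^ 2 : ℝ) : ℂ) := by
      push_cast
      exact Complex.conj_mul' _
    have h4 : -(star (coordShift h z j) * q) * coordShift h z j =
        -(((‖coordShift h z j‖ ^ 2 : ℝ) : ℂ) * q) := by
      rw [← h3]
      ring
    rw [h4, sq_norm_coordShift]
    push_cast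
    field_simp
    ring
  rw [h2]
  field_simp

theorem isAffineForm_star_mulVec (H : Matrix.unitaryGroup (Fin n) ℂ) {K : ℝ} (hK : 1 ≤ K)
    (i : Fin n) : IsAffineForm K fun u : Fin n → ℂ =>
      star (((H : Matrix (Fin n) (Fin n) ℂ) *ᵥ u) i) := by
  have hH : ∀ j, ‖(H : Matrix (Fin n) (Fin n) ℂ) i j‖ ≤ K := fun j =>
    (entry_norm_bound_of_unitary H.2 i j).trans hK
  refine ⟨0, fun j => star ((H : Matrix (Fin n) (Fin n) ℂ) i j),
    fun j => -(Complex.I * star ((H : Matrix (Fin n) (Fin n) ℂ) i j)), ?_, fun j => ?_, fun j => ?_,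
    fun u => ?_⟩
  · rw [norm_zero]
    linarith
  · rw [norm_star]
    exact hH j
  · rw [norm_neg, norm_mul, Complex.norm_I, one_mul, norm_star]
    exact hH j
  · simp only [Matrix.mulVec, dotProduct, star_sum, star_mul', zero_add]
    refine Finset.sum_congr rfl fun j _ => ?_
    have : star (u j) = (u j).re - (u j).im * Complex.I := by
      apply Complex.ext <;> simp
    rw [this]
    ring

/-- Entries of a unitary matrix and the eigenvalues q are at most one in modulus, so the coefficient
bound is independent of t. -/
theorem isAffineForm_mulVec (H : Matrix.unitaryGroup (Fin n) ℂ) {q η : Fin n → ℂ}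
    (hq : ∀ j, ‖q j‖ ≤ 1) (k : Fin n) : IsAffineForm (1 + absSum η) fun u : Fin n → ℂ =>
      ((H : Matrix (Fin n) (Fin n) ℂ) *ᵥ fun j => q j * u j + η j) k := by
  have hH : ∀ j, ‖(H : Matrix (Fin n) (Fin n) ℂ) k j‖ ≤ 1 := fun j =>
    entry_norm_bound_of_unitary H.2 k j
  have hHq : ∀ j, ‖(H : Matrix (Fin n) (Fin n) ℂ) k j * q j‖ ≤ 1 + absSum η := fun j => by
    rw [norm_mul]
    have := mul_le_one₀ (hH j) (norm_nonneg _) (hq j)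
    linarith [absSum_nonneg η]
  refine ⟨∑ j, (H : Matrix (Fin n) (Fin n) ℂ) k j * η j,
    fun j => (H : Matrix (Fin n) (Fin n) ℂ) k j * q j,
    fun j => Complex.I * ((H : Matrix (Fin n) (Fin n) ℂ) k j * q j), ?_, hHq, fun j => ?_,
    fun u => ?_⟩
  · refine (norm_sum_le _ _).trans ((Finset.sum_le_sum fun j _ => ?_).trans
      (le_add_of_nonneg_left zero_le_one))
    rw [norm_mul]
    exact mul_le_of_le_one_left (norm_nonneg _) (hH j)
  · rw [norm_mul, Complex.norm_I, one_mul]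
    exact hHq j
  · simp only [Matrix.mulVec, dotProduct]
    rw [← Finset.sum_add_distrib]
    refine Finset.sum_congr rfl fun j _ => ?_
    nth_rewrite 1 [← Complex.re_add_im (u j)]
    ring

/-- The trace of `B T_z R_g e^{-tH}`, as an integral over coherent states. -/
def diffTrace (h : Matrix.unitaryGroup (Fin n) ℂ) (B : Sch n →L[ℂ] Sch n) (z : Fin n → ℂ)
    (g : Matrix.unitaryGroup (Fin n) ℂ) (t : ℝ) : ℂ :=
  ∫ u, ⟪cohState (conjUnitary h) u, diffTwistedHeat B z g t (cohState (conjUnitary h) u)⟫_ℂ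

theorem diffTrace_word (hd : IsDiagonalization g h φ) (z : Fin n → ℂ)
    (hg : ∃ AB, IsLogarithm (g : Matrix (Fin n) (Fin n) ℂ) AB) {t : ℝ} (ht : 0 < t)
    (l₁ l₂ : List (Fin n)) : diffTrace h (word l₁ l₂) z g t = gaussFactor h z t *
      ∫ u, ((l₁.map fun i => star (((conjUnitary h : Matrix (Fin n) (Fin n) ℂ) *ᵥ u) i)).prod *
        (l₂.map ((conjUnitary h : Matrix (Fin n) (Fin n) ℂ) *ᵥ
          (fun j => heatEigval φ t j * u j + coordShift h z j))).prod) *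
        cgaussPi (fun j => 1 - heatEigval φ t j)
          (fun j => -(star (coordShift h z j) * heatEigval φ t j)) (coordShift h z) 0 0 u := by
  rw [diffTrace, ← integral_const_mul]
  exact integral_congr_ae (Eventually.of_forall fun u =>
    inner_cohState_diffTwistedHeat hd z hg ht l₁ l₂ u)

theorem diffTrace_one (hd : IsDiagonalization g h φ) (z : Fin n → ℂ)
    (hg : ∃ AB, IsLogarithm (g : Matrix (Fin n) (Fin n) ℂ) AB) {t : ℝ} (ht : 0 < t) :
    diffTrace h 1 z g t = ∏ j, traceFactor (φ j) (‖herm z (eigvec h j)‖ ^ 2) t := by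
  have h1 : (1 : Sch n →L[ℂ] Sch n) = word [] [] := by simp [word]
  rw [h1, diffTrace_word hd z hg ht, ← gaussFactor_mul_integral h φ z ht]
  simp

theorem hasTrace_twistedHeat (hd : IsDiagonalization g h φ) (z : Fin n → ℂ)
    (hg : ∃ AB, IsLogarithm (g : Matrix (Fin n) (Fin n) ℂ) AB) {t : ℝ} (ht : 0 < t) :
    HasTrace (twistedHeat z g t)
      (∏ j, traceFactor (φ j) (‖herm z (eigvec h j)‖ ^ 2) t) := by
  rw [← diffTrace_one hd z hg ht, ← diffTwistedHeat_one z hg ht]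
  exact (hasTrace_diffTwistedHeat 1 z hg ht (conjUnitary h)).2

/-- A word costs at most ρ^D relative to the trace without it, with a constant independent of t. The
conditions on ρ are those of the moment estimate, since ‖b_j‖ + ‖c_j‖ ≤ 2‖η_j‖. -/
theorem exists_norm_diffTrace_word_le (hd : IsDiagonalization g h φ) (z : Fin n → ℂ)
    (hg : ∃ AB, IsLogarithm (g : Matrix (Fin n) (Fin n) ℂ) AB) (D : ℕ) :
    ∃ C : ℝ, 0 ≤ C ∧ ∀ (t ρ : ℝ), 0 < t → 1 ≤ ρ →
      (∀ j, 2 * ‖coordShift h z j‖ ≤ ρ * ‖1 - heatEigval φ t j‖) →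
      (∀ j, 1 ≤ ρ ^ 2 * ‖1 - heatEigval φ t j‖) →
      ∀ l₁ l₂ : List (Fin n), l₁.length + l₂.length ≤ D →
        ‖diffTrace h (word l₁ l₂) z g t‖ ≤
          C * ρ ^ D * ‖∏ j, traceFactor (φ j) (‖herm z (eigvec h j)‖ ^ 2) t‖ := by
  have hK : 1 ≤ 1 + absSum (coordShift h z) := le_add_of_nonneg_right (absSum_nonneg _)
  obtain ⟨C, hC0, hC⟩ := exists_norm_integral_affineForms_le n D (zero_le_one.trans hK)
  refine ⟨C, hC0, fun t ρ ht hρ h1 h2 l₁ l₂ hl => ?_⟩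
  have hq : ∀ j, ‖heatEigval φ t j‖ ≤ 1 := fun j => by
    rw [norm_heatEigval]
    exact Real.exp_le_one_iff.2 (by linarith)
  set Fs : List ((Fin n → ℂ) → ℂ) :=
    l₁.map (fun i => fun u => star (((conjUnitary h : Matrix (Fin n) (Fin n) ℂ) *ᵥ u) i)) ++
    l₂.map (fun k => fun u => ((conjUnitary h : Matrix (Fin n) (Fin n) ℂ) *ᵥ
      (fun j => heatEigval φ t j * u j + coordShift h z j)) k) with hFs
  have e : ∀ u : Fin n → ℂ,
      ((l₁.map fun i => star (((conjUnitary h : Matrix (Fin n) (Fin n) ℂ) *ᵥ u) i)).prod *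
        (l₂.map ((conjUnitary h : Matrix (Fin n) (Fin n) ℂ) *ᵥ
          (fun j => heatEigval φ t j * u j + coordShift h z j))).prod) =
      (Fs.map fun F => F u).prod := fun u => by
    rw [hFs, List.map_append, List.prod_append, List.map_map, List.map_map]
    rfl
  rw [diffTrace_word hd z hg ht, ← gaussFactor_mul_integral h φ z ht, norm_mul, norm_mul]
  simp only [e]
  have h3 := hC (fun j => 1 - heatEigval φ t j)
    (fun j => -(star (coordShift h z j) * heatEigval φ t j)) (coordShift h z) ρ
    (re_one_sub_heatEigval_pos φ ht) hρ (fun j => ?_) h2 Fs ?_ ?_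
  · calc _ ≤ ‖gaussFactor h z t‖ * _ := mul_le_mul_of_nonneg_left h3 (norm_nonneg _)
      _ = _ := by ring
  · refine le_trans ?_ (h1 j)
    rw [norm_neg, norm_mul, norm_star, two_mul]
    gcongr
    exact mul_le_of_le_one_right (norm_nonneg _) (hq j)
  · rw [hFs, List.length_append, List.length_map, List.length_map]
    exact hl
  · intro F hF
    rw [hFs, List.mem_append, List.mem_map, List.mem_map] at hF
    rcases hF with ⟨i, -, rfl⟩ | ⟨k, -, rfl⟩
    · exact isAffineForm_star_mulVec _ hK i
    · exact isAffineForm_mulVec _ hq k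

theorem diffTrace_isBigO (hd : IsDiagonalization g h φ) (z : Fin n → ℂ)
    (hg : ∃ AB, IsLogarithm (g : Matrix (Fin n) (Fin n) ℂ) AB) {D : ℕ} {ρ : ℝ → ℝ}
    (hρ : ∀ᶠ t in 𝓝[>] (0 : ℝ), 1 ≤ ρ t ∧ ∀ j,
      2 * ‖coordShift h z j‖ ≤ ρ t * ‖1 - heatEigval φ t j‖ ∧
      1 ≤ ρ t ^ 2 * ‖1 - heatEigval φ t j‖)
    {B : Sch n →L[ℂ] Sch n} (hB : B ∈ normalOps n D) :
    diffTrace h B z g =O[𝓝[>] (0 : ℝ)] fun t => (ρ t : ℂ) ^ D *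
      ∏ j, traceFactor (φ j) (‖herm z (eigvec h j)‖ ^ 2) t := by
  obtain ⟨C, hC0, hC⟩ := exists_norm_diffTrace_word_le hd z hg D
  have hi := fun (B : Sch n →L[ℂ] Sch n) (t : ℝ) (ht : 0 < t) =>
    (hasTrace_diffTwistedHeat B z hg ht (conjUnitary h)).1
  induction hB using Submodule.span_induction with
  | mem P hP =>
    obtain ⟨l₁, l₂, hl, rfl⟩ := hP
    refine IsBigO.of_bound C ?_
    filter_upwards [hρ, self_mem_nhdsWithin] with t ht ht0
    refine (hC t (ρ t) ht0 ht.1 (fun j => (ht.2 j).1) (fun j => (ht.2 j).2) l₁ l₂ hl).trans_eq ?_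
    rw [norm_mul, norm_pow, Complex.norm_real, Real.norm_of_nonneg (zero_le_one.trans ht.1),
      mul_assoc]
  | zero =>
    refine (isBigO_zero _ _).congr_left fun t => ?_
    simp only [diffTrace, diffTwistedHeat_apply, zero_apply, toL2_eq_toLpCLM, map_zero,
      inner_zero_right, integral_zero]
  | add P Q _ _ hP hQ =>
    refine (hP.add hQ).congr' ?_ EventuallyEq.rfl
    filter_upwards [self_mem_nhdsWithin] with t ht
    rw [diffTrace, diffTrace, diffTrace, ← integral_add (hi P t ht) (hi Q t ht)]
    refine integral_congr_ae (Eventually.of_forall fun u => ?_)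
    simp only [diffTwistedHeat_apply, add_apply, toL2_add, inner_add_right]
  | smul c P _ hP =>
    refine (hP.const_mul_left c).congr_left fun t => ?_
    rw [diffTrace, diffTrace, ← integral_const_mul]
    refine integral_congr_ae (Eventually.of_forall fun u => ?_)
    simp only [diffTwistedHeat_apply, smul_apply, toL2_smul, inner_smul_right]

end TraceFormula

end

end HeatTrace

namespace HeatTrace

noncomputable section

open scoped Matrix

/-! ### Diagonalization of unitary matrices -/

/-- The circle is infinite and the spectrum finite. Such a c makes the Cayley transform of G
defined. -/
theorem exists_norm_eq_one_notMem_spectrum {n : ℕ} (G : Matrix (Fin n) (Fin n) ℂ) :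
    ∃ c : ℂ, ‖c‖ = 1 ∧ c ∉ spectrum ℂ G := by
  have h1 : Set.InjOn (fun t : ℝ => Complex.exp (t * Complex.I)) (Set.Ioo 0 1) := by
    intro s hs t ht hst
    have hpi := Real.pi_gt_three
    have h := Complex.exp_inj_of_neg_pi_lt_of_le_pi (x := s * Complex.I) (y := t * Complex.I)
      (by simp; linarith [hs.1]) (by simp; linarith [hs.2]) (by simp; linarith [ht.1])
      (by simp; linarith [ht.2]) hst
    exact_mod_cast mul_right_cancel₀ Complex.I_ne_zero h
  have h2 : ((fun t : ℝ => Complex.exp (t * Complex.I)) '' Set.Ioo 0 1).Infinite :=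
    (Set.Ioo_infinite zero_lt_one).image h1
  obtain ⟨c, ⟨t, -, rfl⟩, hc⟩ := h2.exists_notMem_finite (Matrix.finite_spectrum G)
  exact ⟨_, Complex.norm_exp_ofReal_mul_I t, hc⟩

/-- After multiplication by Mᴴ on the left and M on the right, both the Cayley transform and its
adjoint become i(c̄G - cGᴴ). -/
theorem cayley_isHermitian {n : ℕ} {G M N : Matrix (Fin n) (Fin n) ℂ} {c : ℂ} (hc : ‖c‖ = 1)
    (hG : Gᴴ * G = 1) (hM : M = c • 1 - G) (hMN : M * N = 1) (hNM : N * M = 1) :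
    (Complex.I • ((c • 1 + G) * N)).IsHermitian := by
  have hcc : star c * c = 1 := by
    rw [RCLike.star_def, Complex.conj_mul', hc]
    simp
  have h1 : Mᴴ * Nᴴ = 1 := by
    rw [← Matrix.conjTranspose_mul, hNM, Matrix.conjTranspose_one]
  have h2 : Nᴴ * Mᴴ = 1 := by
    rw [← Matrix.conjTranspose_mul, hMN, Matrix.conjTranspose_one]
  set K := Complex.I • ((c • 1 + G) * N) with hK
  have h3 : Mᴴ * Kᴴ * M = -Complex.I • ((star c • 1 + Gᴴ) * (c • 1 - G)) := by
    rw [hK, Matrix.conjTranspose_smul, Matrix.conjTranspose_mul, Matrix.mul_smul,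
      ← Matrix.mul_assoc Mᴴ, h1, Matrix.one_mul, Matrix.smul_mul, hM, Matrix.conjTranspose_add,
      Matrix.conjTranspose_smul, Matrix.conjTranspose_one]
    simp
  have h4 : Mᴴ * K * M = Complex.I • ((star c • 1 - Gᴴ) * (c • 1 + G)) := by
    rw [hK, Matrix.mul_assoc, Matrix.smul_mul, Matrix.mul_assoc, hNM, Matrix.mul_one,
      Matrix.mul_smul, hM, Matrix.conjTranspose_sub, Matrix.conjTranspose_smul,
      Matrix.conjTranspose_one]
  have h5 : Mᴴ * Kᴴ * M = Mᴴ * K * M := by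
    rw [h3, h4]
    simp only [Matrix.add_mul, Matrix.mul_sub, Matrix.sub_mul, Matrix.mul_add, Matrix.smul_mul,
      Matrix.mul_smul, Matrix.one_mul, hG, smul_sub, smul_add, smul_smul, hcc, mul_comm c, mul_one]
    module
  have h6 : ∀ X : Matrix (Fin n) (Fin n) ℂ, Nᴴ * (Mᴴ * X * M) * N = X := fun X => by
    rw [Matrix.mul_assoc Mᴴ, ← Matrix.mul_assoc Nᴴ, h2, Matrix.one_mul, Matrix.mul_assoc, hMN,
      Matrix.mul_one]
  rw [Matrix.IsHermitian, ← h6 Kᴴ, h5, h6]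

/-- The Cayley transform K reduces the claim to the spectral theorem for Hermitian matrices: an
eigenbasis of K diagonalizes G = c(K - i)(K + i)⁻¹. -/
theorem exists_diagonal_of_unitary {n : ℕ} (g : Matrix.unitaryGroup (Fin n) ℂ) :
    ∃ (h : Matrix.unitaryGroup (Fin n) ℂ) (θ : Fin n → ℝ), (∀ j, θ j ∈ Set.Ico 0 (2 * Real.pi)) ∧
      (g : Matrix (Fin n) (Fin n) ℂ) * h = (h : Matrix (Fin n) (Fin n) ℂ) *
        Matrix.diagonal (fun j => Complex.exp (Complex.I * θ j)) := by
  obtain ⟨c, hc, hcs⟩ := exists_norm_eq_one_notMem_spectrum (g : Matrix (Fin n) (Fin n) ℂ)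
  set G : Matrix (Fin n) (Fin n) ℂ := (g : Matrix (Fin n) (Fin n) ℂ) with hG
  rw [spectrum.notMem_iff] at hcs
  obtain ⟨u, hu⟩ := hcs
  set M : Matrix (Fin n) (Fin n) ℂ := c • 1 - G with hM
  have huM : (u : Matrix (Fin n) (Fin n) ℂ) = M := by
    rw [hu, hM, Algebra.algebraMap_eq_smul_one]
  set N : Matrix (Fin n) (Fin n) ℂ := ((u⁻¹ : (Matrix (Fin n) (Fin n) ℂ)ˣ) :
    Matrix (Fin n) (Fin n) ℂ) with hN
  have hMN : M * N = 1 := by rw [← huM, hN, Units.mul_inv]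
  have hNM : N * M = 1 := by rw [← huM, hN, Units.inv_mul]
  obtain ⟨K, hK⟩ : ∃ K : Matrix (Fin n) (Fin n) ℂ, K = Complex.I • ((c • 1 + G) * N) := ⟨_, rfl⟩
  have hKh : K.IsHermitian := hK ▸ cayley_isHermitian hc (conjTranspose_mul_unitary g) hM hMN hNM
  have hMK : M * K = Complex.I • (c • 1 + G) := by
    rw [hK, Matrix.mul_smul, ← Matrix.mul_assoc]
    have : M * (c • 1 + G) = (c • 1 + G) * M := by
      rw [hM]
      simp only [Matrix.sub_mul, Matrix.mul_add, Matrix.add_mul, Matrix.mul_sub, Matrix.smul_mul,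
        Matrix.mul_smul, Matrix.one_mul, Matrix.mul_one]
      module
    rw [this, Matrix.mul_assoc, hMN, Matrix.mul_one]
  have hGK : G * (K + Complex.I • 1) = c • (K - Complex.I • 1) := by
    have : c • K - G * K = Complex.I • (c • 1 + G) := by
      rw [← hMK, hM, Matrix.sub_mul, Matrix.smul_mul, Matrix.one_mul]
    rw [Matrix.mul_add, Matrix.mul_smul, Matrix.mul_one, smul_sub]
    rw [smul_add] at this
    rw [sub_eq_iff_eq_add] at this
    rw [this, smul_comm c]
    abel
  set U := hKh.eigenvectorUnitary
  set κ := hKh.eigenvalues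
  have hKU : K * (U : Matrix (Fin n) (Fin n) ℂ) = (U : Matrix (Fin n) (Fin n) ℂ) *
      Matrix.diagonal (fun j => (κ j : ℂ)) := by
    have h := hKh.spectral_theorem
    rw [Unitary.conjStarAlgAut_apply] at h
    nth_rewrite 1 [h]
    rw [Matrix.mul_assoc, Unitary.coe_star_mul_self, Matrix.mul_one]
    rfl
  have hne : ∀ j, (κ j : ℂ) + Complex.I ≠ 0 := fun j h => by
    have := congrArg Complex.im h
    simp at this
  set ev : Fin n → ℂ := fun j => c * (κ j - Complex.I) / (κ j + Complex.I) with hev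
  have hGU : G * (U : Matrix (Fin n) (Fin n) ℂ) = (U : Matrix (Fin n) (Fin n) ℂ) *
      Matrix.diagonal ev := by
    have e1 : Matrix.diagonal (fun j => (κ j : ℂ) + Complex.I) =
        Matrix.diagonal (fun j => (κ j : ℂ)) + Complex.I • (1 : Matrix (Fin n) (Fin n) ℂ) := by
      rw [Matrix.smul_one_eq_diagonal, Matrix.diagonal_add]
    have e2 : Matrix.diagonal (fun j => (κ j : ℂ) - Complex.I) =
        Matrix.diagonal (fun j => (κ j : ℂ)) - Complex.I • (1 : Matrix (Fin n) (Fin n) ℂ) := by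
      rw [Matrix.smul_one_eq_diagonal, Matrix.diagonal_sub]
    have h1 : G * (U : Matrix (Fin n) (Fin n) ℂ) *
        Matrix.diagonal (fun j => (κ j : ℂ) + Complex.I) =
        (U : Matrix (Fin n) (Fin n) ℂ) * (c • Matrix.diagonal (fun j => (κ j : ℂ) - Complex.I)) := by
      have l1 : (U : Matrix (Fin n) (Fin n) ℂ) *
          Matrix.diagonal (fun j => (κ j : ℂ) + Complex.I) = (K + Complex.I • 1) * U := by
        rw [e1, Matrix.mul_add, ← hKU, Matrix.add_mul, Matrix.mul_smul, Matrix.mul_one,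
          Matrix.smul_mul, Matrix.one_mul]
      have l2 : (U : Matrix (Fin n) (Fin n) ℂ) *
          Matrix.diagonal (fun j => (κ j : ℂ) - Complex.I) = (K - Complex.I • 1) * U := by
        rw [e2, Matrix.mul_sub, ← hKU, Matrix.sub_mul, Matrix.mul_smul, Matrix.mul_one,
          Matrix.smul_mul, Matrix.one_mul]
      rw [Matrix.mul_assoc, l1, Matrix.mul_smul, l2, ← Matrix.mul_assoc, hGK, Matrix.smul_mul]
    have h2 : Matrix.diagonal (fun j => (κ j : ℂ) + Complex.I) *
        Matrix.diagonal (fun j => ((κ j : ℂ) + Complex.I)⁻¹) = 1 := by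
      rw [Matrix.diagonal_mul_diagonal]
      simp [mul_inv_cancel₀ (hne _)]
    have h3 := congrArg (· * Matrix.diagonal (fun j => ((κ j : ℂ) + Complex.I)⁻¹)) h1
    simp only [Matrix.mul_assoc, h2, Matrix.mul_one, Matrix.smul_mul,
      Matrix.diagonal_mul_diagonal] at h3
    rw [h3]
    congr 1
    rw [← Matrix.diagonal_smul]
    congr 1
    funext j
    simp only [Pi.smul_apply, smul_eq_mul, hev, div_eq_mul_inv, mul_assoc]
  have hev1 : ∀ j, ‖ev j‖ = 1 := fun j => by
    have h1 : (κ j : ℂ) - Complex.I = star ((κ j : ℂ) + Complex.I) := by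
      apply Complex.ext <;> simp
    rw [hev, norm_div, norm_mul, hc, one_mul, h1, norm_star]
    exact div_self (norm_ne_zero_iff.2 (hne j))
  -- The principal argument is shifted into [0, 2π), so that the angle 0 represents exactly the
  -- eigenvalue 1.
  refine ⟨U, fun j => toIcoMod Real.two_pi_pos 0 (ev j).arg, fun j => ?_, ?_⟩
  · simpa using toIcoMod_mem_Ico Real.two_pi_pos 0 (ev j).arg
  · rw [hGU]
    congr 2
    funext j
    have h1 := Complex.norm_mul_exp_arg_mul_I (ev j)
    rw [hev1, Complex.ofReal_one, one_mul] at h1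
    change ev j = Complex.exp (Complex.I * (toIcoMod Real.two_pi_pos 0 (ev j).arg : ℝ))
    rw [← self_sub_toIcoDiv_zsmul, mul_comm Complex.I]
    nth_rewrite 1 [← h1]
    rw [Complex.ofReal_sub]
    rw [sub_mul, Complex.exp_sub, show ((toIcoDiv Real.two_pi_pos 0 (ev j).arg •
      (2 * Real.pi) : ℝ) : ℂ) * Complex.I =
        (toIcoDiv Real.two_pi_pos 0 (ev j).arg : ℤ) * (2 * Real.pi * Complex.I) by
      rw [zsmul_eq_mul]; push_cast; ring, Complex.exp_int_mul_two_pi_mul_I, div_one]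

end

end HeatTrace

namespace HeatTrace

noncomputable section

open scoped Matrix

/-! ### Logarithms, fixed points and the existence of diagonalizations -/

theorem eq_mul_diagonal_mul {n : ℕ} {g h : Matrix.unitaryGroup (Fin n) ℂ} {v : Fin n → ℂ}
    (hgh : (g : Matrix (Fin n) (Fin n) ℂ) * h = (h : Matrix (Fin n) (Fin n) ℂ) *
      Matrix.diagonal v) : (g : Matrix (Fin n) (Fin n) ℂ) = (h : Matrix (Fin n) (Fin n) ℂ) *
        Matrix.diagonal v * (h : Matrix (Fin n) (Fin n) ℂ)ᴴ := by
  rw [← hgh, Matrix.mul_assoc, unitary_mul_conjTranspose, Matrix.mul_one]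

/-- The matrix L = h diag(iθ) hᴴ is skew-Hermitian, which says that its imaginary part is symmetric
and its real part skew. -/
theorem exists_isLogarithm {n : ℕ} (g : Matrix.unitaryGroup (Fin n) ℂ) :
    ∃ AB, IsLogarithm (g : Matrix (Fin n) (Fin n) ℂ) AB := by
  obtain ⟨h, θ, -, hgh⟩ := exists_diagonal_of_unitary g
  set L : Matrix (Fin n) (Fin n) ℂ := (h : Matrix (Fin n) (Fin n) ℂ) *
    Matrix.diagonal (fun j => Complex.I * θ j) * (h : Matrix (Fin n) (Fin n) ℂ)ᴴ with hL
  have hLH : Lᴴ = -L := by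
    rw [hL, Matrix.conjTranspose_mul, Matrix.conjTranspose_mul, Matrix.conjTranspose_conjTranspose,
      Matrix.diagonal_conjTranspose, ← Matrix.mul_assoc, ← Matrix.neg_mul, ← Matrix.mul_neg,
      Matrix.diagonal_neg]
    congr 3
    funext j
    simp
  have hentry : ∀ i j, star (L j i) = -L i j := fun i j => congrFun (congrFun hLH i) j
  refine ⟨(L.map Complex.im, L.map Complex.re), ?_, ?_, ?_⟩
  · ext i j
    have := congrArg Complex.im (hentry i j)
    simpa using this
  · ext i j
    have := congrArg Complex.re (hentry i j)
    simpa using this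
  · have h1 : (L.map Complex.re).map ((↑) : ℝ → ℂ) + Complex.I • (L.map Complex.im).map
        ((↑) : ℝ → ℂ) = L := by
      ext i j
      simp only [Matrix.add_apply, Matrix.smul_apply, Matrix.map_apply, smul_eq_mul]
      rw [mul_comm, Complex.re_add_im]
    rw [h1, hL]
    have h2 := Matrix.exp_units_conj ⟨(h : Matrix (Fin n) (Fin n) ℂ),
      (h : Matrix (Fin n) (Fin n) ℂ)ᴴ, unitary_mul_conjTranspose h, conjTranspose_mul_unitary h⟩
      (Matrix.diagonal (fun j => Complex.I * θ j))
    refine (eq_mul_diagonal_mul hgh).trans (Eq.trans ?_ h2.symm)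
    rw [Matrix.exp_diagonal]
    congr 3
    funext j
    rw [Pi.coe_exp, Complex.exp_eq_exp_ℂ]

section FixedPoints

variable {n : ℕ} {g h : Matrix.unitaryGroup (Fin n) ℂ}

/-- Rank–nullity for g - 1, whose rank is that of the diagonal matrix to which it is conjugate. -/
theorem movedDim_eq_card {v : Fin n → ℂ} (hgh : (g : Matrix (Fin n) (Fin n) ℂ) * h =
    (h : Matrix (Fin n) (Fin n) ℂ) * Matrix.diagonal v) :
    movedDim g = Fintype.card {j // v j - 1 ≠ 0} := by
  have h1 : fixedSpace g = LinearMap.ker (Matrix.mulVecLin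
      ((g : Matrix (Fin n) (Fin n) ℂ) - 1)) := by
    ext w
    rw [fixedSpace, LinearMap.mem_eqLocus, LinearMap.mem_ker, Matrix.mulVecLin_apply,
      Matrix.mulVecLin_apply, Matrix.sub_mulVec, Matrix.one_mulVec, sub_eq_zero,
      LinearMap.id_apply]
  have h2 := LinearMap.finrank_range_add_finrank_ker (Matrix.mulVecLin
    ((g : Matrix (Fin n) (Fin n) ℂ) - 1))
  have h3 : (g : Matrix (Fin n) (Fin n) ℂ) - 1 = (h : Matrix (Fin n) (Fin n) ℂ) *
      (Matrix.diagonal (fun j => v j - 1) * (h : Matrix (Fin n) (Fin n) ℂ)ᴴ) := by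
    rw [← Matrix.diagonal_sub, Matrix.diagonal_one, Matrix.sub_mul, Matrix.mul_sub, Matrix.one_mul,
      unitary_mul_conjTranspose, ← Matrix.mul_assoc, ← eq_mul_diagonal_mul hgh]
  have hdet : IsUnit (h : Matrix (Fin n) (Fin n) ℂ).det :=
    (Matrix.isUnit_iff_isUnit_det _).1 ⟨⟨_, _, unitary_mul_conjTranspose h,
      conjTranspose_mul_unitary h⟩, rfl⟩
  have hdet' : IsUnit (h : Matrix (Fin n) (Fin n) ℂ)ᴴ.det :=
    (Matrix.isUnit_iff_isUnit_det _).1 ⟨⟨_, _, conjTranspose_mul_unitary h,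
      unitary_mul_conjTranspose h⟩, rfl⟩
  have h4 : ((g : Matrix (Fin n) (Fin n) ℂ) - 1).rank = Fintype.card {j // v j - 1 ≠ 0} := by
    rw [h3, Matrix.rank_mul_eq_right_of_isUnit_det _ _ hdet,
      Matrix.rank_mul_eq_left_of_isUnit_det _ _ hdet', Matrix.rank_diagonal]
  rw [Matrix.rank] at h4
  rw [movedDim, h1, ← h4]
  rw [Module.finrank_fin_fun] at h2
  omega

theorem movedDim_le (g : Matrix.unitaryGroup (Fin n) ℂ) : movedDim g ≤ n := Nat.sub_le _ _

/-- The eigenvectors are permuted so that the nonzero angles come first; the cardinalities match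
because m counts the eigenvalues different from 1. -/
theorem exists_isDiagonalization (g : Matrix.unitaryGroup (Fin n) ℂ) :
    ∃ h φ, IsDiagonalization g h φ := by
  obtain ⟨h, θ, hθ, hgh⟩ := exists_diagonal_of_unitary g
  have hzero : ∀ j, Complex.exp (Complex.I * θ j) - 1 ≠ 0 ↔ θ j ≠ 0 := by
    intro j
    refine ⟨fun h1 h2 => h1 (by simp [h2]), fun h1 h2 => ?_⟩
    have h3 : θ j ∈ Set.Ioo 0 (2 * Real.pi) := ⟨lt_of_le_of_ne (hθ j).1 h1.symm, (hθ j).2⟩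
    refine one_sub_exp_neg_ne_zero h3 ?_
    rw [neg_mul, Complex.exp_neg, sub_eq_zero.1 h2, inv_one, sub_self]
  have hcard : Fintype.card {j : Fin n // (j : ℕ) < movedDim g} =
      Fintype.card {j : Fin n // θ j ≠ 0} := by
    rw [Fintype.card_subtype, card_filter_lt (movedDim_le g), movedDim_eq_card hgh]
    exact Fintype.card_congr (Equiv.subtypeEquivRight hzero)
  set σ : Equiv.Perm (Fin n) := (Fintype.equivOfCardEq hcard).extendSubtype
  have hσ1 : ∀ j : Fin n, (j : ℕ) < movedDim g → θ (σ j) ≠ 0 := fun j hj =>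
    Equiv.extendSubtype_mem (Fintype.equivOfCardEq hcard) j hj
  have hσ2 : ∀ j : Fin n, movedDim g ≤ (j : ℕ) → θ (σ j) = 0 := fun j hj =>
    not_not.1 (Equiv.extendSubtype_not_mem (Fintype.equivOfCardEq hcard) j (not_lt.2 hj))
  have hH : (h : Matrix (Fin n) (Fin n) ℂ).submatrix id σ ∈ Matrix.unitaryGroup (Fin n) ℂ := by
    rw [Matrix.mem_unitaryGroup_iff, Matrix.star_eq_conjTranspose, Matrix.conjTranspose_submatrix,
      Matrix.submatrix_mul_equiv, unitary_mul_conjTranspose, Matrix.submatrix_id_id]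
  refine ⟨⟨_, hH⟩, θ ∘ σ, ?_, fun j hj => ?_, hσ2⟩
  · rw [coe_inv_unitary]
    refine eq_mul_diagonal_mul ?_
    have e : Matrix.diagonal (fun j => Complex.exp (Complex.I * (θ ∘ σ) j)) =
        (Matrix.diagonal (fun j => Complex.exp (Complex.I * θ j))).submatrix σ σ :=
      (Matrix.submatrix_diagonal_equiv (fun j => Complex.exp (Complex.I * θ j)) σ).symm
    simp only [e]
    rw [Matrix.submatrix_mul_equiv, ← hgh]
    rfl
  · exact ⟨lt_of_le_of_ne (hθ _).1 (hσ1 j hj).symm, (hθ _).2⟩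

variable {φ : Fin n → ℝ}

theorem IsDiagonalization.mul_eq (hd : IsDiagonalization g h φ) :
    (g : Matrix (Fin n) (Fin n) ℂ) * h = (h : Matrix (Fin n) (Fin n) ℂ) *
      Matrix.diagonal (fun j => Complex.exp (Complex.I * φ j)) := by
  rw [hd.eq, coe_inv_unitary, Matrix.mul_assoc, conjTranspose_mul_unitary, Matrix.mul_one]

theorem IsDiagonalization.angle (hd : IsDiagonalization g h φ) (j : Fin n) :
    φ j = 0 ∨ φ j ∈ Set.Ioo 0 (2 * Real.pi) :=
  (lt_or_ge (j : ℕ) (movedDim g)).elim (fun hj => Or.inr (hd.angle_mem j hj))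
    fun hj => Or.inl (hd.angle_eq_zero j hj)

/-- In the eigenbasis the equation decouples into e^{iφ_j}y_j + (z, e_j) = y_j, which is an
obstruction only where φ_j = 0. -/
theorem hasFixedPoint_iff (hd : IsDiagonalization g h φ) (z : Fin n → ℂ) :
    HasFixedPoint g z ↔ ∀ j : Fin n, movedDim g ≤ (j : ℕ) → herm z (eigvec h j) = 0 := by
  have hz : (h : Matrix (Fin n) (Fin n) ℂ) *ᵥ (fun j => herm z (eigvec h j)) = z := by
    have : (fun j => herm z (eigvec h j)) = (h : Matrix (Fin n) (Fin n) ℂ)ᴴ *ᵥ z :=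
      funext fun j => herm_eigvec h z j
    rw [this, Matrix.mulVec_mulVec, unitary_mul_conjTranspose, Matrix.one_mulVec]
  have hinj : Function.Injective fun y : Fin n → ℂ => (h : Matrix (Fin n) (Fin n) ℂ) *ᵥ y := by
    intro x y hxy
    have := congrArg (fun w => (h : Matrix (Fin n) (Fin n) ℂ)ᴴ *ᵥ w) hxy
    simpa [Matrix.mulVec_mulVec, conjTranspose_mul_unitary] using this
  have key : ∀ y : Fin n → ℂ, ((g : Matrix (Fin n) (Fin n) ℂ).mulVec
      ((h : Matrix (Fin n) (Fin n) ℂ) *ᵥ y) + z = (h : Matrix (Fin n) (Fin n) ℂ) *ᵥ y) ↔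
      ∀ j, Complex.exp (Complex.I * φ j) * y j + herm z (eigvec h j) = y j := by
    intro y
    rw [Matrix.mulVec_mulVec, hd.mul_eq, ← Matrix.mulVec_mulVec]
    nth_rewrite 1 [← hz]
    rw [← Matrix.mulVec_add, hinj.eq_iff, funext_iff]
    simp only [Pi.add_apply, Matrix.mulVec_diagonal]
  constructor
  · rintro ⟨w, hw⟩ j hj
    have hw' : w = (h : Matrix (Fin n) (Fin n) ℂ) *ᵥ ((h : Matrix (Fin n) (Fin n) ℂ)ᴴ *ᵥ w) := by
      rw [Matrix.mulVec_mulVec, unitary_mul_conjTranspose, Matrix.one_mulVec]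
    rw [hw', key] at hw
    have := hw j
    rw [hd.angle_eq_zero j hj] at this
    simpa using this
  · intro hj
    -- Where φ_j = 0 this quotient is 0/0 = 0, an admissible value since there (z, e_j) = 0.
    refine ⟨_, (key fun j => herm z (eigvec h j) / (1 - Complex.exp (Complex.I * φ j))).2
      fun j => ?_⟩
    rcases lt_or_ge (j : ℕ) (movedDim g) with hjm | hjm
    · have h0 : 1 - Complex.exp (Complex.I * φ j) ≠ 0 := fun h0 => by
        refine one_sub_exp_neg_ne_zero (hd.angle_mem j hjm) ?_
        rw [neg_mul, Complex.exp_neg, ← sub_eq_zero.1 h0, inv_one, sub_self]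
      field_simp
      ring
    · simp [hj j hjm]

/-- The range of 1 - g is orthogonal to the fixed space because g is unitary. Conversely, the
columns e_j with j > m are fixed vectors. -/
theorem hasFixedPoint_iff_orthogonal (z : Fin n → ℂ) :
    HasFixedPoint g z ↔ ∀ w ∈ fixedSpace g, herm z w = 0 := by
  have hherm : ∀ x y : Fin n → ℂ, herm x y = star y ⬝ᵥ x := fun x y => by
    simp only [herm, dotProduct, Pi.star_apply, mul_comm]
  constructor
  · rintro ⟨w₀, hw₀⟩ w hw
    have hgw : (g : Matrix (Fin n) (Fin n) ℂ) *ᵥ w = w := hw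
    have hz : z = w₀ - (g : Matrix (Fin n) (Fin n) ℂ) *ᵥ w₀ := (sub_eq_of_eq_add' hw₀.symm).symm
    rw [hherm, hz, dotProduct_sub, sub_eq_zero]
    nth_rewrite 2 [← hgw]
    rw [star_mulVec_dotProduct, Matrix.mulVec_mulVec, conjTranspose_mul_unitary,
      Matrix.one_mulVec]
  · intro hw
    obtain ⟨h, φ, hd⟩ := exists_isDiagonalization g
    refine (hasFixedPoint_iff hd z).2 fun j hj => hw _ ?_
    have h1 : eigvec h j = (h : Matrix (Fin n) (Fin n) ℂ) *ᵥ Pi.single j 1 := by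
      rw [Matrix.mulVec_single_one]
      rfl
    change (g : Matrix (Fin n) (Fin n) ℂ) *ᵥ (eigvec h j) = eigvec h j
    rw [h1, Matrix.mulVec_mulVec, hd.mul_eq, ← Matrix.mulVec_mulVec,
      Matrix.diagonal_mulVec_single, hd.angle_eq_zero j hj]
    simp

end FixedPoints

end

end HeatTrace

namespace HeatTrace

noncomputable section

/-! ### The asymptotics of the traces -/

section Asymptotics

variable {n : ℕ} {g h : Matrix.unitaryGroup (Fin n) ℂ} {φ : Fin n → ℝ}

theorem half_le_norm_one_sub_heatEigval (φ : Fin n → ℝ) (j : Fin n) {t : ℝ} (ht : 0 < t)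
    (ht1 : t ≤ 1) : t / 2 ≤ ‖1 - heatEigval φ t j‖ := by
  have h1 := norm_sub_norm_le (1 : ℂ) (heatEigval φ t j)
  rw [norm_one, norm_heatEigval] at h1
  exact (half_le_one_sub_exp_neg ht.le ht1).trans h1

theorem norm_coordShift_le (h : Matrix.unitaryGroup (Fin n) ℂ) (z : Fin n → ℂ) (j : Fin n) :
    ‖coordShift h z j‖ ≤ absSum (coordShift h z) :=
  Finset.single_le_sum (f := fun j => ‖coordShift h z j‖) (fun _ _ => norm_nonneg _)
    (Finset.mem_univ j)

theorem prod_traceFactor_isBigOInfty_of_not_hasFixedPoint (hd : IsDiagonalization g h φ)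
    {z : Fin n → ℂ} (hz : ¬ HasFixedPoint g z) :
    IsBigOInfty fun t => ∏ j, traceFactor (φ j) (‖herm z (eigvec h j)‖ ^ 2) t := by
  rw [hasFixedPoint_iff hd z] at hz
  push Not at hz
  obtain ⟨j, hj, hzj⟩ := hz
  exact prod_traceFactor_isBigOInfty hd.angle (fun j => by positivity)
    ⟨j, hd.angle_eq_zero j hj, by positivity⟩

theorem prod_traceFactor_isEquivalent_of_hasFixedPoint (hd : IsDiagonalization g h φ)
    {z : Fin n → ℂ} (hz : HasFixedPoint g z) :
    (fun t => ∏ j, traceFactor (φ j) (‖herm z (eigvec h j)‖ ^ 2) t) ~[𝓝[>] (0 : ℝ)] fun t =>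
      ((t : ℂ) ^ (n - movedDim g))⁻¹ *
        ∏ j ∈ Finset.univ.filter (fun j : Fin n => (j : ℕ) < movedDim g),
          Complex.exp (Complex.I / 4 *
            ((‖herm z (eigvec h j)‖ ^ 2 * Real.cot (φ j / 2) : ℝ) : ℂ)) /
              (1 - Complex.exp (-Complex.I * φ j)) :=
  prod_traceFactor_isEquivalent (movedDim_le g) hd.angle_mem hd.angle_eq_zero fun j hj => by
    rw [(hasFixedPoint_iff hd z).1 hz j hj, norm_zero, zero_pow two_ne_zero]

theorem diffTrace_isBigOInfty (hd : IsDiagonalization g h φ) {z : Fin n → ℂ}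
    (hz : ¬ HasFixedPoint g z) (hg : ∃ AB, IsLogarithm (g : Matrix (Fin n) (Fin n) ℂ) AB) {D : ℕ}
    {B : Sch n →L[ℂ] Sch n} (hB : B ∈ normalOps n D) : IsBigOInfty (diffTrace h B z g) := by
  intro N
  -- Since ‖1 - q_j‖ ≥ t/2, the choice ρ = K/t gives ρ‖1 - q_j‖ ≥ K/2, which must exceed both 1 and
  -- 2‖η_j‖. This ρ is not optimal, but its power is lost in the flat product.
  obtain ⟨K, hK⟩ : ∃ K, K = 2 + 4 * absSum (coordShift h z) := ⟨_, rfl⟩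
  have hs := absSum_nonneg (coordShift h z)
  have hρ : ∀ᶠ t in 𝓝[>] (0 : ℝ), 1 ≤ K * t⁻¹ ∧ ∀ j,
      2 * ‖coordShift h z j‖ ≤ K * t⁻¹ * ‖1 - heatEigval φ t j‖ ∧
      1 ≤ (K * t⁻¹) ^ 2 * ‖1 - heatEigval φ t j‖ := by
    filter_upwards [eventually_mem_Ioc] with t ⟨ht, ht1⟩
    have ht2 : 1 ≤ t⁻¹ := (one_le_inv₀ ht).2 ht1
    have h1 : 1 ≤ K * t⁻¹ := one_le_mul_of_one_le_of_one_le (by linarith) ht2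
    have h2 : ∀ j, K / 2 ≤ K * t⁻¹ * ‖1 - heatEigval φ t j‖ := fun j => by
      calc K / 2 = K * t⁻¹ * (t / 2) := by field_simp
        _ ≤ _ := mul_le_mul_of_nonneg_left (half_le_norm_one_sub_heatEigval φ j ht ht1)
          (zero_le_one.trans h1)
    refine ⟨h1, fun j => ⟨le_trans ?_ (h2 j), ?_⟩⟩
    · linarith [norm_coordShift_le h z j]
    · rw [pow_two, mul_assoc]
      exact one_le_mul_of_one_le_of_one_le h1 (le_trans (by linarith) (h2 j))
  have h1 := diffTrace_isBigO hd z hg hρ hB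
  have h2 : (fun t : ℝ => ((K * t⁻¹ : ℝ) : ℂ) ^ D) =O[𝓝[>] 0] fun t => (t⁻¹) ^ D := by
    refine IsBigO.pow (IsBigO.of_bound |K| (Eventually.of_forall fun t => ?_)) D
    rw [Complex.norm_real, norm_mul, Real.norm_eq_abs K]
  refine h1.trans ((h2.mul
    (prod_traceFactor_isBigOInfty_of_not_hasFixedPoint hd hz (N + D))).congr' EventuallyEq.rfl ?_)
  filter_upwards [eventually_mem_Ioc] with t ht
  have h0 : t ≠ 0 := ht.1.ne'
  rw [pow_add, inv_pow, mul_comm, mul_assoc, mul_inv_cancel₀ (pow_ne_zero _ h0), mul_one]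

/-- For φ_j ≠ 0 the number ‖1 - q_j‖ stays away from 0, so any ρ tending to infinity will do. For
φ_j = 0 the fixed point forces η_j = 0, leaving only ρ²‖1 - q_j‖ ≥ 1, for which t^{-1/2} is the
right order. -/
theorem eventually_bounds_of_hasFixedPoint (hd : IsDiagonalization g h φ) {z : Fin n → ℂ}
    (hz : HasFixedPoint g z) :
    ∀ᶠ t in 𝓝[>] (0 : ℝ), 1 ≤ 2 * t ^ (-(1 / 2) : ℝ) ∧ ∀ j,
      2 * ‖coordShift h z j‖ ≤ 2 * t ^ (-(1 / 2) : ℝ) * ‖1 - heatEigval φ t j‖ ∧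
      1 ≤ (2 * t ^ (-(1 / 2) : ℝ)) ^ 2 * ‖1 - heatEigval φ t j‖ := by
  have hlim : Tendsto (fun t : ℝ => 2 * t ^ (-(1 / 2) : ℝ)) (𝓝[>] 0) atTop :=
    (tendsto_rpow_neg_nhdsGT_zero (by norm_num)).const_mul_atTop (by norm_num)
  have h1 := hlim.eventually_ge_atTop 1
  refine h1.and (eventually_all.2 fun j => ?_)
  rcases lt_or_ge (j : ℕ) (movedDim g) with hj | hj
  · have h2 : Tendsto (fun t => ‖1 - heatEigval φ t j‖) (𝓝[>] 0)
        (𝓝 ‖1 - Complex.exp (-Complex.I * φ j)‖) :=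
      ((tendsto_exp_neg_sub (φ j)).const_sub 1).norm
    have h3 : 0 < ‖1 - Complex.exp (-Complex.I * φ j)‖ :=
      norm_pos_iff.2 (one_sub_exp_neg_ne_zero (hd.angle_mem j hj))
    have h4 := hlim.atTop_mul_pos h3 h2
    filter_upwards [h1, h4.eventually_ge_atTop (2 * ‖coordShift h z j‖),
      h4.eventually_ge_atTop 1] with t ht1 ht2 ht3
    refine ⟨ht2, ?_⟩
    rw [pow_two, mul_assoc]
    exact one_le_mul_of_one_le_of_one_le ht1 ht3
  · have h2 : coordShift h z j = 0 := by
      rw [coordShift, (hasFixedPoint_iff hd z).1 hz j hj, star_zero, zero_div]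
    filter_upwards [h1, eventually_mem_Ioc] with t ht1 ⟨ht, ht2⟩
    have h3 := half_le_norm_one_sub_heatEigval φ j ht ht2
    refine ⟨?_, ?_⟩
    · rw [h2, norm_zero, mul_zero]
      positivity
    · have h4 : (t ^ (-(1 / 2) : ℝ)) ^ 2 = t⁻¹ := by
        rw [← Real.rpow_natCast, ← Real.rpow_mul ht.le, ← Real.rpow_neg_one]
        norm_num
      rw [mul_pow, h4]
      calc (1 : ℝ) ≤ 2 ^ 2 * t⁻¹ * (t / 2) := by
            field_simp
            norm_num
        _ ≤ _ := by gcongr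

theorem diffTrace_isBigO_rpow (hd : IsDiagonalization g h φ) {z : Fin n → ℂ}
    (hz : HasFixedPoint g z) (hg : ∃ AB, IsLogarithm (g : Matrix (Fin n) (Fin n) ℂ) AB) {D : ℕ}
    {B : Sch n →L[ℂ] Sch n} (hB : B ∈ normalOps n D) : diffTrace h B z g =O[𝓝[>] (0 : ℝ)]
      fun t => t ^ (-(((n : ℝ) - (movedDim g : ℝ)) + (D : ℝ) / 2)) := by
  have h1 := diffTrace_isBigO hd z hg (eventually_bounds_of_hasFixedPoint hd hz) hB
  have h2 : (fun t : ℝ => ((2 * t ^ (-(1 / 2) : ℝ) : ℝ) : ℂ) ^ D) =O[𝓝[>] 0]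
      fun t => (t ^ (-(1 / 2) : ℝ)) ^ D := by
    refine IsBigO.pow (IsBigO.of_bound 2 (Eventually.of_forall fun t => ?_)) D
    rw [Complex.norm_real, norm_mul, Real.norm_ofNat]
  have h3 : (fun t => ∏ j, traceFactor (φ j) (‖herm z (eigvec h j)‖ ^ 2) t) =O[𝓝[>] (0 : ℝ)]
      fun t => (t ^ (n - movedDim g))⁻¹ := by
    refine (prod_traceFactor_isEquivalent_of_hasFixedPoint hd hz).isBigO.trans ?_
    simp only [mul_comm (((_ : ℂ) ^ _)⁻¹)]
    refine IsBigO.const_mul_left (IsBigO.of_bound 1 (Eventually.of_forall fun t => ?_)) _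
    rw [one_mul, norm_inv, norm_inv, norm_pow, norm_pow, Complex.norm_real]
  refine h1.trans ((h2.mul h3).congr' EventuallyEq.rfl ?_)
  filter_upwards [self_mem_nhdsWithin] with t ht
  have ht : 0 < t := ht
  rw [← Real.rpow_natCast, ← Real.rpow_natCast, ← Real.rpow_mul ht.le, ← Real.rpow_neg ht.le,
    ← Real.rpow_add ht, Nat.cast_sub (movedDim_le g)]
  congr 1
  ring

end Asymptotics

end

end HeatTrace

/-! ### The theorem. -/

open HeatTrace
theorem proposition5p2 {n : ℕ} (g : Matrix.unitaryGroup (Fin n) ℂ) (z : Fin n → ℂ) :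
    -- the trace of `T_z R_g e^{-tH}`
    (∃ τ : ℝ → ℂ,
      (∀ t : ℝ, 0 < t → HasTrace (twistedHeat z g t) (τ t)) ∧
      (¬ HasFixedPoint g z → IsBigOInfty τ) ∧
      (HasFixedPoint g z →
        ∀ (h : Matrix.unitaryGroup (Fin n) ℂ) (φ : Fin n → ℝ),
          IsDiagonalization g h φ →
          τ ~[𝓝[>] (0 : ℝ)] fun t =>
            ((t : ℂ) ^ (n - movedDim g))⁻¹ *
              ∏ j ∈ Finset.univ.filter (fun j : Fin n => (j : ℕ) < movedDim g),
                Complex.exp (Complex.I / 4 *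
                    ((‖herm z (eigvec h j)‖ ^ 2 * Real.cot (φ j / 2) : ℝ) : ℂ)) /
                  (1 - Complex.exp (-Complex.I * φ j)))) ∧
    -- the components of `z`, and the condition for the existence of a fixed point
    (∀ (h : Matrix.unitaryGroup (Fin n) ℂ) (φ : Fin n → ℝ),
      IsDiagonalization g h φ →
      (∀ j, herm z (eigvec h j) =
        ((h⁻¹ : Matrix.unitaryGroup (Fin n) ℂ) : Matrix (Fin n) (Fin n) ℂ).mulVec z j) ∧
      (HasFixedPoint g z ↔
        ∀ j : Fin n, movedDim g ≤ (j : ℕ) →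
          herm z (eigvec h j) = 0)) ∧
    (HasFixedPoint g z ↔ ∀ w ∈ fixedSpace g, herm z w = 0) ∧
    -- the trace of `B T_z R_g e^{-tH}`
    (∀ (d : ℕ), ∀ B ∈ diffOps n d,
      ∃ (Y : ℝ → L2 n →L[ℂ] L2 n) (τ : ℝ → ℂ),
        (∀ t : ℝ, 0 < t → IsDiffOpComp B (twistedHeat z g t) (Y t) ∧
          HasTrace (Y t) (τ t)) ∧
        (¬ HasFixedPoint g z → IsBigOInfty τ) ∧
        (HasFixedPoint g z →
          τ =O[𝓝[>] (0 : ℝ)] fun t =>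
            t ^ (-(((n : ℝ) - (movedDim g : ℝ)) + (d : ℝ) / 2)))) := by
  have hg := exists_isLogarithm g
  obtain ⟨h₀, φ₀, hd₀⟩ := exists_isDiagonalization g
  refine ⟨⟨fun t => ∏ j, traceFactor (φ₀ j) (‖herm z (eigvec h₀ j)‖ ^ 2) t,
    fun t ht => hasTrace_twistedHeat hd₀ z hg ht,
    fun hz => prod_traceFactor_isBigOInfty_of_not_hasFixedPoint hd₀ hz, fun hz h φ hd => ?_⟩,
    fun h φ hd => ⟨herm_eigvec h z, hasFixedPoint_iff hd z⟩, hasFixedPoint_iff_orthogonal z,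
    fun d B hB => ⟨diffTwistedHeat B z g, diffTrace h₀ B z g, fun t ht =>
      ⟨isDiffOpComp_diffTwistedHeat B z hg ht,
        (hasTrace_diffTwistedHeat B z hg ht (conjUnitary h₀)).2⟩,
      fun hz => diffTrace_isBigOInfty hd₀ hz hg (diffOps_le_normalOps n d hB),
      fun hz => diffTrace_isBigO_rpow hd₀ hz hg (diffOps_le_normalOps n d hB)⟩⟩
  -- τ was built from one fixed diagonalization; uniqueness of the trace identifies it, for t > 0,
  -- with the product belonging to the given one.
  refine IsEquivalent.trans (EventuallyEq.isEquivalent ?_)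
    (prod_traceFactor_isEquivalent_of_hasFixedPoint hd hz)
  filter_upwards [self_mem_nhdsWithin] with t ht
  exact (hasTrace_twistedHeat hd₀ z hg ht).unique (hasTrace_twistedHeat hd z hg ht)
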